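/- **Setting.** Let $S,A,O$ be finite sets, $C:S\times A\to[0,1]$ a known cost, $\eta:S\to\Delta_O$ a known observation kernel, where $\Delta_X$ is the set of probability distributions on $X$. A parameter is a transition kernel $\theta:S\times A\to\Delta_S$. For a belief $b\in\Delta_S$ put $c(b,a)=\sum_s C(s,a)b(s)$, $P(o|b,a;\theta)=\sum_{s,s'}\eta(o|s')\theta(s'|s,a)b(s)$, and let $\tau(b,a,o;\theta)(s')\propto\eta(o|s')\sum_s\theta(s'|s,a)b(s)$ be the Bayes update (an observation of probability zero is ignored in the update, so that $\tau$ is always a belief). Let $J(\theta)=\inf_\pi\limsup_{T}\frac1T\sum_{t\le T}\mathbb E[C(s_t,\pi(h_t))]$ be the optimal long-term average cost over stationary belief policies $\pi:\Delta_S\to A$. For $H\ge 0$ let $\Theta_H$ be the set of $\theta$ for which there are a constant $J$ and a bounded $v(\cdot;\theta):\Delta_S\to\mathbb R$ with $\inf v=0$, $\sup v\le H$ and $$J+v(b;\theta)=\min_{a}\Big\{c(b,a)+\sum_oP(o|b,a;\theta)\,v(\tau(b,a,o;\theta);\theta)\Big\}\quad\text{for all } b\in\Delta_S;$$ let $\pi^*(b;\theta)$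 be a minimizer ($v$ and $\pi^*$ chosen jointly measurable). **Protocol.** The parameter $\theta_*$ is drawn from a prior probability distribution $f$ carried by $\Theta_H$, and $s_1\sim h(\cdot;\theta_*)$; at time $t\ge1$, $o_t\sim\eta(\cdot|s_t)$, the agent takes $a_t$, and $s_{t+1}\sim\theta_*(\cdot|s_t,a_t)$. Let $\mathcal F_t=\sigma(a_1,o_1,\dots,a_{t-1},o_{t-1},o_t)$, $\mathcal F_{t+}=\sigma(\mathcal F_t,a_t)$, let $h_t(\cdot;\theta)$ be the belief computed with parameter $\theta$ from the Bayes update of $h(\cdot;\theta)$ by $o_1$ and then $h_{t+1}=\tau(h_t,a_t,o_{t+1};\theta)$, and let $f_t$ be the posterior of $\theta_*$ obtained from $f$ by Bayes' rule. Let $n_t(s,a)$ be the number of visits to $(s,a)$ at times $1,\dots,t-1$, $\tilde n_t=\mathbb E[n_t|\mathcal F_{(t-1)+}]$, $\tilde m_0=0$ and $\tilde m_t=\max\{\tilde m_{t-1},\lceil\tilde n_t\rceil\}$. **Algorithm (PSRL-POMDP).** Episode $k$ has start time $t_k$ and length $T_k$, with $t_1=1$, $T_0=1$. At time $t_k$ a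 parameter $\theta_k\sim f_{t_k}$ is sampled; during the episode $a_t=\pi^*(h_t(\cdot;\theta_k);\theta_k)$. The episode lasts as long as $t\le t_k+T_{k-1}$ and $\tilde m_t(s,a)\le2\tilde m_{t_k}(s,a)$ for all $(s,a)$. Let $k(t)$ be the episode at time $t$. The regret is $R_T=\mathbb E\big[\sum_{t=1}^T(C(s_t,a_t)-J(\theta_*))\,\big|\,\theta_*\big]$. **Assumptions** (for the horizon $T\ge1$). (a) Concentrating belief: for every $\delta\in(0,1)$ and every $t\le T$, with probability at least $1-\delta$, $$\mathbb E\Big[\sum_s|h_t(s;\theta_*)-h_t(s;\theta_{k(t)})|\Big]\le\frac{K_1(\delta)}{\sqrt{t_{k(t)}}}.$$ The expectation may be unconditional, conditional on $\theta_*$, or conditional on any other fixed σ-algebra. (b) Transition-kernel concentration: there are $\mathcal F_t$-measurable estimators $\hat\theta_t:S\times A\to\Delta_S$ such that, for every $\delta\in(0,1)$, with probability at least $1-\delta$, $$\sum_{s'}|\theta_*(s'|s,a)-\hat\theta_t(s'|s,a)|\le\frac{K_2(\delta)}{\sqrt{\max\{1,\tilde m_t(s,a)\}}}\quad\text{for all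 }t\le T\text{ and all }(s,a).$$ **Theorem.** (1) For every such problem and every $T\ge1$ for which (a) and (b) hold, $\sum_{t=1}^T(C(s_t,a_t)-J(\theta_*))$ is integrable, and with $K_1=K_1(\delta_1)$, $\delta_1=\frac1{2T\max\{1,H\}}$, and $K_2=K_2(\delta_2)$, $\delta_2=\frac1{4T^2}$, $$\mathbb E[R_T]\le(1+H)\sqrt{2T(1+|S||A|\log_2(T+1))}+12HK_2(|S||A|T)^{2/3}+7(H+1)K_1\sqrt{2T}\,(1+|S||A|\log_2(T+1))\log\sqrt{2T}+2+H .$$ (2) Suppose in addition that $K_i(\delta)=p_i(|S|,|A|,|O|,\iota)$ with $\iota=\log(|S||A||O|T/\delta)$ and fixed real polynomials $p_1,p_2$, and let $H_0>0$. Then $\mathbb E[R_T]=\tilde O(H(|S||A|T)^{2/3})$ in the following sense: there are $T_0$, $C$ and $q$, depending only on $S,A,O,p_1,p_2,H_0$, such that for every such problem with $H\ge H_0$ and every $T$ for which (a) and (b) hold, $$\mathbb E[R_T]\le13\,H\max\{1,K_2(\tfrac1{4T^2})\}(|S||A|T)^{2/3}\ \text{ if }T\ge T_0,\qquad \mathbb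 E[R_T]\le C\,H(|S||A|T)^{2/3}(\log T)^q\ \text{ if }T\ge2 .$$ -/

import Mathlib

open MeasureTheory ProbabilityTheory
open scoped ENNReal

universe uΩ

noncomputable section

/-- Probability distributions on a finite set: the beliefs `Δ_S`. -/
abbrev Belief (S : Type*) [Fintype S] : Type _ := stdSimplex ℝ S

/-- Transition kernels `θ : S × A → Δ_S`, with `θ s a s' = θ(s' | s, a)`.  This is the space of all
parameters; it carries the Borel σ-algebra of the finite-dimensional space it lives in. -/
abbrev TransKernel (S A : Type*) [Fintype S] : Type _ := S → A → Belief S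

/-- The normalisation `w / ∑ w` of a nonnegative weight vector.  Where the total weight is zero
(a conditional law given an event of probability zero) the value is the fallback `b`. -/
def normalizeOr {S : Type*} [Fintype S] (w : S → ℝ) (hw : ∀ s, 0 ≤ w s) (b : Belief S) :
    Belief S :=
  open Classical in
  if h : 0 < ∑ s, w s then
    ⟨fun s => w s / ∑ r, w r, fun s => div_nonneg (hw s) h.le, by
      rw [← Finset.sum_div]; exact div_self h.ne'⟩
  else b

/-- The known part of the POMDP: the cost function `C : S × A → [0,1]` and the observation kernel
`η : S → Δ_O`. -/
structure POMDP (S A O : Type*) [Fintype S] [Fintype A] [Fintype O] where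
  cost : S → A → ℝ
  cost_nonneg : ∀ s a, 0 ≤ cost s a
  cost_le_one : ∀ s a, cost s a ≤ 1
  obsKernel : S → stdSimplex ℝ O

namespace POMDP

variable {S A O : Type*} [Fintype S] [Fintype A] [Fintype O] (M : POMDP S A O)

/-- The law of the next state, `∑ s, θ(s' | s, a) b(s)`. -/
def predict (θ : TransKernel S A) (b : Belief S) (a : A) : Belief S :=
  ⟨fun s' => ∑ s, θ s a s' * b s,
    fun _ => Finset.sum_nonneg fun s _ => mul_nonneg ((θ s a).2.1 _) (b.2.1 s), by
      rw [Finset.sum_comm]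
      simp_rw [← Finset.sum_mul]
      have h : ∀ s, ∑ s', θ s a s' = 1 := fun s => (θ s a).2.2
      simp_rw [h, one_mul]
      exact b.2.2⟩

/-- Bayes update of a distribution of the state after the observation `o`:
`η(o | s) b(s) / ∑ s, η(o | s) b(s)`.  An observation of probability zero is ignored. -/
def bayes (b : Belief S) (o : O) : Belief S :=
  normalizeOr (fun s => M.obsKernel s o * b s)
    (fun s => mul_nonneg ((M.obsKernel s).2.1 o) (b.2.1 s)) b

/-- The belief update `τ(b, a, o; θ)`. -/
def tau (θ : TransKernel S A) (b : Belief S) (a : A) (o : O) : Belief S :=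
  M.bayes (predict θ b a) o

/-- Expected cost `c(b, a) = ∑ s, C(s, a) b(s)`. -/
def expCost (b : Belief S) (a : A) : ℝ := ∑ s, M.cost s a * b s

/-- `P(o | b, a; θ) = ∑ s', ∑ s, η(o | s') θ(s' | s, a) b(s)`. -/
def obsProb (θ : TransKernel S A) (b : Belief S) (a : A) (o : O) : ℝ :=
  ∑ s', ∑ s, M.obsKernel s' o * θ s a s' * b s

/-- The quantity minimised over `a` in the Bellman equation:
`c(b, a) + ∑ o, P(o | b, a; θ) v(τ(b, a, o; θ))`. -/
def bellmanRHS (θ : TransKernel S A) (v : Belief S → ℝ) (b : Belief S) (a : A) : ℝ :=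
  M.expCost b a + ∑ o, M.obsProb θ b a o * v (M.tau θ b a o)

/-- `v` is a relative value function of `θ`, normalised by `inf v = 0`, with span `sup v ≤ H`:
it is bounded and solves the Bellman optimality equation with some constant `J`.  The class `Θ_H`
consists of the `θ` that have such a `v`. -/
def IsRelValue (H : ℝ) (θ : TransKernel S A) (v : Belief S → ℝ) : Prop :=
  (∃ B : ℝ, ∀ b, |v b| ≤ B) ∧
  (∃ J : ℝ, ∀ b, IsLeast (Set.range (M.bellmanRHS θ v b)) (J + v b)) ∧
  (⨅ b, v b) = 0 ∧ (⨆ b, v b) ≤ H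

/-- Expected cost `n` steps ahead under the belief policy `π` for the transition kernel `θ`, when
the current state is `s` and the current belief of the agent is `b`. -/
def costAhead (θ : TransKernel S A) (π : Belief S → A) : ℕ → S → Belief S → ℝ
  | 0, s, b => M.cost s (π b)
  | n + 1, s, b =>
      ∑ s', θ s (π b) s' * ∑ o, M.obsKernel s' o * costAhead θ π n s' (M.tau θ b (π b) o)

/-- `E[C(s_t, π(h_t))]` for `t = n + 1`, when `s_1 ∼ h`, the first observation is drawn from
`η(· | s_1)`, and `h_1` is the Bayes update of `h`. -/
def costAt (θ : TransKernel S A) (π : Belief S → A) (h : Belief S) (n : ℕ) : ℝ :=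
  ∑ s, h s * ∑ o, M.obsKernel s o * M.costAhead θ π n s (M.bayes h o)

/-- Long-term average cost `J_π(h; θ)`. -/
def avgCost (θ : TransKernel S A) (π : Belief S → A) (h : Belief S) : ℝ :=
  Filter.limsup (fun T : ℕ => (∑ n ∈ Finset.range T, M.costAt θ π h n) / (T : ℝ)) Filter.atTop

/-- Optimal long-term average cost `J(h; θ) = inf_π J_π(h; θ)` over the deterministic stationary
belief policies. -/
def optCost (θ : TransKernel S A) (h : Belief S) : ℝ := ⨅ π : Belief S → A, M.avgCost θ π h

end POMDP

/-- The input of the learning problem and of the algorithm: the known part of the POMDP, the prior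
`f` of the parameter, the law `h(· ; θ)` of the initial state, and for each parameter the relative
value function `v(· ; θ)` and the policy `π^*(· ; θ)`. -/
structure Setup (S A O : Type*) [Fintype S] [Fintype A] [Fintype O] extends POMDP S A O where
  prior : Measure (TransKernel S A)
  init : TransKernel S A → Belief S
  value : TransKernel S A → Belief S → ℝ
  policy : TransKernel S A → Belief S → A

namespace Setup

variable {S A O : Type*} [Fintype S] [Fintype A] [Fintype O] (L : Setup S A O)

/-- The prior is a probability measure carried by `Θ_H`: for almost every parameter, `v(· ; θ)` is a
normalised relative value function with span at most `H` and `π^*(b ; θ)` minimises the right-hand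
side of the Bellman equation at every belief `b`. -/
structure IsAdmissible [MeasurableSpace A] (H : ℝ) : Prop where
  prob : IsProbabilityMeasure L.prior
  init_meas : Measurable L.init
  value_meas : Measurable fun x : TransKernel S A × Belief S => L.value x.1 x.2
  policy_meas : Measurable fun x : TransKernel S A × Belief S => L.policy x.1 x.2
  bellman : ∀ᵐ θ ∂L.prior, L.toPOMDP.IsRelValue H θ (L.value θ)
  argmin : ∀ᵐ θ ∂L.prior, ∀ b a,
    L.toPOMDP.bellmanRHS θ (L.value θ) b (L.policy θ b) ≤ L.toPOMDP.bellmanRHS θ (L.value θ) b a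

/-- The belief `h_t(· ; θ)` computed from actions `a_1, …, a_{t-1}` and observations
`o_1, …, o_t`.  Time starts at `1`; the value at time `0` is the law of the initial state. -/
def belief (act : ℕ → A) (obs : ℕ → O) : ℕ → TransKernel S A → Belief S
  | 0, θ => L.init θ
  | 1, θ => L.toPOMDP.bayes (L.init θ) (obs 1)
  | t + 2, θ => L.toPOMDP.tau θ (belief act obs (t + 1) θ) (act (t + 1)) (obs (t + 2))

/-- The posterior `f_t` of the parameter, updated by Bayes' rule.  The value at time `0` is the
prior. -/
def posterior (act : ℕ → A) (obs : ℕ → O) : ℕ → Measure (TransKernel S A)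
  | 0 => L.prior
  | 1 =>
      let ν := L.prior.withDensity fun θ =>
        ENNReal.ofReal (∑ s, L.obsKernel s (obs 1) * L.init θ s)
      (ν Set.univ)⁻¹ • ν
  | t + 2 =>
      let ν := (posterior act obs (t + 1)).withDensity fun θ =>
        ENNReal.ofReal
          (L.toPOMDP.obsProb θ (L.belief act obs (t + 1) θ) (act (t + 1)) (obs (t + 2)))
      (ν Set.univ)⁻¹ • ν

end Setup

/-- The random variables of an interaction: the true parameter `θ_*`, and at each time `t ≥ 1` the
state, the observation, the action, and the sampled parameter `θ_{k(t)}` in use at time `t`, where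
`k(t)` is the episode at time `t`.  The values at index `0` play no role. -/
structure Trajectory (S A O : Type*) [Fintype S] (Ω : Type*) where
  param : Ω → TransKernel S A
  state : ℕ → Ω → S
  obs : ℕ → Ω → O
  act : ℕ → Ω → A
  sample : ℕ → Ω → TransKernel S A

/-- The episodes generated by counts `m`, with schedule `t_k + T_{k-1}`.  The value at time `t` is
`(t_k, T_{k-1})` for the episode `k` at time `t`; the value `(0, 0)` at time `0` is the
initialisation, which gives `t_1 = 1` and `T_0 = 1`. -/
def episode {S A : Type*} [Fintype S] [Fintype A] (m : ℕ → S → A → ℕ) : ℕ → ℕ × ℕ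
  | 0 => (0, 0)
  | t + 1 =>
      open Classical in
      if t + 1 ≤ (episode m t).1 + (episode m t).2 ∧
          ∀ s a, m (t + 1) s a ≤ 2 * m (episode m t).1 s a then
        episode m t
      else (t + 1, t + 1 - (episode m t).1)

namespace Trajectory

variable {S A O : Type*} [Fintype S] [Fintype A] [Fintype O]
  [MeasurableSpace S] [MeasurableSpace A] [MeasurableSpace O]
  {Ω : Type*} (X : Trajectory S A O Ω)

/-- `F_t`, generated by `a_1, o_1, …, a_{t-1}, o_{t-1}, o_t`. -/
@[reducible] def hist (t : ℕ) : MeasurableSpace Ω :=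
  (⨆ i ∈ Finset.Icc 1 t, MeasurableSpace.comap (X.obs i) inferInstance) ⊔
    ⨆ i ∈ Finset.Ico 1 t, MeasurableSpace.comap (X.act i) inferInstance

/-- `F_{t+}`, generated by `F_t` and `a_t` (trivial for `t = 0`). -/
@[reducible] def histPlus (t : ℕ) : MeasurableSpace Ω :=
  ⨆ i ∈ Finset.Icc 1 t,
    (MeasurableSpace.comap (X.obs i) inferInstance ⊔
      MeasurableSpace.comap (X.act i) inferInstance)

/-- The σ-algebra generated by `θ_*`, the first `i` states, the first `j` observations, and the
sampled parameters and actions up to time `k`. -/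
@[reducible] def full (i j k : ℕ) : MeasurableSpace Ω :=
  MeasurableSpace.comap X.param inferInstance ⊔
    (⨆ l ∈ Finset.Icc 1 i, MeasurableSpace.comap (X.state l) inferInstance) ⊔
    (⨆ l ∈ Finset.Icc 1 j, MeasurableSpace.comap (X.obs l) inferInstance) ⊔
    ⨆ l ∈ Finset.Icc 1 k,
      (MeasurableSpace.comap (X.sample l) inferInstance ⊔
        MeasurableSpace.comap (X.act l) inferInstance)

/-- The number `n_t(s, a)` of visits to `(s, a)` at the times `1, …, t - 1`. -/
def visits (t : ℕ) (s : S) (a : A) (ω : Ω) : ℕ :=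
  open Classical in
  ((Finset.Ico 1 t).filter fun i => X.state i ω = s ∧ X.act i ω = a).card

variable [MeasurableSpace Ω] (P : Measure Ω)

/-- `ñ_t(s, a) = E[n_t(s, a) | F_{(t-1)+}]`. -/
def expVisits (t : ℕ) (s : S) (a : A) : Ω → ℝ :=
  P[fun ω => (X.visits t s a ω : ℝ) | X.histPlus (t - 1)]

/-- The pseudo-count `m̃_t(s, a) = max {m̃_{t-1}(s, a), ⌈ñ_t(s, a)⌉}`, with `m̃_0 = 0`. -/
def pseudoCount (ω : Ω) : ℕ → S → A → ℕ
  | 0, _, _ => 0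
  | t + 1, s, a => max (pseudoCount ω t s a) ⌈X.expVisits P (t + 1) s a ω⌉₊

/-- The start time `t_{k(t)}` of the episode at time `t`. -/
def epStart (t : ℕ) (ω : Ω) : ℕ := (episode (X.pseudoCount P ω) t).1

variable (L : Setup S A O)

/-- The belief `h_t(· ; θ)` along the trajectory. -/
def beliefAt (t : ℕ) (θ : TransKernel S A) (ω : Ω) : Belief S :=
  L.belief (fun i => X.act i ω) (fun i => X.obs i ω) t θ

/-- The posterior `f_t` along the trajectory. -/
def posteriorAt (t : ℕ) (ω : Ω) : Measure (TransKernel S A) :=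
  L.posterior (fun i => X.act i ω) (fun i => X.obs i ω) t

/-- Under `P`, the variables `X` are distributed as the interaction of the PSRL-POMDP algorithm with
a POMDP whose parameter is drawn from the prior.  Everything is generated in the order
`θ_*, s_1, o_1, θ_{k(1)}, a_1, s_2, o_2, θ_{k(2)}, a_2, …`. -/
structure IsPSRLRun : Prop where
  param_meas : Measurable X.param
  state_meas : ∀ t, Measurable (X.state t)
  obs_meas : ∀ t, Measurable (X.obs t)
  act_meas : ∀ t, Measurable (X.act t)
  sample_meas : ∀ t, Measurable (X.sample t)
  /-- `θ_* ∼ f` -/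
  param_law : P.map X.param = L.prior
  /-- given `θ_*`, `s_1 ∼ h(· ; θ_*)` -/
  init_law : ∀ s, P⟦X.state 1 ⁻¹' {s} | X.full 0 0 0⟧ =ᵐ[P] fun ω => L.init (X.param ω) s
  /-- given the past, `s_{t+1} ∼ θ_*(· | s_t, a_t)` -/
  state_law : ∀ t, 1 ≤ t → ∀ s,
    P⟦X.state (t + 1) ⁻¹' {s} | X.full t t t⟧ =ᵐ[P]
      fun ω => X.param ω (X.state t ω) (X.act t ω) s
  /-- given the past, `o_t ∼ η(· | s_t)` -/
  obs_law : ∀ t, 1 ≤ t → ∀ o,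
    P⟦X.obs t ⁻¹' {o} | X.full t (t - 1) (t - 1)⟧ =ᵐ[P] fun ω => L.obsKernel (X.state t ω) o
  /-- where a new episode starts at time `t`, its parameter is drawn from `f_t`, given the past -/
  sample_law : ∀ t, 1 ≤ t → ∀ B : Set (TransKernel S A), MeasurableSet B →
    ∀ᵐ ω ∂P, X.epStart P t ω = t →
      (P⟦X.sample t ⁻¹' B | X.full t t (t - 1)⟧) ω = (X.posteriorAt L t ω).real B
  /-- inside an episode the sampled parameter is kept -/
  sample_keep : ∀ t, 1 ≤ t → ∀ᵐ ω ∂P, X.epStart P (t + 1) ω ≠ t + 1 →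
    X.sample (t + 1) ω = X.sample t ω
  /-- `a_t = π^*(h_t(· ; θ_{k(t)}) ; θ_{k(t)})` -/
  act_eq : ∀ t, 1 ≤ t → ∀ᵐ ω ∂P,
    X.act t ω = L.policy (X.sample t ω) (X.beliefAt L t (X.sample t ω) ω)

/-- `∑_{t ≤ T} [C(s_t, a_t) - J(θ_*)]`, with `J(θ_*)` the optimal long-term average cost. -/
def excessCost (T : ℕ) (ω : Ω) : ℝ :=
  ∑ t ∈ Finset.Icc 1 T,
    (L.cost (X.state t ω) (X.act t ω) - L.toPOMDP.optCost (X.param ω) (L.init (X.param ω)))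

/-- The regret `R_T`, a conditional expectation given `θ_*`. -/
def regret (T : ℕ) : Ω → ℝ :=
  P[X.excessCost L T | MeasurableSpace.comap X.param inferInstance]

/-- Concentration of the transition kernel: some estimators `θ̂_t`, measurable with respect to
`F_t`, are close to `θ_*` with probability at least `1 - δ`, uniformly in `t ≤ T`. -/
def TransitionConcentration (T : ℕ) (K : ℝ → ℝ) : Prop :=
  ∃ est : ℕ → Ω → TransKernel S A,
    (∀ t, 1 ≤ t → t ≤ T → Measurable[X.hist t] (est t)) ∧
    ∀ δ : ℝ, 0 < δ → δ < 1 →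
      1 - δ ≤ P.real {ω | ∀ t, 1 ≤ t → t ≤ T → ∀ s a,
        ∑ s', |X.param ω s a s' - est t ω s a s'|
          ≤ K δ / Real.sqrt (max 1 (X.pseudoCount P ω t s a : ℝ))}

end Trajectory

namespace Trajectory

variable {S A O : Type*} [Fintype S] [Fintype A] [Fintype O]
  [MeasurableSpace S] [MeasurableSpace A] [MeasurableSpace O] {Ω : Type*}
  (X : Trajectory S A O Ω) (𝒢 : MeasurableSpace Ω) [MeasurableSpace Ω] (P : Measure Ω)
  (L : Setup S A O)

/-- Concentrating belief, up to time `T`, with constant `K δ` at confidence level `1 - δ`.  The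
expectation of the belief error is conditional on `𝒢`: the trivial σ-algebra gives the unconditional
expectation, the one generated by `θ_*` the conditional expectation given `θ_*`. -/
def ConcentratingBelief (T : ℕ) (K : ℝ → ℝ) : Prop :=
  ∀ δ : ℝ, 0 < δ → δ < 1 → ∀ t : ℕ, 1 ≤ t → t ≤ T →
    1 - δ ≤ P.real {ω |
      (P[fun ω' => ∑ s, |X.beliefAt L t (X.param ω') ω' s -
          X.beliefAt L t (X.sample t ω') ω' s| | 𝒢]) ω
        ≤ K δ / Real.sqrt (X.epStart P t ω)}

end Trajectory

/-- A constant `K(|S|, |A|, |O|, ι)` that is polynomial in its arguments, as a function of `δ`,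
where `ι = log (|S| |A| |O| T / δ)`. -/
def polyLogConst (S A O : Type*) [Fintype S] [Fintype A] [Fintype O] (p : MvPolynomial (Fin 4) ℝ)
    (T : ℕ) (δ : ℝ) : ℝ :=
  MvPolynomial.eval
    ![(Fintype.card S : ℝ), (Fintype.card A : ℝ), (Fintype.card O : ℝ),
      Real.log (Fintype.card S * Fintype.card A * Fintype.card O * T / δ)] p

end

/-! The regret is bounded by a comparison with the Bellman equation of the sampled parameter θ_k,
taken at the belief h_t(θ_k) and at the action actually played. In expectation the cost at time t is
J(θ_k), plus the drop of v(·; θ_k) from the current to the next belief, plus an error: θ_k predicts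
cost and observation from h_t(θ_k), while the data follow θ_* and h_t(θ_*). Both predictions average
the same function of the next observation, with values in [0, H], so no continuity of v is needed.
The error is at most 1 + H times the l¹ distance of the two beliefs plus H times the l¹ distance of
the two transition laws at (s_t, a_t) (`integral_cost_le`).

This rests on two filtering facts. Given θ_* and all that the agent has seen and drawn, the state
has the law computed with θ_* (`condEq_state_pred`, `condEq_state`); given only what the agent has
seen and drawn, θ_* has the posterior law (`condEq_param`). Both are proved by induction over the
order in which the run is generated; the sampled parameter and the action bring no new information,
because given the whole past their law depends only on what the agent knows. Hence, where an episode
starts, θ_k and θ_* have the same law jointly with the history (`map_sample_eq_map_param`). Moreover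
the constant of the Bellman equation is the optimal average cost (`optCost_eq`).

Summation over t leaves four terms. The costs J(θ_k): an episode lasts at most T_{k-1} + 1 steps, a
number known at its start, so θ_k may be exchanged for θ_*; as the T_{k-1} add up to at most T, the
excess over T·J(θ_*) is at most the number of episodes (`sum_integral_bellmanConst_le`). The values:
they telescope inside an episode and cost at most H per episode (`sum_integral_val_le`). The number
of episodes is at most √(2T(1 + |S||A| log₂(T+1))) (`numStarts_le_sqrt`): counts can double only
|S||A| log₂(T+1) times, and between two doublings the lengths grow by one each time. The beliefs:
assumption (a) and t ≤ 2t_k give a multiple of √T (`sum_integral_beliefErr_le`). The kernels: θ_*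
and, by the equality of laws, θ_k are close to the estimator of the start time
(`sum_integral_kernelErr_le`), which leaves the sum of the inverse roots of the pseudo-counts at
(s_t, a_t). A pseudo-count dominates only a conditional expectation of the visit count n. By
Markov's inequality it is below 0.9·α·n with probability at most α (`probReal_condExp_lt_le`), so
with N = |S||A|T the sum is at most αN + O(√(N/α)), and α = N^(-1/3) gives N^(2/3), the dominant
rate (`sum_integral_invSqrtCount_le_rpow`).

For the rate, polynomials in ι are powers of 1 + log T as long as H ≤ T, while for H > T the trivial
bound T on the regret suffices. -/

set_option linter.unusedSectionVars false

/-! ### Beliefs and normalisation -/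

section NormalizeOr

variable {S : Type*} [Fintype S]

theorem normalizeOr_apply (w : S → ℝ) (hw : ∀ s, 0 ≤ w s) (b : Belief S) (s : S) :
    normalizeOr w hw b s = if 0 < ∑ r, w r then w s / ∑ r, w r else b s := by
  unfold normalizeOr
  split_ifs <;> rfl

/-- Nonnegative weights with sum zero all vanish, so the fallback value is harmless once the
normalisation is multiplied out. Bayes' rule is used in this division-free form throughout. -/
theorem normalizeOr_mul_sum (w : S → ℝ) (hw : ∀ s, 0 ≤ w s) (b : Belief S) (s : S) :
    normalizeOr w hw b s * ∑ r, w r = w s := by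
  rw [normalizeOr_apply]
  split_ifs with h
  · exact div_mul_cancel₀ _ h.ne'
  · have h0 : ∑ r, w r = 0 := le_antisymm (not_lt.1 h) (Finset.sum_nonneg fun r _ => hw r)
    rw [h0, mul_zero]
    exact ((Finset.sum_eq_zero_iff_of_nonneg fun r _ => hw r).1 h0 s (Finset.mem_univ s)).symm

theorem Belief.nonneg (b : Belief S) (s : S) : 0 ≤ b s := b.2.1 s

theorem Belief.sum_eq_one (b : Belief S) : ∑ s, b s = 1 := b.2.2

theorem Belief.le_one (b : Belief S) (s : S) : b s ≤ 1 := by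
  rw [← b.sum_eq_one]
  exact Finset.single_le_sum (fun r _ => b.nonneg r) (Finset.mem_univ s)

theorem Belief.sum_abs_sub_le (b b' : Belief S) : ∑ s, |b s - b' s| ≤ 2 := by
  calc ∑ s, |b s - b' s| ≤ ∑ s, (b s + b' s) := Finset.sum_le_sum fun s _ => by
        have h1 := b.nonneg s
        have h2 := b'.nonneg s
        rw [abs_le]; constructor <;> linarith
    _ = 2 := by rw [Finset.sum_add_distrib, b.sum_eq_one, b'.sum_eq_one]; norm_num

theorem Belief.sum_mul_le (b : Belief S) {f : S → ℝ} {c : ℝ} (hf : ∀ s, f s ≤ c) :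
    ∑ s, b s * f s ≤ c := by
  calc ∑ s, b s * f s ≤ ∑ s, b s * c :=
        Finset.sum_le_sum fun s _ => mul_le_mul_of_nonneg_left (hf s) (b.nonneg s)
    _ = c := by rw [← Finset.sum_mul, b.sum_eq_one, one_mul]

theorem Belief.le_sum_mul (b : Belief S) {f : S → ℝ} {c : ℝ} (hf : ∀ s, c ≤ f s) :
    c ≤ ∑ s, b s * f s := by
  calc c = ∑ s, b s * c := by rw [← Finset.sum_mul, b.sum_eq_one, one_mul]
    _ ≤ ∑ s, b s * f s :=
        Finset.sum_le_sum fun s _ => mul_le_mul_of_nonneg_left (hf s) (b.nonneg s)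

end NormalizeOr

/-! ### The Bellman constant is the optimal average cost -/

namespace POMDP

variable {S A O : Type*} [Fintype S] [Fintype A] [Fintype O] (M : POMDP S A O)

theorem predict_apply (θ : TransKernel S A) (b : Belief S) (a : A) (s' : S) :
    predict θ b a s' = ∑ s, θ s a s' * b s := rfl

/-- The probability of the observation `o` when the state has law `b`. -/
noncomputable def obsWeight (b : Belief S) (o : O) : ℝ := ∑ s, M.obsKernel s o * b s

theorem obsWeight_nonneg (b : Belief S) (o : O) : 0 ≤ M.obsWeight b o :=
  Finset.sum_nonneg fun s _ => mul_nonneg ((M.obsKernel s).2.1 o) (b.nonneg s)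

theorem sum_obsWeight_mul (b : Belief S) (f : O → ℝ) :
    ∑ o, M.obsWeight b o * f o = ∑ s, b s * ∑ o, M.obsKernel s o * f o := by
  simp_rw [obsWeight, Finset.sum_mul, Finset.mul_sum]
  rw [Finset.sum_comm]
  exact Finset.sum_congr rfl fun s _ => Finset.sum_congr rfl fun o _ => by ring

theorem sum_obsWeight (b : Belief S) : ∑ o, M.obsWeight b o = 1 := by
  have h := M.sum_obsWeight_mul b fun _ => 1
  simp only [mul_one] at h
  rw [h]
  simp_rw [fun s => Belief.sum_eq_one (M.obsKernel s), mul_one]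
  exact b.sum_eq_one

theorem bayes_mul_obsWeight (b : Belief S) (o : O) (s : S) :
    M.bayes b o s * M.obsWeight b o = M.obsKernel s o * b s :=
  normalizeOr_mul_sum _ _ _ s

theorem obsProb_eq (θ : TransKernel S A) (b : Belief S) (a : A) (o : O) :
    M.obsProb θ b a o = M.obsWeight (predict θ b a) o := by
  simp_rw [obsProb, obsWeight, predict_apply, Finset.mul_sum, mul_assoc]

theorem obsProb_nonneg (θ : TransKernel S A) (b : Belief S) (a : A) (o : O) :
    0 ≤ M.obsProb θ b a o := by
  rw [obsProb_eq]; exact M.obsWeight_nonneg _ _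

theorem sum_obsProb (θ : TransKernel S A) (b : Belief S) (a : A) :
    ∑ o, M.obsProb θ b a o = 1 := by
  simp_rw [obsProb_eq]; exact M.sum_obsWeight _

theorem obsProb_le_one (θ : TransKernel S A) (b : Belief S) (a : A) (o : O) :
    M.obsProb θ b a o ≤ 1 := by
  rw [← M.sum_obsProb θ b a]
  exact Finset.single_le_sum (fun o _ => M.obsProb_nonneg θ b a o) (Finset.mem_univ o)

theorem obsWeight_le_one (b : Belief S) (o : O) : M.obsWeight b o ≤ 1 := by
  rw [← M.sum_obsWeight b]
  exact Finset.single_le_sum (fun o _ => M.obsWeight_nonneg b o) (Finset.mem_univ o)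

theorem expCost_nonneg (b : Belief S) (a : A) : 0 ≤ M.expCost b a :=
  Finset.sum_nonneg fun s _ => mul_nonneg (M.cost_nonneg s a) (b.nonneg s)

theorem expCost_le_one (b : Belief S) (a : A) : M.expCost b a ≤ 1 := by
  simp_rw [expCost, mul_comm (M.cost _ a)]
  exact b.sum_mul_le fun s => M.cost_le_one s a

/-- Expected cost `n` steps ahead when the state has the law that the agent believes in. -/
noncomputable def beliefCost (θ : TransKernel S A) (π : Belief S → A) (n : ℕ) (b : Belief S) : ℝ :=
  ∑ s, b s * M.costAhead θ π n s b

/-- The joint weight of state and observation disintegrates as the law of the observation times the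
Bayes update. This reduces costs of the hidden state to costs of the belief process. -/
theorem sum_mul_costAhead_bayes (θ : TransKernel S A) (π : Belief S → A) (n : ℕ) (b : Belief S) :
    ∑ s, b s * ∑ o, M.obsKernel s o * M.costAhead θ π n s (M.bayes b o) =
      ∑ o, M.obsWeight b o * M.beliefCost θ π n (M.bayes b o) := by
  simp_rw [beliefCost, Finset.mul_sum]
  rw [Finset.sum_comm]
  refine Finset.sum_congr rfl fun o _ => Finset.sum_congr rfl fun s _ => ?_
  rw [← mul_assoc, ← mul_assoc, mul_comm (M.obsWeight b o), bayes_mul_obsWeight,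
    mul_comm (b s)]

theorem beliefCost_zero (θ : TransKernel S A) (π : Belief S → A) (b : Belief S) :
    M.beliefCost θ π 0 b = M.expCost b (π b) := by
  simp_rw [beliefCost, costAhead, expCost, mul_comm]

theorem beliefCost_succ (θ : TransKernel S A) (π : Belief S → A) (n : ℕ) (b : Belief S) :
    M.beliefCost θ π (n + 1) b =
      ∑ o, M.obsProb θ b (π b) o * M.beliefCost θ π n (M.tau θ b (π b) o) := by
  simp_rw [obsProb_eq, tau]
  rw [← sum_mul_costAhead_bayes]
  simp_rw [beliefCost, costAhead, predict_apply, Finset.sum_mul, tau]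
  rw [Finset.sum_comm]
  refine Finset.sum_congr rfl fun s _ => ?_
  rw [Finset.mul_sum]
  exact Finset.sum_congr rfl fun s' _ => by ring

theorem costAt_eq (θ : TransKernel S A) (π : Belief S → A) (h : Belief S) (n : ℕ) :
    M.costAt θ π h n = ∑ o, M.obsWeight h o * M.beliefCost θ π n (M.bayes h o) :=
  M.sum_mul_costAhead_bayes θ π n h

theorem costAhead_mem (θ : TransKernel S A) (π : Belief S → A) (n : ℕ) (s : S) (b : Belief S) :
    0 ≤ M.costAhead θ π n s b ∧ M.costAhead θ π n s b ≤ 1 := by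
  induction n generalizing s b with
  | zero => exact ⟨M.cost_nonneg _ _, M.cost_le_one _ _⟩
  | succ n ih =>
    exact ⟨Belief.le_sum_mul _ fun s' => Belief.le_sum_mul _ fun o => (ih s' _).1,
      Belief.sum_mul_le _ fun s' => Belief.sum_mul_le _ fun o => (ih s' _).2⟩

theorem costAt_mem (θ : TransKernel S A) (π : Belief S → A) (h : Belief S) (n : ℕ) :
    0 ≤ M.costAt θ π h n ∧ M.costAt θ π h n ≤ 1 :=
  ⟨Belief.le_sum_mul _ fun _ => Belief.le_sum_mul _ fun _ => (M.costAhead_mem _ _ _ _ _).1,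
    Belief.sum_mul_le _ fun _ => Belief.sum_mul_le _ fun _ => (M.costAhead_mem _ _ _ _ _).2⟩

theorem avg_costAt_mem (θ : TransKernel S A) (π : Belief S → A) (h : Belief S) (T : ℕ) :
    0 ≤ (∑ n ∈ Finset.range T, M.costAt θ π h n) / (T : ℝ) ∧
      (∑ n ∈ Finset.range T, M.costAt θ π h n) / (T : ℝ) ≤ 1 := by
  constructor
  · exact div_nonneg (Finset.sum_nonneg fun n _ => (M.costAt_mem θ π h n).1) T.cast_nonneg
  · refine div_le_one_of_le₀ ?_ T.cast_nonneg
    calc _ ≤ ∑ n ∈ Finset.range T, (1 : ℝ) :=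
          Finset.sum_le_sum fun n _ => (M.costAt_mem θ π h n).2
      _ = T := by simp

theorem avgCost_isBounded (θ : TransKernel S A) (π : Belief S → A) (h : Belief S) :
    Filter.IsBoundedUnder (· ≤ ·) Filter.atTop
      fun T : ℕ => (∑ n ∈ Finset.range T, M.costAt θ π h n) / (T : ℝ) :=
  Filter.isBoundedUnder_of ⟨1, fun T => (M.avg_costAt_mem θ π h T).2⟩

theorem avgCost_nonneg (θ : TransKernel S A) (π : Belief S → A) (h : Belief S) :
    0 ≤ M.avgCost θ π h :=
  Filter.le_limsup_of_frequently_le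
    (Filter.Eventually.frequently <| Filter.Eventually.of_forall
      fun T => (M.avg_costAt_mem θ π h T).1) (M.avgCost_isBounded θ π h)

theorem avgCost_le_one (θ : TransKernel S A) (π : Belief S → A) (h : Belief S) :
    M.avgCost θ π h ≤ 1 :=
  Filter.limsup_le_of_le
    (Filter.isCoboundedUnder_le_of_le Filter.atTop fun T => (M.avg_costAt_mem θ π h T).1)
    (Filter.Eventually.of_forall fun T => (M.avg_costAt_mem θ π h T).2)

theorem optCost_nonneg (θ : TransKernel S A) (h : Belief S) : 0 ≤ M.optCost θ h :=
  Real.iInf_nonneg fun π => M.avgCost_nonneg θ π h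

theorem optCost_le_one [Nonempty A] (θ : TransKernel S A) (h : Belief S) : M.optCost θ h ≤ 1 :=
  (ciInf_le ⟨0, by rintro _ ⟨π, rfl⟩; exact M.avgCost_nonneg θ π h⟩
    fun _ => Classical.arbitrary A).trans (M.avgCost_le_one _ _ _)

variable {M} {θ : TransKernel S A} {v : Belief S → ℝ} {J H : ℝ}

/-- The Bellman inequality is iterated along an arbitrary policy, and the value left over after the
last step is at most H. Only finite sums occur, so the policy need not be measurable. -/
theorem le_sum_beliefCost (hv : ∀ b, v b ≤ H) (hJ : ∀ b a, J + v b ≤ M.bellmanRHS θ v b a)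
    (π : Belief S → A) (N : ℕ) (b : Belief S) :
    N * J + v b ≤ ∑ n ∈ Finset.range N, M.beliefCost θ π n b + H := by
  induction N generalizing b with
  | zero => simpa using hv b
  | succ N ih =>
    rw [Finset.sum_range_succ']
    simp_rw [beliefCost_succ, beliefCost_zero]
    rw [Finset.sum_comm]
    simp_rw [← Finset.mul_sum]
    have h1 : ∑ o, M.obsProb θ b (π b) o * (N * J + v (M.tau θ b (π b) o) - H) ≤
        ∑ o, M.obsProb θ b (π b) o *
          ∑ n ∈ Finset.range N, M.beliefCost θ π n (M.tau θ b (π b) o) :=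
      Finset.sum_le_sum fun o _ => mul_le_mul_of_nonneg_left (by linarith [ih (M.tau θ b (π b) o)])
        (M.obsProb_nonneg _ _ _ _)
    have h2 : ∑ o, M.obsProb θ b (π b) o * (N * J + v (M.tau θ b (π b) o) - H) =
        (N * J - H) + ∑ o, M.obsProb θ b (π b) o * v (M.tau θ b (π b) o) := by
      have : ∀ o, M.obsProb θ b (π b) o * (N * J + v (M.tau θ b (π b) o) - H) =
        M.obsProb θ b (π b) o * (N * J - H) +
          M.obsProb θ b (π b) o * v (M.tau θ b (π b) o) := fun o => by ring
      simp_rw [this, Finset.sum_add_distrib, ← Finset.sum_mul, sum_obsProb, one_mul]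
    have h3 := hJ b (π b)
    rw [bellmanRHS] at h3
    push_cast
    linarith

/-- The iteration is now an equality up to the final value, which is dropped because it is
nonnegative. -/
theorem sum_beliefCost_le (hv : ∀ b, 0 ≤ v b) {π : Belief S → A}
    (hJ : ∀ b, M.bellmanRHS θ v b (π b) = J + v b) (N : ℕ) (b : Belief S) :
    ∑ n ∈ Finset.range N, M.beliefCost θ π n b ≤ N * J + v b := by
  induction N generalizing b with
  | zero => simpa using hv b
  | succ N ih =>
    rw [Finset.sum_range_succ']
    simp_rw [beliefCost_succ, beliefCost_zero]
    rw [Finset.sum_comm]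
    simp_rw [← Finset.mul_sum]
    have h1 : ∑ o, M.obsProb θ b (π b) o *
          ∑ n ∈ Finset.range N, M.beliefCost θ π n (M.tau θ b (π b) o) ≤
        ∑ o, M.obsProb θ b (π b) o * (N * J + v (M.tau θ b (π b) o)) :=
      Finset.sum_le_sum fun o _ => mul_le_mul_of_nonneg_left (ih (M.tau θ b (π b) o))
        (M.obsProb_nonneg _ _ _ _)
    have h2 : ∑ o, M.obsProb θ b (π b) o * (N * J + v (M.tau θ b (π b) o)) =
        N * J + ∑ o, M.obsProb θ b (π b) o * v (M.tau θ b (π b) o) := by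
      simp_rw [mul_add, Finset.sum_add_distrib, ← Finset.sum_mul, sum_obsProb, one_mul]
    have h3 := hJ b
    rw [bellmanRHS] at h3
    push_cast
    linarith

theorem le_avgCost (hv0 : ∀ b, 0 ≤ v b) (hv : ∀ b, v b ≤ H)
    (hJ : ∀ b a, J + v b ≤ M.bellmanRHS θ v b a) (π : Belief S → A) (h : Belief S) :
    J ≤ M.avgCost θ π h := by
  have hsum : ∀ N : ℕ, N * J - H ≤ ∑ n ∈ Finset.range N, M.costAt θ π h n := fun N => by
    simp_rw [costAt_eq]
    rw [Finset.sum_comm]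
    simp_rw [← Finset.mul_sum]
    calc (N * J - H : ℝ) = ∑ o, M.obsWeight h o * (N * J - H) := by
          rw [← Finset.sum_mul, sum_obsWeight, one_mul]
      _ ≤ _ := Finset.sum_le_sum fun o _ => mul_le_mul_of_nonneg_left
          (by linarith [le_sum_beliefCost hv hJ π N (M.bayes h o), hv0 (M.bayes h o)])
          (M.obsWeight_nonneg _ _)
  have ht : Filter.Tendsto (fun N : ℕ => J - H / (N : ℝ)) Filter.atTop (nhds J) := by
    simpa using (tendsto_const_nhds (x := J)).sub (tendsto_const_div_atTop_nhds_zero_nat H)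
  rw [← ht.limsup_eq]
  refine Filter.limsup_le_limsup ?_ ht.isCoboundedUnder_le (M.avgCost_isBounded θ π h)
  filter_upwards [Filter.eventually_gt_atTop 0] with N hN
  have hN' : (0 : ℝ) < N := by exact_mod_cast hN
  rw [le_div_iff₀ hN']
  calc (J - H / N) * N = N * J - H := by field_simp
    _ ≤ _ := hsum N

theorem avgCost_le (hv0 : ∀ b, 0 ≤ v b) (hv : ∀ b, v b ≤ H) {π : Belief S → A}
    (hJ : ∀ b, M.bellmanRHS θ v b (π b) = J + v b) (h : Belief S) :
    M.avgCost θ π h ≤ J := by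
  have hsum : ∀ N : ℕ, ∑ n ∈ Finset.range N, M.costAt θ π h n ≤ N * J + H := fun N => by
    simp_rw [costAt_eq]
    rw [Finset.sum_comm]
    simp_rw [← Finset.mul_sum]
    calc _ ≤ ∑ o, M.obsWeight h o * (N * J + H) :=
          Finset.sum_le_sum fun o _ => mul_le_mul_of_nonneg_left
          (by linarith [sum_beliefCost_le hv0 hJ N (M.bayes h o), hv (M.bayes h o)])
          (M.obsWeight_nonneg _ _)
      _ = _ := by rw [← Finset.sum_mul, sum_obsWeight, one_mul]
  have ht : Filter.Tendsto (fun N : ℕ => J + H / (N : ℝ)) Filter.atTop (nhds J) := by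
    simpa using (tendsto_const_nhds (x := J)).add (tendsto_const_div_atTop_nhds_zero_nat H)
  rw [← ht.limsup_eq]
  refine Filter.limsup_le_limsup ?_
    (Filter.isCoboundedUnder_le_of_le Filter.atTop fun T => (M.avg_costAt_mem θ π h T).1)
    ht.isBoundedUnder_le
  filter_upwards [Filter.eventually_gt_atTop 0] with N hN
  have hN' : (0 : ℝ) < N := by exact_mod_cast hN
  rw [div_le_iff₀ hN']
  calc _ ≤ _ := hsum N
    _ = (J + H / N) * N := by field_simp

/-- The constant of the Bellman equation is the optimal long-term average cost. -/
theorem optCost_eq (hv0 : ∀ b, 0 ≤ v b) (hv : ∀ b, v b ≤ H)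
    (hJ : ∀ b, IsLeast (Set.range (M.bellmanRHS θ v b)) (J + v b)) (h : Belief S) :
    M.optCost θ h = J := by
  -- A minimising action at each belief is a stationary policy that attains J; every other policy
  -- costs at least J.
  choose π hπ using fun b => (hJ b).1
  have : Nonempty (Belief S → A) := ⟨π⟩
  refine le_antisymm ?_ (le_ciInf fun π' => le_avgCost hv0 hv (fun b a => (hJ b).2 ⟨a, rfl⟩) π' h)
  exact (ciInf_le ⟨0, by rintro _ ⟨π, rfl⟩; exact M.avgCost_nonneg θ π h⟩ π).trans
    (avgCost_le hv0 hv hπ h)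

theorem IsRelValue.nonneg (hv : M.IsRelValue H θ v) (b : Belief S) : 0 ≤ v b := by
  obtain ⟨⟨B, hB⟩, -, h0, -⟩ := hv
  rw [← h0]
  exact ciInf_le ⟨-B, by rintro _ ⟨b, rfl⟩; exact (abs_le.1 (hB b)).1⟩ b

theorem IsRelValue.le (hv : M.IsRelValue H θ v) (b : Belief S) : v b ≤ H := by
  obtain ⟨⟨B, hB⟩, -, -, h0⟩ := hv
  exact (le_ciSup ⟨B, by rintro _ ⟨b, rfl⟩; exact (abs_le.1 (hB b)).2⟩ b).trans h0

/-- The Bellman equation at a minimising action, with the optimal average cost as its constant. -/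
theorem IsRelValue.bellmanRHS_eq (hv : M.IsRelValue H θ v) {a : A} {b : Belief S}
    (ha : ∀ a', M.bellmanRHS θ v b a ≤ M.bellmanRHS θ v b a') (h : Belief S) :
    M.bellmanRHS θ v b a = M.optCost θ h + v b := by
  obtain ⟨J, hJ⟩ := hv.2.1
  rw [optCost_eq hv.nonneg hv.le hJ]
  obtain ⟨a', ha'⟩ := (hJ b).1
  exact le_antisymm (ha' ▸ ha a') ((hJ b).2 ⟨a, rfl⟩)

end POMDP

/-! ### Measurability of belief updates -/

section Measurability

variable {Ω : Type*} {m : MeasurableSpace Ω}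

/-- States, actions, observations and start times take countably many values, so measurability may
be checked with them frozen. -/
theorem measurable_comp_of_countable {α β : Type*} [MeasurableSpace α] [Countable α]
    [DiscreteMeasurableSpace α] [MeasurableSpace β] {f : α → Ω → β} {g : Ω → α}
    (hf : ∀ a, Measurable (f a)) (hg : Measurable g) : Measurable fun ω => f (g ω) ω := by
  have : Measurable fun x : α × Ω => f x.1 x.2 :=
    measurable_from_prod_countable_right hf
  exact this.comp (hg.prodMk measurable_id)

variable {S A O : Type*} [Fintype S] [Fintype A] [Fintype O]

theorem Belief.measurable_iff {f : Ω → Belief S} :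
    Measurable f ↔ ∀ s, Measurable fun ω => f ω s := by
  constructor
  · intro h s
    exact (measurable_pi_apply s).comp (measurable_subtype_coe.comp h)
  · intro h
    exact Measurable.subtype_mk (f := fun ω => (f ω : S → ℝ)) (measurable_pi_lambda _ h)

theorem Measurable.belief_apply {f : Ω → Belief S} (hf : Measurable f) (s : S) :
    Measurable fun ω => f ω s := Belief.measurable_iff.1 hf s

theorem Measurable.kernel_apply {f : Ω → TransKernel S A} (hf : Measurable f) (s : S) (a : A) :
    Measurable fun ω => f ω s a :=
  (measurable_pi_apply a).comp ((measurable_pi_apply s).comp hf)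

namespace POMDP

variable (M : POMDP S A O)

theorem measurable_predict {θ : Ω → TransKernel S A} {b : Ω → Belief S} (hθ : Measurable θ)
    (hb : Measurable b) (a : A) : Measurable fun ω => predict (θ ω) (b ω) a :=
  Belief.measurable_iff.2 fun s' => Finset.measurable_fun_sum _ fun s _ =>
    ((hθ.kernel_apply s a).belief_apply s').mul (hb.belief_apply s)

theorem measurable_obsWeight {b : Ω → Belief S} (hb : Measurable b) (o : O) :
    Measurable fun ω => M.obsWeight (b ω) o :=
  Finset.measurable_fun_sum _ fun s _ => (hb.belief_apply s).const_mul _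

theorem measurable_bayes {b : Ω → Belief S} (hb : Measurable b) (o : O) :
    Measurable fun ω => M.bayes (b ω) o := by
  refine Belief.measurable_iff.2 fun s => ?_
  simp_rw [bayes, normalizeOr_apply]
  exact Measurable.ite (measurableSet_lt measurable_const (M.measurable_obsWeight hb o))
    (((hb.belief_apply s).const_mul _).div (M.measurable_obsWeight hb o)) (hb.belief_apply s)

theorem measurable_tau {θ : Ω → TransKernel S A} {b : Ω → Belief S} (hθ : Measurable θ)
    (hb : Measurable b) (a : A) (o : O) : Measurable fun ω => M.tau (θ ω) (b ω) a o :=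
  M.measurable_bayes (measurable_predict hθ hb a) o

theorem measurable_obsProb {θ : Ω → TransKernel S A} {b : Ω → Belief S} (hθ : Measurable θ)
    (hb : Measurable b) (a : A) (o : O) : Measurable fun ω => M.obsProb (θ ω) (b ω) a o := by
  simp_rw [obsProb_eq]
  exact M.measurable_obsWeight (measurable_predict hθ hb a) o

theorem measurable_expCost {b : Ω → Belief S} (hb : Measurable b) (a : A) :
    Measurable fun ω => M.expCost (b ω) a :=
  Finset.measurable_fun_sum _ fun s _ => (hb.belief_apply s).const_mul _

end POMDP

variable (L : Setup S A O)

theorem Setup.belief_congr {act act' : ℕ → A} {obs obs' : ℕ → O} {t : ℕ}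
    (hact : ∀ i, 1 ≤ i → i < t → act i = act' i) (hobs : ∀ i, 1 ≤ i → i ≤ t → obs i = obs' i)
    (θ : TransKernel S A) : L.belief act obs t θ = L.belief act' obs' t θ := by
  induction t with
  | zero => rfl
  | succ t ih =>
    rcases t with _ | t
    · simp only [Setup.belief]
      rw [hobs 1 le_rfl le_rfl]
    · simp only [Setup.belief]
      rw [ih (fun i h1 h2 => hact i h1 (by omega)) (fun i h1 h2 => hobs i h1 (by omega)),
        hact (t + 1) (by omega) (by omega), hobs (t + 2) (by omega) le_rfl]

theorem Setup.posterior_congr {act act' : ℕ → A} {obs obs' : ℕ → O} {t : ℕ}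
    (hact : ∀ i, 1 ≤ i → i < t → act i = act' i) (hobs : ∀ i, 1 ≤ i → i ≤ t → obs i = obs' i) :
    L.posterior act obs t = L.posterior act' obs' t := by
  induction t with
  | zero => rfl
  | succ t ih =>
    rcases t with _ | t
    · simp only [Setup.posterior]
      rw [hobs 1 le_rfl le_rfl]
    · simp only [Setup.posterior]
      rw [ih (fun i h1 h2 => hact i h1 (by omega)) (fun i h1 h2 => hobs i h1 (by omega)),
        hact (t + 1) (by omega) (by omega), hobs (t + 2) (by omega) le_rfl]
      have hb : ∀ θ, L.belief act obs (t + 1) θ = L.belief act' obs' (t + 1) θ := fun θ =>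
        L.belief_congr (fun i h1 h2 => hact i h1 (by omega))
          (fun i h1 h2 => hobs i h1 (by omega)) θ
      simp_rw [hb]

variable [MeasurableSpace A] [DiscreteMeasurableSpace A] [MeasurableSpace O]
  [DiscreteMeasurableSpace O]

/-- The belief along random actions and observations, with a random parameter, is measurable with
respect to any σ-algebra that contains the history and the parameter. -/
theorem Setup.measurable_belief (hinit : Measurable L.init) {act : ℕ → Ω → A} {obs : ℕ → Ω → O}
    {θ : Ω → TransKernel S A} (hθ : Measurable θ) (t : ℕ)
    (hact : ∀ i, 1 ≤ i → i < t → Measurable (act i))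
    (hobs : ∀ i, 1 ≤ i → i ≤ t → Measurable (obs i)) :
    Measurable fun ω => L.belief (fun i => act i ω) (fun i => obs i ω) t (θ ω) := by
  induction t with
  | zero => exact hinit.comp hθ
  | succ t ih =>
    rcases t with _ | t
    · simp only [Setup.belief]
      exact measurable_comp_of_countable (f := fun o ω => L.toPOMDP.bayes (L.init (θ ω)) o)
        (fun o => L.toPOMDP.measurable_bayes (hinit.comp hθ) o) (hobs 1 le_rfl le_rfl)
    · simp only [Setup.belief]
      have hb := ih (fun i h1 h2 => hact i h1 (by omega)) (fun i h1 h2 => hobs i h1 (by omega))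
      exact measurable_comp_of_countable
        (f := fun (x : A × O) ω => L.toPOMDP.tau (θ ω)
          (L.belief (fun i => act i ω) (fun i => obs i ω) (t + 1) (θ ω)) x.1 x.2)
        (fun x => L.toPOMDP.measurable_tau hθ hb x.1 x.2)
        ((hact (t + 1) (by omega) (by omega)).prodMk (hobs (t + 2) (by omega) le_rfl))

end Measurability

/-! ### Equality of conditional expectations, and enlarging the conditioning -/

section CondEq

variable {Ω : Type*} {m m₁ m₂ mΩ : MeasurableSpace Ω} (P : Measure Ω)

/-- `Y` and `y` are integrable and have the same conditional expectation given `m`. -/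
structure CondEq (m : MeasurableSpace Ω) (Y y : Ω → ℝ) : Prop where
  int_left : Integrable Y P
  int_right : Integrable y P
  eq : P[Y | m] =ᵐ[P] P[y | m]

variable {P} [IsProbabilityMeasure P] {Y y Z z W : Ω → ℝ}

namespace CondEq

theorem of_ae_eq (hY : Integrable Y P) (h : Y =ᵐ[P] y) : CondEq P m Y y :=
  ⟨hY, hY.congr h, condExp_congr_ae h⟩

theorem refl (hY : Integrable Y P) : CondEq P m Y Y := of_ae_eq hY Filter.EventuallyEq.rfl

theorem symm (h : CondEq P m Y y) : CondEq P m y Y := ⟨h.int_right, h.int_left, h.eq.symm⟩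

theorem trans (h : CondEq P m Y y) (h' : CondEq P m y z) : CondEq P m Y z :=
  ⟨h.int_left, h'.int_right, h.eq.trans h'.eq⟩

theorem of_condExp (hm : m ≤ mΩ) (hY : Integrable Y P) (hy : StronglyMeasurable[m] y)
    (h : P[Y | m] =ᵐ[P] y) : CondEq P m Y y := by
  have hy' : Integrable y P := integrable_condExp.congr h
  refine ⟨hY, hy', ?_⟩
  rwa [condExp_of_stronglyMeasurable hm hy hy']

theorem mono (h : CondEq P m₂ Y y) (h₁₂ : m₁ ≤ m₂) (h₂ : m₂ ≤ mΩ) : CondEq P m₁ Y y := by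
  refine ⟨h.int_left, h.int_right, ?_⟩
  calc P[Y | m₁] =ᵐ[P] P[P[Y | m₂] | m₁] := (condExp_condExp_of_le h₁₂ h₂).symm
    _ =ᵐ[P] P[P[y | m₂] | m₁] := condExp_congr_ae h.eq
    _ =ᵐ[P] P[y | m₁] := condExp_condExp_of_le h₁₂ h₂

theorem mul_left (h : CondEq P m Y y) (hm : m ≤ mΩ) (hW : Measurable[m] W) {c : ℝ}
    (hc : ∀ ω, |W ω| ≤ c) : CondEq P m (fun ω => W ω * Y ω) fun ω => W ω * y ω := by
  have hWs : StronglyMeasurable[m] W := hW.stronglyMeasurable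
  have hint : ∀ {V : Ω → ℝ}, Integrable V P → Integrable (fun ω => W ω * V ω) P := fun hV =>
    hV.bdd_mul (hWs.mono hm).aestronglyMeasurable (ae_of_all _ hc)
  refine ⟨hint h.int_left, hint h.int_right, ?_⟩
  calc P[W * Y | m] =ᵐ[P] W * P[Y | m] :=
        condExp_mul_of_stronglyMeasurable_left hWs (hint h.int_left) h.int_left
    _ =ᵐ[P] W * P[y | m] := Filter.EventuallyEq.rfl.mul h.eq
    _ =ᵐ[P] P[W * y | m] :=
        (condExp_mul_of_stronglyMeasurable_left hWs (hint h.int_right) h.int_right).symm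

theorem mul_right (h : CondEq P m Y y) (hm : m ≤ mΩ) (hW : Measurable[m] W) {c : ℝ}
    (hc : ∀ ω, |W ω| ≤ c) : CondEq P m (fun ω => Y ω * W ω) fun ω => y ω * W ω := by
  simpa only [mul_comm] using h.mul_left hm hW hc

theorem sum {ι : Type*} {s : Finset ι} {Y y : ι → Ω → ℝ} (h : ∀ i ∈ s, CondEq P m (Y i) (y i)) :
    CondEq P m (fun ω => ∑ i ∈ s, Y i ω) fun ω => ∑ i ∈ s, y i ω := by
  refine ⟨integrable_finsetSum _ fun i hi => (h i hi).int_left,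
    integrable_finsetSum _ fun i hi => (h i hi).int_right, ?_⟩
  have hs : ∀ {V : ι → Ω → ℝ}, (fun ω => ∑ i ∈ s, V i ω) = ∑ i ∈ s, V i := by
    intro V; ext ω; simp
  rw [hs, hs]
  refine (condExp_finsetSum (fun i hi => (h i hi).int_left) m).trans
    (Filter.EventuallyEq.trans ?_ (condExp_finsetSum (fun i hi => (h i hi).int_right) m).symm)
  have : ∀ᵐ ω ∂P, ∀ i ∈ s, (P[Y i | m]) ω = (P[y i | m]) ω :=
    (ae_ball_iff s.countable_toSet).2 fun i hi => (h i hi).eq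
  filter_upwards [this] with ω hω
  simp only [Finset.sum_apply]
  exact Finset.sum_congr rfl hω

theorem setIntegral_eq (h : CondEq P m Y y) (hm : m ≤ mΩ) {E : Set Ω} (hE : MeasurableSet[m] E) :
    ∫ ω in E, Y ω ∂P = ∫ ω in E, y ω ∂P := by
  rw [← setIntegral_condExp hm h.int_left hE, ← setIntegral_condExp hm h.int_right hE]
  exact integral_congr_ae (ae_restrict_of_ae h.eq)

theorem integral_eq (h : CondEq P m Y y) (hm : m ≤ mΩ) : ∫ ω, Y ω ∂P = ∫ ω, y ω ∂P := by
  simpa using h.setIntegral_eq hm MeasurableSet.univ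

theorem of_setIntegral_eq (hm : m ≤ mΩ) (hY : Integrable Y P) (hy : Integrable y P)
    (h : ∀ E, MeasurableSet[m] E → ∫ ω in E, Y ω ∂P = ∫ ω in E, y ω ∂P) : CondEq P m Y y := by
  refine ⟨hY, hy, (ae_eq_condExp_of_forall_setIntegral_eq hm hy
    (fun _ _ _ => integrable_condExp.integrableOn) (fun E hE _ => ?_)
    stronglyMeasurable_condExp.aestronglyMeasurable)⟩
  rw [setIntegral_condExp hm hY hE, h E hE]

theorem bot (hY : Integrable Y P) (hy : Integrable y P) (h : ∫ ω, Y ω ∂P = ∫ ω, y ω ∂P) :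
    CondEq P ⊥ Y y := by
  refine ⟨hY, hy, ?_⟩
  rw [condExp_bot, condExp_bot, h]

end CondEq

theorem sup_comap_eq_generateFrom {β : Type*} [mβ : MeasurableSpace β] (m : MeasurableSpace Ω)
    (X : Ω → β) : m ⊔ MeasurableSpace.comap X mβ = MeasurableSpace.generateFrom
      {E | ∃ F B, MeasurableSet[m] F ∧ MeasurableSet B ∧ E = F ∩ X ⁻¹' B} := by
  apply le_antisymm
  · refine sup_le ?_ ?_
    · intro F hF
      exact MeasurableSpace.measurableSet_generateFrom
        ⟨F, Set.univ, hF, MeasurableSet.univ, by simp⟩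
    · rintro _ ⟨B, hB, rfl⟩
      exact MeasurableSpace.measurableSet_generateFrom
        ⟨Set.univ, B, MeasurableSet.univ, hB, by simp⟩
  · refine MeasurableSpace.generateFrom_le ?_
    rintro _ ⟨F, B, hF, hB, rfl⟩
    exact MeasurableSet.inter (m := m ⊔ MeasurableSpace.comap X mβ)
      ((le_sup_left : m ≤ m ⊔ MeasurableSpace.comap X mβ) F hF)
      ((le_sup_right : MeasurableSpace.comap X mβ ≤ m ⊔ MeasurableSpace.comap X mβ) _ ⟨B, hB, rfl⟩)

/-- Conditional equality extends from `m` to the σ-algebra generated by `m` and a random variable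
if it holds after multiplication with the indicators of that random variable. -/
theorem CondEq.sup_comap {β : Type*} [mβ : MeasurableSpace β] {X : Ω → β} (hm : m ≤ mΩ)
    (hX : Measurable X) (hY : Integrable Y P) (hy : Integrable y P)
    (h : ∀ B, MeasurableSet B →
      CondEq P m ((X ⁻¹' B).indicator Y) ((X ⁻¹' B).indicator y)) :
    CondEq P (m ⊔ MeasurableSpace.comap X mβ) Y y := by
  have hm' : m ⊔ MeasurableSpace.comap X mβ ≤ mΩ := sup_le hm hX.comap_le
  refine CondEq.of_setIntegral_eq hm' hY hy fun E hE => ?_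
  -- The sets F ∩ X⁻¹(B), with F in `m`, form a π-system that generates the join; on them the claim
  -- is the hypothesis integrated over F.
  induction E, hE using MeasurableSpace.induction_on_inter (sup_comap_eq_generateFrom m X) with
  | h_inter =>
    rintro _ ⟨F, B, hF, hB, rfl⟩ _ ⟨F', B', hF', hB', rfl⟩ -
    exact ⟨F ∩ F', B ∩ B', MeasurableSet.inter (m := m) hF hF', hB.inter hB', by
      rw [Set.preimage_inter, Set.inter_inter_inter_comm]⟩
  | empty => simp
  | basic E hE =>
    obtain ⟨F, B, hF, hB, rfl⟩ := hE
    rw [← setIntegral_indicator (hX hB), ← setIntegral_indicator (hX hB)]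
    exact (h B hB).setIntegral_eq hm hF
  | compl E hE ih =>
    have h1 : ∫ ω, Y ω ∂P = ∫ ω, y ω ∂P := by
      have := (h Set.univ MeasurableSet.univ).integral_eq hm
      simpa using this
    have h2 := integral_add_compl (hm' E hE) hY
    have h3 := integral_add_compl (hm' E hE) hy
    linarith
  | iUnion f hd hf ih =>
    rw [integral_iUnion (fun i => hm' _ (hf i)) hd hY.integrableOn,
      integral_iUnion (fun i => hm' _ (hf i)) hd hy.integrableOn]
    exact tsum_congr ih

theorem integrable_of_abs_le {f : Ω → ℝ} (hf : Measurable f) {c : ℝ} (hc : ∀ ω, |f ω| ≤ c) :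
    Integrable f P :=
  Integrable.of_bound hf.aestronglyMeasurable c (ae_of_all _ hc)

theorem CondEq.sup_comap_of_finite {β : Type*} [Finite β] [mβ : MeasurableSpace β]
    [DiscreteMeasurableSpace β] {X : Ω → β} (hm : m ≤ mΩ)
    (hX : Measurable X) (hY : Integrable Y P) (hy : Integrable y P)
    (h : ∀ x, CondEq P m ((X ⁻¹' {x}).indicator Y) ((X ⁻¹' {x}).indicator y)) :
    CondEq P (m ⊔ MeasurableSpace.comap X mβ) Y y := by
  classical
  have := Fintype.ofFinite β
  refine CondEq.sup_comap hm hX hY hy fun B _ => ?_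
  have hB : ∀ V : Ω → ℝ, (X ⁻¹' B).indicator V =
      fun ω => ∑ x ∈ Finset.univ.filter (· ∈ B), (X ⁻¹' {x}).indicator V ω := by
    intro V
    ext ω
    simp only [Set.indicator_apply, Set.mem_preimage, Set.mem_singleton_iff]
    rw [Finset.sum_ite_eq]
    simp
  rw [hB Y, hB y]
  exact CondEq.sum fun x _ => h x

/-- Adding a random variable that is almost surely equal to an `m`-measurable one. -/
theorem CondEq.sup_comap_of_ae_eq {β : Type*} [mβ : MeasurableSpace β] {X X' : Ω → β} (hm : m ≤ mΩ)
    (hX : Measurable X) (hX' : Measurable[m] X') (hXX' : X =ᵐ[P] X') (h : CondEq P m Y y) :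
    CondEq P (m ⊔ MeasurableSpace.comap X mβ) Y y := by
  refine CondEq.sup_comap hm hX h.int_left h.int_right fun B hB => ?_
  have hi : ∀ V : Ω → ℝ, (X ⁻¹' B).indicator V =ᵐ[P]
      fun ω => (X' ⁻¹' B).indicator (fun _ => 1) ω * V ω := fun V => by
    classical
    filter_upwards [hXX'] with ω hω
    simp [Set.indicator_apply, hω]
  have h1 := h.mul_left (W := (X' ⁻¹' B).indicator fun _ => 1) hm
    (Measurable.indicator (m := m) measurable_const (hX' hB)) (c := 1) (fun ω => by
      classical
      rw [Set.indicator_apply]; split_ifs <;> simp)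
  exact (of_ae_eq (h.int_left.indicator (hX hB)) (hi Y)).trans
    (h1.trans (of_ae_eq h1.int_right (hi y).symm))

end CondEq

section CondEqMore

variable {Ω : Type*} {m m' mΩ : MeasurableSpace Ω} {P : Measure Ω} [IsProbabilityMeasure P]
  {Y y Z z : Ω → ℝ}

theorem CondEq.add (h : CondEq P m Y y) (h' : CondEq P m Z z) :
    CondEq P m (fun ω => Y ω + Z ω) fun ω => y ω + z ω :=
  ⟨h.int_left.add h'.int_left, h.int_right.add h'.int_right,
    (condExp_add h.int_left h'.int_left m).trans
      ((h.eq.add h'.eq).trans (condExp_add h.int_right h'.int_right m).symm)⟩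

theorem CondEq.condExp_self (hm : m ≤ mΩ) (hY : Integrable Y P) : CondEq P m Y (P[Y | m]) :=
  CondEq.of_condExp hm hY stronglyMeasurable_condExp Filter.EventuallyEq.rfl

theorem abs_indicator_one_le (E : Set Ω) (ω : Ω) : |E.indicator (fun _ => (1 : ℝ)) ω| ≤ 1 := by
  by_cases h : ω ∈ E <;> simp [h]

theorem measurable_indicator_one {E : Set Ω} (hE : MeasurableSet[m] E) :
    Measurable[m] (E.indicator fun _ => (1 : ℝ)) :=
  Measurable.indicator (m := m) measurable_const hE

theorem integrable_indicator_one {E : Set Ω} (hE : MeasurableSet E) :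
    Integrable (E.indicator fun _ => (1 : ℝ)) P :=
  integrable_of_abs_le (measurable_indicator_one hE) (abs_indicator_one_le E)

theorem indicator_eq_mul (E : Set Ω) (Y : Ω → ℝ) :
    E.indicator Y = fun ω => E.indicator (fun _ => 1) ω * Y ω := by
  ext ω
  by_cases h : ω ∈ E <;> simp [h]

theorem apply_eq_sum_indicator {ι : Type*} [Fintype ι] (X : Ω → ι) (F : ι → Ω → ℝ) (ω : Ω) :
    F (X ω) ω = ∑ i, (X ⁻¹' {i}).indicator (fun _ => 1) ω * F i ω := by
  classical
  simp [Set.indicator_apply]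

/-- Conditional equality of a family, evaluated at a finitely valued `m`-measurable index. -/
theorem CondEq.comp_of_finite {ι : Type*} [Finite ι] [MeasurableSpace ι]
    [DiscreteMeasurableSpace ι] (hm : m ≤ mΩ) {X : Ω → ι} (hX : Measurable[m] X)
    {F G : ι → Ω → ℝ} (h : ∀ i, CondEq P m (F i) (G i)) :
    CondEq P m (fun ω => F (X ω) ω) fun ω => G (X ω) ω := by
  have := Fintype.ofFinite ι
  simp_rw [apply_eq_sum_indicator X]
  exact CondEq.sum fun i _ => (h i).mul_left hm
    (measurable_indicator_one (hX (MeasurableSet.of_discrete))) (abs_indicator_one_le _)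

/-- A random variable `X` is added to the conditioning: if, given a larger σ-algebra `m'` that
determines `Y` and `y`, the law of `X` depends on `m` only, then `X` carries no information on `Y`
beyond `m`. -/
theorem CondEq.sup_comap_of_condLaw {β : Type*} [mβ : MeasurableSpace β]
    {X : Ω → β} (hX : Measurable X) (hmm' : m ≤ m') (hm' : m' ≤ mΩ) (h : CondEq P m Y y)
    (hY : Measurable[m'] Y) (hy : Measurable[m'] y) {c : ℝ} (hYc : ∀ ω, |Y ω| ≤ c)
    (hyc : ∀ ω, |y ω| ≤ c) {κ : Set β → Ω → ℝ}
    (hκm : ∀ B, MeasurableSet B → Measurable[m] (κ B)) (hκc : ∀ B ω, |κ B ω| ≤ 1)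
    (hκ : ∀ B, MeasurableSet B → CondEq P m' ((X ⁻¹' B).indicator fun _ => 1) (κ B)) :
    CondEq P (m ⊔ MeasurableSpace.comap X mβ) Y y := by
  refine CondEq.sup_comap (hmm'.trans hm') hX h.int_left h.int_right fun B hB => ?_
  rw [indicator_eq_mul _ Y, indicator_eq_mul _ y]
  -- Under `m'` the indicator of X is replaced by κ; as κ is `m`-measurable it can be pulled out,
  -- `Y` is exchanged for `y`, and the first replacement is undone.
  exact (((hκ B hB).mul_right hm' hY hYc).mono hmm' hm').trans
    ((h.mul_left (hmm'.trans hm') (hκm B hB) (hκc B)).trans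
      (((hκ B hB).mul_right hm' hy hyc).mono hmm' hm').symm)

end CondEqMore

/-! ### Prediction, and Bayes' rule for the posterior of the parameter -/

namespace Setup

variable {S A O : Type*} [Fintype S] [Fintype A] [Fintype O] (L : Setup S A O)

/-- The law of the state at time `t + 1` given the actions and observations up to time `t`. -/
noncomputable def predBelief (act : ℕ → A) (obs : ℕ → O) : ℕ → TransKernel S A → Belief S
  | 0, θ => L.init θ
  | t + 1, θ => POMDP.predict θ (L.belief act obs (t + 1) θ) (act (t + 1))

theorem belief_succ (act : ℕ → A) (obs : ℕ → O) (t : ℕ) (θ : TransKernel S A) :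
    L.belief act obs (t + 1) θ = L.toPOMDP.bayes (L.predBelief act obs t θ) (obs (t + 1)) := by
  cases t <;> rfl

theorem posterior_succ (act : ℕ → A) (obs : ℕ → O) (t : ℕ) :
    L.posterior act obs (t + 1) =
      ((L.posterior act obs t).withDensity (fun θ => ENNReal.ofReal
        (L.toPOMDP.obsWeight (L.predBelief act obs t θ) (obs (t + 1)))) Set.univ)⁻¹ •
      (L.posterior act obs t).withDensity fun θ => ENNReal.ofReal
        (L.toPOMDP.obsWeight (L.predBelief act obs t θ) (obs (t + 1))) := by
  cases t
  · rfl
  · simp only [Setup.posterior, POMDP.obsProb_eq]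
    rfl

/-- Only an inequality: along a history of probability zero the normaliser can vanish, and then the
posterior is the zero measure. -/
theorem posterior_univ_le [IsProbabilityMeasure L.prior] (act : ℕ → A) (obs : ℕ → O) (t : ℕ) :
    L.posterior act obs t Set.univ ≤ 1 := by
  cases t with
  | zero => exact prob_le_one (μ := L.prior)
  | succ t =>
    rw [posterior_succ, Measure.smul_apply, smul_eq_mul]
    exact ENNReal.inv_mul_le_one _

theorem isFiniteMeasure_posterior [IsProbabilityMeasure L.prior] (act : ℕ → A) (obs : ℕ → O)
    (t : ℕ) : IsFiniteMeasure (L.posterior act obs t) :=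
  ⟨(L.posterior_univ_le act obs t).trans_lt ENNReal.one_lt_top⟩

theorem posterior_real_le_one [IsProbabilityMeasure L.prior] (act : ℕ → A) (obs : ℕ → O) (t : ℕ)
    (B : Set (TransKernel S A)) : (L.posterior act obs t).real B ≤ 1 := by
  have := L.isFiniteMeasure_posterior act obs t
  exact (measureReal_mono (Set.subset_univ B)).trans
    (ENNReal.toReal_mono ENNReal.one_ne_top (L.posterior_univ_le act obs t))

theorem abs_integral_posterior_le [IsProbabilityMeasure L.prior] (act : ℕ → A) (obs : ℕ → O) (t : ℕ)
    {φ : TransKernel S A → ℝ} {c : ℝ} (hc : ∀ θ, |φ θ| ≤ c) :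
    |∫ θ, φ θ ∂L.posterior act obs t| ≤ |c| := by
  have := L.isFiniteMeasure_posterior act obs t
  refine (norm_integral_le_of_norm_le_const (f := φ) (C := c) (ae_of_all _ hc)).trans ?_
  calc c * (L.posterior act obs t).real Set.univ
      ≤ |c| * (L.posterior act obs t).real Set.univ :=
        mul_le_mul_of_nonneg_right (le_abs_self c) measureReal_nonneg
    _ ≤ |c| * 1 := mul_le_mul_of_nonneg_left (L.posterior_real_le_one _ _ _ _) (abs_nonneg c)
    _ = |c| := mul_one _

/-- Bayes' rule for the posterior, in a form that needs no division. -/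
theorem integral_posterior_succ_mul [IsProbabilityMeasure L.prior] (act : ℕ → A) (obs : ℕ → O)
    (t : ℕ) (hm : Measurable fun θ => L.predBelief act obs t θ)
    (φ : TransKernel S A → ℝ) :
    (∫ θ, φ θ ∂L.posterior act obs (t + 1)) *
        ∫ θ, L.toPOMDP.obsWeight (L.predBelief act obs t θ) (obs (t + 1)) ∂L.posterior act obs t =
      ∫ θ, φ θ * L.toPOMDP.obsWeight (L.predBelief act obs t θ) (obs (t + 1))
        ∂L.posterior act obs t := by
  have := L.isFiniteMeasure_posterior act obs t
  set g : TransKernel S A → ℝ := fun θ =>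
    L.toPOMDP.obsWeight (L.predBelief act obs t θ) (obs (t + 1)) with hg
  have hg0 : ∀ θ, 0 ≤ g θ := fun θ => L.toPOMDP.obsWeight_nonneg _ _
  have hg1 : ∀ θ, g θ ≤ 1 := fun θ => L.toPOMDP.obsWeight_le_one _ _
  have hgm : Measurable g := L.toPOMDP.measurable_obsWeight hm _
  have hgi : Integrable g (L.posterior act obs t) :=
    Integrable.of_bound hgm.aestronglyMeasurable 1
      (ae_of_all _ fun θ => by rw [Real.norm_eq_abs, abs_of_nonneg (hg0 θ)]; exact hg1 θ)
  have hint : ∀ ψ : TransKernel S A → ℝ,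
      ∫ θ, ψ θ ∂(L.posterior act obs t).withDensity (fun θ => ENNReal.ofReal (g θ)) =
        ∫ θ, ψ θ * g θ ∂L.posterior act obs t := fun ψ => by
    rw [integral_withDensity_eq_integral_toReal_smul hgm.ennreal_ofReal
      (ae_of_all _ fun _ => ENNReal.ofReal_lt_top)]
    simp_rw [smul_eq_mul, ENNReal.toReal_ofReal (hg0 _), mul_comm]
  have hZ : ((L.posterior act obs t).withDensity (fun θ => ENNReal.ofReal (g θ)) Set.univ) =
      ENNReal.ofReal (∫ θ, g θ ∂L.posterior act obs t) := by
    rw [withDensity_apply _ MeasurableSet.univ, Measure.restrict_univ,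
      ofReal_integral_eq_lintegral_ofReal hgi (ae_of_all _ hg0)]
  rw [posterior_succ, integral_smul_measure, hint, hZ, smul_eq_mul, ENNReal.toReal_inv,
    ENNReal.toReal_ofReal (integral_nonneg hg0)]
  -- If the normaliser is zero, the likelihood vanishes almost everywhere and so does the right-hand
  -- side.
  by_cases h0 : ∫ θ, g θ ∂L.posterior act obs t = 0
  · rw [h0, mul_zero]
    have h1 : g =ᵐ[L.posterior act obs t] 0 := (integral_eq_zero_iff_of_nonneg hg0 hgi).1 h0
    symm
    refine integral_eq_zero_of_ae ?_
    filter_upwards [h1] with θ hθ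
    change φ θ * g θ = 0
    rw [hθ]; simp
  · field_simp
    rfl

theorem predBelief_congr {act act' : ℕ → A} {obs obs' : ℕ → O} {t : ℕ}
    (hact : ∀ i, 1 ≤ i → i ≤ t → act i = act' i) (hobs : ∀ i, 1 ≤ i → i ≤ t → obs i = obs' i)
    (θ : TransKernel S A) : L.predBelief act obs t θ = L.predBelief act' obs' t θ := by
  cases t with
  | zero => rfl
  | succ t =>
    simp only [predBelief]
    rw [L.belief_congr (fun i h1 h2 => hact i h1 h2.le) hobs, hact (t + 1) (by omega) le_rfl]

theorem measurable_predBelief {Ω : Type*} {m : MeasurableSpace Ω} [MeasurableSpace A]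
    [DiscreteMeasurableSpace A] [MeasurableSpace O] [DiscreteMeasurableSpace O]
    (hinit : Measurable L.init) {act : ℕ → Ω → A} {obs : ℕ → Ω → O}
    {θ : Ω → TransKernel S A} (hθ : Measurable θ) (t : ℕ)
    (hact : ∀ i, 1 ≤ i → i ≤ t → Measurable (act i))
    (hobs : ∀ i, 1 ≤ i → i ≤ t → Measurable (obs i)) :
    Measurable fun ω => L.predBelief (fun i => act i ω) (fun i => obs i ω) t (θ ω) := by
  cases t with
  | zero => exact hinit.comp hθ
  | succ t =>
    simp only [predBelief]
    exact measurable_comp_of_countable (f := fun a ω => POMDP.predict (θ ω)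
      (L.belief (fun i => act i ω) (fun i => obs i ω) (t + 1) (θ ω)) a)
      (fun a => POMDP.measurable_predict hθ
        (L.measurable_belief hinit hθ (t + 1) (fun i h1 h2 => hact i h1 h2.le) hobs) a)
      (hact (t + 1) (by omega) le_rfl)

end Setup

/-! ### The episode schedule -/

section Episode

variable {S A : Type*} [Fintype S] [Fintype A] (m : ℕ → S → A → ℕ)

/-- The criterion for staying in the current episode at time `t + 1`. -/
def episodeStays (t : ℕ) : Prop :=
  t + 1 ≤ (episode m t).1 + (episode m t).2 ∧ ∀ s a, m (t + 1) s a ≤ 2 * m (episode m t).1 s a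

theorem episode_succ_of_stays {t : ℕ} (h : episodeStays m t) : episode m (t + 1) = episode m t := by
  rw [episode]
  exact if_pos h

theorem episode_succ_of_not_stays {t : ℕ} (h : ¬ episodeStays m t) :
    episode m (t + 1) = (t + 1, t + 1 - (episode m t).1) := by
  rw [episode]
  exact if_neg h

theorem episode_fst_le (t : ℕ) : (episode m t).1 ≤ t := by
  induction t with
  | zero => simp [episode]
  | succ t ih =>
    by_cases h : episodeStays m t
    · rw [episode_succ_of_stays m h]; omega
    · rw [episode_succ_of_not_stays m h]

theorem episode_fst_succ_ne_iff (t : ℕ) : (episode m (t + 1)).1 ≠ t + 1 ↔ episodeStays m t := by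
  constructor
  · intro h
    by_contra h'
    exact h (by rw [episode_succ_of_not_stays m h'])
  · intro h
    rw [episode_succ_of_stays m h]
    have := episode_fst_le m t
    omega

theorem not_episodeStays_zero : ¬ episodeStays m 0 := by
  simp [episodeStays, episode]

theorem episode_one : episode m 1 = (1, 1) := by
  rw [episode_succ_of_not_stays m (not_episodeStays_zero m)]
  rfl

theorem one_le_episode_fst {t : ℕ} (ht : 1 ≤ t) : 1 ≤ (episode m t).1 := by
  induction t, ht using Nat.le_induction with
  | base => rw [episode_one]
  | succ t ht ih =>
    by_cases h : episodeStays m t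
    · rwa [episode_succ_of_stays m h]
    · rw [episode_succ_of_not_stays m h]; omega

/-- An episode that continues satisfies the schedule by its stopping rule, one that has just started
satisfies it trivially. -/
theorem le_episode_add (t : ℕ) : t ≤ (episode m t).1 + (episode m t).2 := by
  cases t with
  | zero => simp
  | succ t =>
    by_cases h : episodeStays m t
    · rw [episode_succ_of_stays m h]; exact h.1
    · rw [episode_succ_of_not_stays m h]; simp

/-- The previous length is t_k - t_{k-1}, hence at most t_k. Together with the schedule this gives t
≤ 2t_k inside an episode. -/
theorem episode_snd_le (t : ℕ) : (episode m t).2 ≤ (episode m t).1 := by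
  induction t with
  | zero => simp [episode]
  | succ t ih =>
    by_cases h : episodeStays m t
    · rwa [episode_succ_of_stays m h]
    · rw [episode_succ_of_not_stays m h]; simp

theorem measurable_episode {Ω : Type*} {mΩ : MeasurableSpace Ω} {m : Ω → ℕ → S → A → ℕ} (t : ℕ)
    (hm : ∀ u ≤ t, ∀ s a, Measurable fun ω => m ω u s a) :
    Measurable fun ω => episode (m ω) t := by
  induction t with
  | zero => exact measurable_const
  | succ t ih =>
    have ih := ih fun u hu => hm u (by omega)
    have hset : MeasurableSet {ω | episodeStays (m ω) t} := by
      have h1 : ∀ s a, Measurable fun ω => m ω (episode (m ω) t).1 s a := fun s a => by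
        -- The start time is a random index. Capping it at t, which changes nothing, keeps each
        -- frozen index in the range where the counts are known to be measurable.
        have h2 : (fun ω => m ω (episode (m ω) t).1 s a) =
            fun ω => m ω (min (episode (m ω) t).1 t) s a := by
          ext ω
          rw [min_eq_left (episode_fst_le (m ω) t)]
        rw [h2]
        exact measurable_comp_of_countable (f := fun u ω => m ω (min u t) s a)
          (fun u => hm _ (by omega) s a) ih.fst
      have h3 : {ω | episodeStays (m ω) t} =
          {ω | t + 1 ≤ (episode (m ω) t).1 + (episode (m ω) t).2} ∩
            ⋂ s, ⋂ a, {ω | m ω (t + 1) s a ≤ 2 * m ω (episode (m ω) t).1 s a} := by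
        ext ω
        simp [episodeStays]
      rw [h3]
      refine MeasurableSet.inter (measurableSet_le measurable_const (ih.fst.add ih.snd)) ?_
      exact MeasurableSet.iInter fun s => MeasurableSet.iInter fun a =>
        measurableSet_le (hm (t + 1) le_rfl s a) ((h1 s a).const_mul 2)
    have heq : (fun ω => episode (m ω) (t + 1)) = fun ω => open Classical in
        if ω ∈ {ω | episodeStays (m ω) t} then episode (m ω) t
        else (t + 1, t + 1 - (episode (m ω) t).1) := by
      ext1 ω
      by_cases h : episodeStays (m ω) t
      · rw [episode_succ_of_stays _ h]; simp [h]
      · rw [episode_succ_of_not_stays _ h]; simp [h]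
    rw [heq]
    exact Measurable.ite hset ih (measurable_const.prodMk (measurable_const.sub ih.fst))

end Episode

/-! ### The σ-algebras of the run -/

namespace Trajectory

variable {S A O : Type*} [Fintype S] [Fintype A] [Fintype O]
  [MeasurableSpace S] [DiscreteMeasurableSpace S] [mA : MeasurableSpace A]
  [DiscreteMeasurableSpace A] [mO : MeasurableSpace O] [DiscreteMeasurableSpace O]
  {Ω : Type*} {mΩ : MeasurableSpace Ω} {P : Measure Ω} {L : Setup S A O}

/-- The σ-algebra generated by `m₀` and the observations, sampled parameters and actions up to
time `t`. -/
@[reducible] def info (X : Trajectory S A O Ω) (m₀ : MeasurableSpace Ω) : ℕ → MeasurableSpace Ω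
  | 0 => m₀
  | t + 1 => X.info m₀ t ⊔ MeasurableSpace.comap (X.obs (t + 1)) mO ⊔
      MeasurableSpace.comap (X.sample (t + 1)) inferInstance ⊔
      MeasurableSpace.comap (X.act (t + 1)) mA

/-- The σ-algebra generated by `info` up to time `t` and the observation at time `t + 1`. -/
@[reducible] def preInfo (X : Trajectory S A O Ω) (m₀ : MeasurableSpace Ω) (t : ℕ) :
    MeasurableSpace Ω := X.info m₀ t ⊔ MeasurableSpace.comap (X.obs (t + 1)) mO

/-- The σ-algebra generated by the true parameter. -/
@[reducible] def paramInfo (X : Trajectory S A O Ω) : MeasurableSpace Ω :=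
  MeasurableSpace.comap X.param inferInstance

variable {X : Trajectory S A O Ω}

theorem full_mono {i i' j j' k k' : ℕ} (hi : i ≤ i') (hj : j ≤ j') (hk : k ≤ k') :
    X.full i j k ≤ X.full i' j' k' := by
  refine sup_le_sup (sup_le_sup (sup_le_sup le_rfl ?_) ?_) ?_
  all_goals exact biSup_mono fun l hl => by simp only [Finset.mem_Icc] at hl ⊢; omega

theorem paramInfo_le_full {i j k : ℕ} : X.paramInfo ≤ X.full i j k :=
  le_sup_left.trans (le_sup_left.trans le_sup_left)

theorem comap_state_le_full {i j k l : ℕ} (h1 : 1 ≤ l) (h2 : l ≤ i) :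
    MeasurableSpace.comap (X.state l) inferInstance ≤ X.full i j k :=
  (le_biSup (fun l => MeasurableSpace.comap (X.state l) inferInstance)
    (Finset.mem_Icc.2 ⟨h1, h2⟩)).trans (le_sup_right.trans (le_sup_left.trans le_sup_left))

theorem comap_obs_le_full {i j k l : ℕ} (h1 : 1 ≤ l) (h2 : l ≤ j) :
    MeasurableSpace.comap (X.obs l) inferInstance ≤ X.full i j k :=
  (le_biSup (fun l => MeasurableSpace.comap (X.obs l) inferInstance)
    (Finset.mem_Icc.2 ⟨h1, h2⟩)).trans (le_sup_right.trans le_sup_left)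

theorem comap_sample_act_le_full {i j k l : ℕ} (h1 : 1 ≤ l) (h2 : l ≤ k) :
    MeasurableSpace.comap (X.sample l) inferInstance ⊔
      MeasurableSpace.comap (X.act l) inferInstance ≤ X.full i j k :=
  (le_biSup (fun l => MeasurableSpace.comap (X.sample l) inferInstance ⊔
      MeasurableSpace.comap (X.act l) inferInstance)
    (Finset.mem_Icc.2 ⟨h1, h2⟩)).trans le_sup_right

theorem info_mono {m₀ m₀' : MeasurableSpace Ω} (h : m₀ ≤ m₀') (t : ℕ) :
    X.info m₀ t ≤ X.info m₀' t := by
  induction t with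
  | zero => exact h
  | succ t ih => exact sup_le_sup (sup_le_sup (sup_le_sup ih le_rfl) le_rfl) le_rfl

theorem preInfo_le_info {m₀ : MeasurableSpace Ω} (t : ℕ) : X.preInfo m₀ t ≤ X.info m₀ (t + 1) :=
  le_sup_left.trans le_sup_left

theorem info_le_succ {m₀ : MeasurableSpace Ω} (t : ℕ) : X.info m₀ t ≤ X.info m₀ (t + 1) :=
  le_sup_left.trans (preInfo_le_info t)

theorem info_le_of_le {m₀ : MeasurableSpace Ω} {t u : ℕ} (h : t ≤ u) : X.info m₀ t ≤ X.info m₀ u :=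
  monotone_nat_of_le_succ (f := X.info m₀) info_le_succ h

/-- Two choices of `m₀` are used: `paramInfo` for the law of the state given θ_*, and `⊥` for the
law of θ_* itself. -/
theorem info_le_full {m₀ : MeasurableSpace Ω} (h : m₀ ≤ X.paramInfo) (i t : ℕ) :
    X.info m₀ t ≤ X.full i t t := by
  induction t with
  | zero => exact h.trans paramInfo_le_full
  | succ t ih =>
    exact sup_le (sup_le (sup_le (ih.trans (full_mono le_rfl (by omega) (by omega)))
      (comap_obs_le_full (by omega) le_rfl))
      (le_sup_left.trans (comap_sample_act_le_full (by omega) le_rfl)))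
      (le_sup_right.trans (comap_sample_act_le_full (by omega) le_rfl))

theorem preInfo_le_full {m₀ : MeasurableSpace Ω} (h : m₀ ≤ X.paramInfo) (i t : ℕ) :
    X.preInfo m₀ t ≤ X.full i (t + 1) t :=
  sup_le ((info_le_full h i t).trans (full_mono le_rfl (by omega) le_rfl))
    (comap_obs_le_full (by omega) le_rfl)

theorem le_info {m₀ : MeasurableSpace Ω} (t : ℕ) : m₀ ≤ X.info m₀ t :=
  info_le_of_le (m₀ := m₀) (Nat.zero_le t)

theorem measurable_param_info (t : ℕ) : Measurable[X.info X.paramInfo t] X.param :=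
  (comap_measurable X.param).mono (le_info t) le_rfl

theorem measurable_obs_info {m₀ : MeasurableSpace Ω} {i t : ℕ} (h1 : 1 ≤ i) (h2 : i ≤ t) :
    Measurable[X.info m₀ t] (X.obs i) := by
  obtain ⟨i, rfl⟩ := Nat.exists_eq_add_of_le' h1
  exact (comap_measurable (X.obs (i + 1))).mono
    ((le_sup_right.trans (preInfo_le_info (m₀ := m₀) i)).trans (info_le_of_le h2)) le_rfl

theorem measurable_obs_preInfo {m₀ : MeasurableSpace Ω} {i t : ℕ} (h1 : 1 ≤ i) (h2 : i ≤ t + 1) :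
    Measurable[X.preInfo m₀ t] (X.obs i) := by
  rcases Nat.lt_or_ge t i with h | h
  · obtain rfl : i = t + 1 := by omega
    exact (comap_measurable (X.obs (t + 1))).mono le_sup_right le_rfl
  · exact (measurable_obs_info (m₀ := m₀) h1 h).mono le_sup_left le_rfl

theorem measurable_sample_info {m₀ : MeasurableSpace Ω} {i t : ℕ} (h1 : 1 ≤ i) (h2 : i ≤ t) :
    Measurable[X.info m₀ t] (X.sample i) := by
  obtain ⟨i, rfl⟩ := Nat.exists_eq_add_of_le' h1
  exact (comap_measurable (X.sample (i + 1))).mono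
    (((le_sup_right (a := X.preInfo m₀ i)).trans (le_sup_left (a := _ ⊔ _))).trans
      (info_le_of_le (m₀ := m₀) h2)) le_rfl

theorem measurable_act_info {m₀ : MeasurableSpace Ω} {i t : ℕ} (h1 : 1 ≤ i) (h2 : i ≤ t) :
    Measurable[X.info m₀ t] (X.act i) := by
  obtain ⟨i, rfl⟩ := Nat.exists_eq_add_of_le' h1
  exact (comap_measurable (X.act (i + 1))).mono
    ((le_sup_right (a := _ ⊔ _)).trans (info_le_of_le (m₀ := m₀) h2)) le_rfl

theorem measurable_obs_hist {i t : ℕ} (h1 : 1 ≤ i) (h2 : i ≤ t) :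
    Measurable[X.hist t] (X.obs i) :=
  (comap_measurable (X.obs i)).mono ((le_biSup (fun i => MeasurableSpace.comap (X.obs i) mO)
    (Finset.mem_Icc.2 ⟨h1, h2⟩)).trans le_sup_left) le_rfl

theorem measurable_act_hist {i t : ℕ} (h1 : 1 ≤ i) (h2 : i < t) :
    Measurable[X.hist t] (X.act i) :=
  (comap_measurable (X.act i)).mono ((le_biSup (fun i => MeasurableSpace.comap (X.act i) mA)
    (Finset.mem_Ico.2 ⟨h1, h2⟩)).trans le_sup_right) le_rfl

theorem hist_le_preInfo {m₀ : MeasurableSpace Ω} (t : ℕ) : X.hist (t + 1) ≤ X.preInfo m₀ t := by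
  refine sup_le (iSup₂_le fun i hi => ?_) (iSup₂_le fun i hi => ?_)
  · rw [Finset.mem_Icc] at hi
    exact (measurable_obs_preInfo (m₀ := m₀) hi.1 hi.2).comap_le
  · rw [Finset.mem_Ico] at hi
    exact ((measurable_act_info (m₀ := m₀) hi.1 (by omega : i ≤ t)).mono le_sup_left
      le_rfl).comap_le

/-- This makes the pseudo-counts up to time t, and hence the decision to start an episode at t,
measurable for `hist t`. -/
theorem histPlus_le_hist {t u : ℕ} (h : u < t ∨ u = 0) : X.histPlus u ≤ X.hist t := by
  refine iSup₂_le fun i hi => ?_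
  rw [Finset.mem_Icc] at hi
  exact sup_le (measurable_obs_hist hi.1 (by omega)).comap_le
    (measurable_act_hist hi.1 (by omega)).comap_le

theorem measurable_pseudoCount (P : Measure Ω) {t u : ℕ} (h : u ≤ t) (s : S) (a : A) :
    Measurable[X.hist t] fun ω => X.pseudoCount P ω u s a := by
  induction u with
  | zero => exact measurable_const
  | succ u ih =>
    simp only [pseudoCount]
    refine Measurable.max (ih (by omega)) ?_
    refine Nat.measurable_ceil.comp ?_
    exact stronglyMeasurable_condExp.measurable.mono (histPlus_le_hist (by omega)) le_rfl

theorem measurable_episode_hist (P : Measure Ω) {t u : ℕ} (h : u ≤ t) :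
    Measurable[X.hist t] fun ω => episode (X.pseudoCount P ω) u :=
  measurable_episode u fun _ hu s a => measurable_pseudoCount P (hu.trans h) s a

theorem measurable_epStart_hist (P : Measure Ω) {t u : ℕ} (h : u ≤ t) :
    Measurable[X.hist t] (X.epStart P u) := by
  let _ := X.hist t
  exact (measurable_episode_hist P h).fst

/-- A quantity that is determined by the history is measurable with respect to it. -/
theorem measurable_of_history {β : Type*} [MeasurableSpace β] [Nonempty A] [Nonempty O]
    (F : (ℕ → A) → (ℕ → O) → β) (t : ℕ)
    (hF : ∀ act act' obs obs', (∀ i, 1 ≤ i → i < t → act i = act' i) →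
      (∀ i, 1 ≤ i → i ≤ t → obs i = obs' i) → F act obs = F act' obs') :
    Measurable[X.hist t] fun ω => F (fun i => X.act i ω) fun i => X.obs i ω := by
  classical
  let a₀ : A := Classical.arbitrary A
  let o₀ : O := Classical.arbitrary O
  -- The history takes finitely many values, so F itself need not be measurable. Slot i holds the
  -- action of time i and the observation of time i + 1; the action at time 0 is not part of the
  -- history and is replaced by a default.
  let word : Ω → (Fin t → A) × (Fin t → O) := fun ω =>
    (fun i => if 1 ≤ i.1 then X.act i ω else a₀, fun i => X.obs (i + 1) ω)
  have hword : Measurable[X.hist t] word := by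
    let _ := X.hist t
    refine Measurable.prodMk (measurable_pi_lambda _ fun i => ?_)
      (measurable_pi_lambda _ fun i => measurable_obs_hist (by omega) i.2)
    by_cases hi : 1 ≤ i.1
    · simp only [if_pos hi]; exact measurable_act_hist hi i.2
    · simp only [if_neg hi]; exact measurable_const
  have heq : (fun ω => F (fun i => X.act i ω) fun i => X.obs i ω) =
      (fun w : (Fin t → A) × (Fin t → O) => F (fun i => if h : i < t then w.1 ⟨i, h⟩ else a₀)
        fun i => if h : i - 1 < t then w.2 ⟨i - 1, h⟩ else o₀) ∘ word := by
    ext1 ω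
    refine hF _ _ _ _ (fun i h1 h2 => ?_) fun i h1 h2 => ?_
    · simp [word, h1, h2]
    · have h3 : i - 1 < t := by omega
      simp [word, h3, Nat.sub_add_cancel h1]
  rw [heq]
  exact (measurable_of_countable _).comp hword

end Trajectory

/-! ### Filtering: the law of the hidden state given the true parameter -/

namespace Trajectory

variable {S A O : Type*} [Fintype S] [Fintype A] [Fintype O]
  [MeasurableSpace S] [DiscreteMeasurableSpace S] [mA : MeasurableSpace A]
  [DiscreteMeasurableSpace A] [mO : MeasurableSpace O] [DiscreteMeasurableSpace O]
  {Ω : Type*} {m₀ mΩ : MeasurableSpace Ω} {P : Measure Ω} {L : Setup S A O}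
  {X : Trajectory S A O Ω} {H : ℝ}

/-- The law of the state at time `t + 1` given the history up to time `t`, along the trajectory. -/
noncomputable def predBeliefAt (X : Trajectory S A O Ω) (L : Setup S A O) (t : ℕ)
    (θ : TransKernel S A) (ω : Ω) : Belief S :=
  L.predBelief (fun i => X.act i ω) (fun i => X.obs i ω) t θ

theorem beliefAt_succ (t : ℕ) (θ : TransKernel S A) (ω : Ω) :
    X.beliefAt L (t + 1) θ ω = L.toPOMDP.bayes (X.predBeliefAt L t θ ω) (X.obs (t + 1) ω) :=
  L.belief_succ _ _ t θ

theorem measurable_predBeliefAt (hinit : Measurable L.init) {t : ℕ} {θ : Ω → TransKernel S A}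
    (hθ : Measurable[X.info m₀ t] θ) :
    Measurable[X.info m₀ t] fun ω => X.predBeliefAt L t (θ ω) ω :=
  L.measurable_predBelief (m := X.info m₀ t) hinit hθ t (fun _ h1 h2 => measurable_act_info h1 h2)
    fun _ h1 h2 => measurable_obs_info h1 h2

theorem measurable_beliefAt_preInfo (hinit : Measurable L.init) {t : ℕ} {θ : Ω → TransKernel S A}
    (hθ : Measurable[X.preInfo m₀ t] θ) :
    Measurable[X.preInfo m₀ t] fun ω => X.beliefAt L (t + 1) (θ ω) ω :=
  L.measurable_belief (m := X.preInfo m₀ t) hinit hθ (t + 1)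
    (fun _ h1 h2 => (measurable_act_info (m₀ := m₀) h1 (by omega)).mono le_sup_left le_rfl)
    fun _ h1 h2 => measurable_obs_preInfo h1 h2

theorem measurable_beliefAt_info (hinit : Measurable L.init) {t : ℕ} {θ : Ω → TransKernel S A}
    (hθ : Measurable[X.info m₀ t] θ) :
    Measurable[X.info m₀ t] fun ω => X.beliefAt L t (θ ω) ω :=
  L.measurable_belief (m := X.info m₀ t) hinit hθ t
    (fun _ h1 h2 => measurable_act_info h1 h2.le) fun _ h1 h2 => measurable_obs_info h1 h2

namespace IsPSRLRun

theorem full_le (hX : X.IsPSRLRun P L) (i j k : ℕ) : X.full i j k ≤ mΩ :=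
  sup_le (sup_le (sup_le hX.param_meas.comap_le
    (iSup₂_le fun l _ => (hX.state_meas l).comap_le))
    (iSup₂_le fun l _ => (hX.obs_meas l).comap_le))
    (iSup₂_le fun l _ => sup_le (hX.sample_meas l).comap_le (hX.act_meas l).comap_le)

theorem info_le (hX : X.IsPSRLRun P L) (h : m₀ ≤ X.paramInfo) (t : ℕ) : X.info m₀ t ≤ mΩ :=
  (info_le_full h 0 t).trans (hX.full_le 0 t t)

theorem preInfo_le (hX : X.IsPSRLRun P L) (h : m₀ ≤ X.paramInfo) (t : ℕ) : X.preInfo m₀ t ≤ mΩ :=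
  (preInfo_le_full h 0 t).trans (hX.full_le 0 (t + 1) t)

theorem hist_le (hX : X.IsPSRLRun P L) (t : ℕ) : X.hist t ≤ mΩ :=
  sup_le (iSup₂_le fun l _ => (hX.obs_meas l).comap_le)
    (iSup₂_le fun l _ => (hX.act_meas l).comap_le)

theorem histPlus_le (hX : X.IsPSRLRun P L) (t : ℕ) : X.histPlus t ≤ mΩ :=
  iSup₂_le fun l _ => sup_le (hX.obs_meas l).comap_le (hX.act_meas l).comap_le

end IsPSRLRun

/-- The event that a new episode starts at time `t`. -/
def startSet (X : Trajectory S A O Ω) (P : Measure Ω) (t : ℕ) : Set Ω := {ω | X.epStart P t ω = t}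

theorem measurableSet_startSet (P : Measure Ω) (t : ℕ) :
    MeasurableSet[X.hist t] (X.startSet P t) :=
  measurable_epStart_hist P le_rfl (MeasurableSet.of_discrete (s := {t}))

theorem startSet_one : X.startSet P 1 = Set.univ := by
  ext ω
  simp [startSet, epStart, episode_one]

variable [IsProbabilityMeasure P]

variable (P L X) in
/-- The law of the parameter used at time `t + 1`, given everything that precedes its choice. -/
noncomputable def sampleLaw (t : ℕ) (B : Set (TransKernel S A)) (ω : Ω) : ℝ :=
  (X.startSet P (t + 1)).indicator (fun ω => (X.posteriorAt L (t + 1) ω).real B) ω +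
    ((X.startSet P (t + 1))ᶜ ∩ X.sample t ⁻¹' B).indicator (fun _ => 1) ω

theorem abs_sampleLaw_le [IsProbabilityMeasure L.prior] (t : ℕ) (B : Set (TransKernel S A)) (ω : Ω) :
    |sampleLaw P L X t B ω| ≤ 1 := by
  have h1 : (X.posteriorAt L (t + 1) ω).real B ≤ 1 := L.posterior_real_le_one _ _ _ _
  have h0 : 0 ≤ (X.posteriorAt L (t + 1) ω).real B := measureReal_nonneg
  rw [sampleLaw]
  by_cases hω : ω ∈ X.startSet P (t + 1)
  · simp [hω, abs_of_nonneg h0, h1]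
  · by_cases hB : X.sample t ω ∈ B <;> simp [hω, hB]

theorem measurable_sampleLaw (P : Measure Ω) [IsProbabilityMeasure P] (t : ℕ)
    {B : Set (TransKernel S A)} (hB : MeasurableSet B) :
    Measurable[X.preInfo m₀ t] (sampleLaw P L X t B) := by
  obtain ⟨ω₀⟩ := P.nonempty_of_neZero
  have : Nonempty A := ⟨X.act 0 ω₀⟩
  have : Nonempty O := ⟨X.obs 0 ω₀⟩
  have hs : MeasurableSet[X.preInfo m₀ t] (X.startSet P (t + 1)) :=
    hist_le_preInfo t _ (measurableSet_startSet P (t + 1))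
  refine Measurable.add (Measurable.indicator ?_ hs) (measurable_indicator_one ?_)
  · exact (measurable_of_history
      (fun act obs => (L.posterior act obs (t + 1)).real B) (t + 1)
      fun act act' obs obs' ha ho => by simp only [L.posterior_congr ha ho]).mono
        (hist_le_preInfo t) le_rfl
  -- `X.sample 0` is not part of the information, but at time 1 an episode always starts, so the
  -- term that contains it is zero.
  · cases t with
    | zero =>
      rw [startSet_one]
      simp
    | succ t =>
      exact MeasurableSet.inter (m := X.preInfo m₀ (t + 1))
        (MeasurableSet.compl (m := X.preInfo m₀ (t + 1)) hs)
        (((measurable_sample_info (m₀ := m₀) (by omega) le_rfl).mono le_sup_left le_rfl) hB)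

namespace IsPSRLRun

variable (hX : X.IsPSRLRun P L)

include hX

/-- On the start set this is `sample_law`, off it `sample_keep`. The conditioning includes θ_* and
the states, whereas the resulting law is known to the agent: this is why sampling reveals nothing.
-/
theorem condEq_sample (t : ℕ) {B : Set (TransKernel S A)} (hB : MeasurableSet B) :
    CondEq P (X.full (t + 1) (t + 1) t) ((X.sample (t + 1) ⁻¹' B).indicator fun _ => 1)
      (sampleLaw P L X t B) := by
  have hfull := hX.full_le (t + 1) (t + 1) t
  have hsm : MeasurableSet[X.full (t + 1) (t + 1) t] (X.startSet P (t + 1)) :=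
    ((hist_le_preInfo (m₀ := X.paramInfo) t).trans (preInfo_le_full le_rfl _ _)) _
      (measurableSet_startSet P (t + 1))
  have hI := integrable_indicator_one (P := P) (hX.sample_meas (t + 1) hB)
  have h1 := (CondEq.condExp_self hfull hI).mul_left hfull (measurable_indicator_one hsm)
    (abs_indicator_one_le _)
  have hkeep : ∀ᵐ ω ∂P, ω ∉ X.startSet P (t + 1) → X.sample (t + 1) ω = X.sample t ω := by
    cases t with
    | zero => exact ae_of_all _ fun ω hω => absurd (by rw [startSet_one]; trivial) hω
    | succ t => exact hX.sample_keep (t + 1) (by omega)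
  have hE : MeasurableSet ((X.startSet P (t + 1))ᶜ ∩ X.sample t ⁻¹' B) :=
    (hfull _ hsm).compl.inter (hX.sample_meas t hB)
  have h2 := h1.add (CondEq.refl (P := P) (integrable_indicator_one hE))
  refine (CondEq.of_ae_eq hI ?_).trans (h2.trans (CondEq.of_ae_eq h2.int_right ?_))
  · filter_upwards [hkeep] with ω hω
    by_cases hs : ω ∈ X.startSet P (t + 1)
    · simp [hs]
    · have := hω hs
      by_cases hb : X.sample t ω ∈ B <;> simp [hs, hb, this]
  · filter_upwards [hX.sample_law (t + 1) (by omega) B hB] with ω hω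
    by_cases hs : ω ∈ X.startSet P (t + 1)
    · have h3 := hω hs
      simp only [sampleLaw, hs, Set.indicator_of_mem, one_mul]
      congr 1
    · simp [sampleLaw, hs]

/-- The choice of the action at time `t + 1` carries no information beyond what is known before. -/
theorem condEq_info_succ [IsProbabilityMeasure L.prior] (hinit : Measurable L.init)
    (hpol : Measurable fun x : TransKernel S A × Belief S => L.policy x.1 x.2)
    (h₀ : m₀ ≤ X.paramInfo) {t : ℕ} {Y y : Ω → ℝ} {c : ℝ}
    (h : CondEq P (X.preInfo m₀ t) Y y) (hY : Measurable[X.full (t + 1) (t + 1) t] Y)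
    (hy : Measurable[X.full (t + 1) (t + 1) t] y) (hYc : ∀ ω, |Y ω| ≤ c) (hyc : ∀ ω, |y ω| ≤ c) :
    CondEq P (X.info m₀ (t + 1)) Y y := by
  -- The sampled parameter is added first, by its conditional law; afterwards the action is almost
  -- surely a function of what is already in the conditioning.
  have h1 := h.sup_comap_of_condLaw (hX.sample_meas (t + 1)) (preInfo_le_full h₀ (t + 1) t)
    (hX.full_le _ _ _) hY hy hYc hyc (fun B hB => measurable_sampleLaw (L := L) P t hB)
    (fun B ω => abs_sampleLaw_le t B ω) fun B hB => hX.condEq_sample t hB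
  have hm : X.preInfo m₀ t ⊔ MeasurableSpace.comap (X.sample (t + 1)) inferInstance ≤ mΩ :=
    sup_le (hX.preInfo_le h₀ t) (hX.sample_meas (t + 1)).comap_le
  refine h1.sup_comap_of_ae_eq hm (hX.act_meas (t + 1)) ?_ (hX.act_eq (t + 1) (by omega))
  have hs : Measurable[X.preInfo m₀ t ⊔ MeasurableSpace.comap (X.sample (t + 1)) inferInstance]
      (X.sample (t + 1)) := (comap_measurable (X.sample (t + 1))).mono le_sup_right le_rfl
  have hb : Measurable[X.preInfo m₀ t ⊔ MeasurableSpace.comap (X.sample (t + 1)) inferInstance]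
      fun ω => X.beliefAt L (t + 1) (X.sample (t + 1) ω) ω :=
    L.measurable_belief (m := X.preInfo m₀ t ⊔ _) hinit hs (t + 1)
      (fun _ h1 h2 => (measurable_act_info (m₀ := m₀) h1 (by omega)).mono
        (le_sup_left.trans le_sup_left) le_rfl)
      fun _ h1 h2 => (measurable_obs_preInfo (m₀ := m₀) h1 h2).mono le_sup_left le_rfl
  exact hpol.comp (Measurable.prodMk (m := X.preInfo m₀ t ⊔ _) hs hb)

/-- Prediction of the observation, given a prediction of the state. -/
theorem condEq_state_obs {t : ℕ}
    (h : ∀ s, CondEq P (X.info X.paramInfo t) ((X.state (t + 1) ⁻¹' {s}).indicator fun _ => 1)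
      fun ω => X.predBeliefAt L t (X.param ω) ω s) (s : S) (o : O) :
    CondEq P (X.info X.paramInfo t)
      (fun ω => (X.obs (t + 1) ⁻¹' {o}).indicator (fun _ => 1) ω *
        (X.state (t + 1) ⁻¹' {s}).indicator (fun _ => 1) ω)
      fun ω => L.obsKernel s o * X.predBeliefAt L t (X.param ω) ω s := by
  have hfull := hX.full_le (t + 1) t t
  have hsm : Measurable[X.full (t + 1) t t] (X.state (t + 1)) :=
    (comap_measurable (X.state (t + 1))).mono (comap_state_le_full (by omega) le_rfl) le_rfl
  have hinfo : X.info X.paramInfo t ≤ X.full (t + 1) t t := info_le_full le_rfl _ _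
  have hlaw := hX.obs_law (t + 1) (by omega) o
  have h1 : CondEq P (X.full (t + 1) t t) ((X.obs (t + 1) ⁻¹' {o}).indicator fun _ => 1)
      fun ω => L.obsKernel (X.state (t + 1) ω) o :=
    CondEq.of_condExp hfull
      (integrable_indicator_one (hX.obs_meas (t + 1) (MeasurableSet.of_discrete)))
      (((measurable_of_countable fun s => L.obsKernel s o).comp hsm).stronglyMeasurable) hlaw
  have h2 := (h1.mul_right hfull
    (measurable_indicator_one (hsm (MeasurableSet.of_discrete (s := {s}))))
    (abs_indicator_one_le _)).mono hinfo hfull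
  have h3 := (h s).mul_left (hX.info_le le_rfl t)
    (measurable_const (a := L.obsKernel s o)) (c := |L.obsKernel s o|) fun _ => le_rfl
  refine h2.trans ((CondEq.of_ae_eq h2.int_right (ae_of_all _ fun ω => ?_)).trans h3)
  by_cases hs : X.state (t + 1) ω = s <;> simp [hs]

theorem condEq_obs {t : ℕ}
    (h : ∀ s, CondEq P (X.info X.paramInfo t) ((X.state (t + 1) ⁻¹' {s}).indicator fun _ => 1)
      fun ω => X.predBeliefAt L t (X.param ω) ω s) (o : O) :
    CondEq P (X.info X.paramInfo t) ((X.obs (t + 1) ⁻¹' {o}).indicator fun _ => 1)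
      fun ω => L.toPOMDP.obsWeight (X.predBeliefAt L t (X.param ω) ω) o := by
  have h1 := CondEq.sum (s := Finset.univ) fun s _ => hX.condEq_state_obs h s o
  refine (CondEq.of_ae_eq (integrable_indicator_one
    (hX.obs_meas (t + 1) (MeasurableSet.of_discrete))) (ae_of_all _ fun ω => ?_)).trans h1
  rw [← Finset.mul_sum]
  have h2 := apply_eq_sum_indicator (X.state (t + 1)) (fun _ _ => 1) ω
  simp only [mul_one] at h2
  rw [← h2, mul_one]

/-- Bayes' rule for the state. -/
theorem condEq_state_preInfo (hinit : Measurable L.init) {t : ℕ}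
    (h : ∀ s, CondEq P (X.info X.paramInfo t) ((X.state (t + 1) ⁻¹' {s}).indicator fun _ => 1)
      fun ω => X.predBeliefAt L t (X.param ω) ω s) (s : S) :
    CondEq P (X.preInfo X.paramInfo t) ((X.state (t + 1) ⁻¹' {s}).indicator fun _ => 1)
      fun ω => X.beliefAt L (t + 1) (X.param ω) ω s := by
  have hinfo := hX.info_le le_rfl t
  have hpm := measurable_predBeliefAt hinit (X := X) (measurable_param_info (X := X) t)
  have hbm : Measurable[X.preInfo X.paramInfo t] fun ω => X.beliefAt L (t + 1) (X.param ω) ω :=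
    measurable_beliefAt_preInfo hinit
      ((measurable_param_info (X := X) t).mono le_sup_left le_rfl)
  have hbi : Integrable (fun ω => X.beliefAt L (t + 1) (X.param ω) ω s) P :=
    integrable_of_abs_le (c := 1) ((hbm.belief_apply s).mono (hX.preInfo_le le_rfl t) le_rfl)
      fun ω => by rw [abs_of_nonneg (Belief.nonneg _ _)]; exact Belief.le_one _ _
  have hsi := integrable_indicator_one (P := P)
    (hX.state_meas (t + 1) (MeasurableSet.of_discrete (s := {s})))
  refine CondEq.sup_comap_of_finite hinfo (hX.obs_meas (t + 1)) hsi hbi fun o => ?_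
  rw [indicator_eq_mul _ (Set.indicator _ _),
    indicator_eq_mul _ fun ω => X.beliefAt L (t + 1) (X.param ω) ω s]
  have h1 := hX.condEq_state_obs h s o
  -- With the observation frozen at o the Bayes update is known before the observation. Multiplied
  -- by the probability of o it equals the joint weight in `condEq_state_obs`, with no division.
  have h2 := (hX.condEq_obs h o).mul_left hinfo
    (W := fun ω => L.toPOMDP.bayes (X.predBeliefAt L t (X.param ω) ω) o s)
    ((L.toPOMDP.measurable_bayes hpm o).belief_apply s) (c := 1)
    fun ω => by rw [abs_of_nonneg (Belief.nonneg _ _)]; exact Belief.le_one _ _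
  simp only [POMDP.bayes_mul_obsWeight] at h2
  refine h1.trans (h2.symm.trans (CondEq.of_ae_eq h2.int_left (ae_of_all _ fun ω => ?_)))
  by_cases ho : X.obs (t + 1) ω = o
  · simp only [beliefAt_succ, ho, mul_comm]
  · simp [ho]

/-- The transition probability depends on the hidden state, which is expanded over its finitely many
values; each coefficient is known and multiplies the belief in that state. -/
theorem condEq_state_succ {t : ℕ}
    (h : ∀ s, CondEq P (X.info X.paramInfo (t + 1))
      ((X.state (t + 1) ⁻¹' {s}).indicator fun _ => 1)
      fun ω => X.beliefAt L (t + 1) (X.param ω) ω s) (s' : S) :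
    CondEq P (X.info X.paramInfo (t + 1)) ((X.state (t + 2) ⁻¹' {s'}).indicator fun _ => 1)
      fun ω => X.predBeliefAt L (t + 1) (X.param ω) ω s' := by
  have hfull := hX.full_le (t + 1) (t + 1) (t + 1)
  have hinfo := hX.info_le le_rfl (t + 1)
  have hsm : Measurable[X.full (t + 1) (t + 1) (t + 1)] (X.state (t + 1)) :=
    (comap_measurable (X.state (t + 1))).mono (comap_state_le_full (by omega) le_rfl) le_rfl
  have hle : X.info X.paramInfo (t + 1) ≤ X.full (t + 1) (t + 1) (t + 1) := info_le_full le_rfl _ _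
  have hkm : ∀ s, Measurable[X.info X.paramInfo (t + 1)]
      fun ω => X.param ω s (X.act (t + 1) ω) s' := fun s =>
    measurable_comp_of_countable (m := X.info X.paramInfo (t + 1))
      (f := fun a ω => X.param ω s a s')
      (fun a => ((measurable_param_info (t + 1)).kernel_apply s a).belief_apply s')
      (measurable_act_info (by omega) le_rfl)
  have hkm' : Measurable[X.full (t + 1) (t + 1) (t + 1)]
      fun ω => X.param ω (X.state (t + 1) ω) (X.act (t + 1) ω) s' :=
    measurable_comp_of_countable (m := X.full (t + 1) (t + 1) (t + 1))
      (f := fun s ω => X.param ω s (X.act (t + 1) ω) s') (fun s => (hkm s).mono hle le_rfl) hsm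
  have h1 : CondEq P (X.full (t + 1) (t + 1) (t + 1))
      ((X.state (t + 2) ⁻¹' {s'}).indicator fun _ => 1)
      fun ω => X.param ω (X.state (t + 1) ω) (X.act (t + 1) ω) s' :=
    CondEq.of_condExp hfull
      (integrable_indicator_one (hX.state_meas (t + 2) (MeasurableSet.of_discrete)))
      hkm'.stronglyMeasurable (hX.state_law (t + 1) (by omega) s')
  have h2 := CondEq.sum (s := Finset.univ) fun s _ => (h s).mul_left hinfo (hkm s) (c := 1)
    fun ω => by rw [abs_of_nonneg (Belief.nonneg _ _)]; exact Belief.le_one _ _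
  have h3 := h1.mono hle hfull
  refine h3.trans ((CondEq.of_ae_eq h3.int_right (ae_of_all _ fun ω => ?_)).trans h2)
  simp only
  rw [apply_eq_sum_indicator (X.state (t + 1)) (fun s ω => X.param ω s (X.act (t + 1) ω) s') ω]
  simp_rw [mul_comm]

/-- Given the true parameter, the observations, the sampled parameters and the actions, the law of
the state is the belief computed with the true parameter. -/
theorem condEq_state_pred (hL : L.IsAdmissible H) (t : ℕ) (s : S) :
    CondEq P (X.info X.paramInfo t) ((X.state (t + 1) ⁻¹' {s}).indicator fun _ => 1)
      fun ω => X.predBeliefAt L t (X.param ω) ω s := by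
  have := hL.prob
  induction t generalizing s with
  | zero =>
    have hle : X.paramInfo ≤ X.full 0 0 0 := paramInfo_le_full
    have h1 : CondEq P (X.full 0 0 0) ((X.state 1 ⁻¹' {s}).indicator fun _ => 1)
        fun ω => L.init (X.param ω) s :=
      CondEq.of_condExp (hX.full_le 0 0 0)
        (integrable_indicator_one (hX.state_meas 1 (MeasurableSet.of_discrete)))
        ((hL.init_meas.comp
          ((comap_measurable X.param).mono hle le_rfl)).belief_apply s).stronglyMeasurable
        (hX.init_law s)
    exact h1.mono hle (hX.full_le 0 0 0)
  | succ t ih =>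
    refine hX.condEq_state_succ (fun s => ?_) s
    refine hX.condEq_info_succ hL.init_meas hL.policy_meas le_rfl (c := 1)
      (hX.condEq_state_preInfo hL.init_meas ih s) ?_ ?_ (abs_indicator_one_le _) fun ω => ?_
    · exact measurable_indicator_one (((comap_measurable (X.state (t + 1))).mono
        (comap_state_le_full (by omega) le_rfl) le_rfl) (MeasurableSet.of_discrete (s := {s})))
    · exact ((measurable_beliefAt_preInfo hL.init_meas ((measurable_param_info t).mono le_sup_left
        le_rfl)).belief_apply s).mono (preInfo_le_full le_rfl _ _) le_rfl
    · rw [abs_of_nonneg (Belief.nonneg _ _)]; exact Belief.le_one _ _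

/-- The form used for averages at time t + 1: the conditioning already contains the action of that
time, which depends on the state only through the history. -/
theorem condEq_state (hL : L.IsAdmissible H) (t : ℕ) (s : S) :
    CondEq P (X.info X.paramInfo (t + 1)) ((X.state (t + 1) ⁻¹' {s}).indicator fun _ => 1)
      fun ω => X.beliefAt L (t + 1) (X.param ω) ω s := by
  have := hL.prob
  refine hX.condEq_info_succ hL.init_meas hL.policy_meas le_rfl (c := 1)
    (hX.condEq_state_preInfo hL.init_meas (hX.condEq_state_pred hL t) s) ?_ ?_
    (abs_indicator_one_le _) fun ω => ?_
  · exact measurable_indicator_one (((comap_measurable (X.state (t + 1))).mono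
      (comap_state_le_full (by omega) le_rfl) le_rfl) (MeasurableSet.of_discrete (s := {s})))
  · exact ((measurable_beliefAt_preInfo hL.init_meas ((measurable_param_info t).mono le_sup_left
      le_rfl)).belief_apply s).mono (preInfo_le_full le_rfl _ _) le_rfl
  · rw [abs_of_nonneg (Belief.nonneg _ _)]; exact Belief.le_one _ _

end IsPSRLRun

end Trajectory

/-! ### The law of the parameter given the history, and posterior sampling -/

namespace Trajectory

variable {S A O : Type*} [Fintype S] [Fintype A] [Fintype O]
  [MeasurableSpace S] [DiscreteMeasurableSpace S] [mA : MeasurableSpace A]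
  [DiscreteMeasurableSpace A] [mO : MeasurableSpace O] [DiscreteMeasurableSpace O]
  {Ω : Type*} {m₀ mΩ : MeasurableSpace Ω} {P : Measure Ω} {L : Setup S A O}
  {X : Trajectory S A O Ω} {H : ℝ}

/-- The actions and observations up to time `t`, as an element of a finite set. -/
def word (X : Trajectory S A O Ω) (t : ℕ) (ω : Ω) : Fin t → A × O :=
  fun i => (X.act (i + 1) ω, X.obs (i + 1) ω)

/-- A pair of sequences that starts with the given actions and observations. -/
noncomputable def unword [Nonempty A] [Nonempty O] {t : ℕ} (w : Fin t → A × O) (i : ℕ) : A × O :=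
  if h : i - 1 < t then w ⟨i - 1, h⟩ else Classical.arbitrary _

theorem unword_word [Nonempty A] [Nonempty O] (t : ℕ) (ω : Ω) {i : ℕ} (h1 : 1 ≤ i) (h2 : i ≤ t) :
    unword (X.word t ω) i = (X.act i ω, X.obs i ω) := by
  have h : i - 1 < t := by omega
  simp [unword, word, h, Nat.sub_add_cancel h1]

theorem measurable_word (t : ℕ) : Measurable[X.info m₀ t] (X.word t) := by
  let _ := X.info m₀ t
  exact measurable_pi_lambda _ fun i => (measurable_act_info (m₀ := m₀) (by omega) i.2).prodMk
    (measurable_obs_info (m₀ := m₀) (by omega) i.2)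

/-- A quantity determined by the actions and observations up to time `t` is a function of the
word. -/
theorem eq_unword [Nonempty A] [Nonempty O] {β : Type*} (F : (ℕ → A) → (ℕ → O) → β) {t : ℕ}
    (hF : ∀ act act' obs obs', (∀ i, 1 ≤ i → i ≤ t → act i = act' i) →
      (∀ i, 1 ≤ i → i ≤ t → obs i = obs' i) → F act obs = F act' obs') (ω : Ω) :
    F (fun i => X.act i ω) (fun i => X.obs i ω) =
      F (fun i => (unword (X.word t ω) i).1) fun i => (unword (X.word t ω) i).2 :=
  hF _ _ _ _ (fun i h1 h2 => by rw [unword_word t ω h1 h2])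
    fun i h1 h2 => by rw [unword_word t ω h1 h2]

variable [IsProbabilityMeasure P]

namespace IsPSRLRun

/-- The posterior law of the parameter also applies to functions of the parameter and of the
actions and observations so far. -/
theorem condEq_param_history [Nonempty A] [Nonempty O] (hX : X.IsPSRLRun P L) {t : ℕ}
    (h : ∀ (φ : TransKernel S A → ℝ) (c : ℝ), Measurable φ → (∀ θ, |φ θ| ≤ c) →
      CondEq P (X.info ⊥ t) (fun ω => φ (X.param ω)) fun ω => ∫ θ, φ θ ∂X.posteriorAt L t ω)
    (F : (ℕ → A) → (ℕ → O) → TransKernel S A → ℝ) {c : ℝ}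
    (hF : ∀ act act' obs obs', (∀ i, 1 ≤ i → i ≤ t → act i = act' i) →
      (∀ i, 1 ≤ i → i ≤ t → obs i = obs' i) → F act obs = F act' obs')
    (hm : ∀ act obs, Measurable (F act obs)) (hc : ∀ act obs θ, |F act obs θ| ≤ c) :
    CondEq P (X.info ⊥ t) (fun ω => F (fun i => X.act i ω) (fun i => X.obs i ω) (X.param ω))
      fun ω => ∫ θ, F (fun i => X.act i ω) (fun i => X.obs i ω) θ ∂X.posteriorAt L t ω := by
  simp_rw [eq_unword F hF]
  exact CondEq.comp_of_finite (hX.info_le bot_le t) (measurable_word t)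
    (F := fun w ω => F (fun i => (unword w i).1) (fun i => (unword w i).2) (X.param ω))
    (G := fun w ω => ∫ θ, F (fun i => (unword w i).1) (fun i => (unword w i).2) θ
      ∂X.posteriorAt L t ω) fun w => h _ c (hm _ _) (hc _ _)

/-- Bayes' rule for the parameter. -/
theorem condEq_param_preInfo (hX : X.IsPSRLRun P L) (hL : L.IsAdmissible H) {t : ℕ}
    (h : ∀ (φ : TransKernel S A → ℝ) (c : ℝ), Measurable φ → (∀ θ, |φ θ| ≤ c) →
      CondEq P (X.info ⊥ t) (fun ω => φ (X.param ω)) fun ω => ∫ θ, φ θ ∂X.posteriorAt L t ω)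
    (φ : TransKernel S A → ℝ) {c : ℝ} (hφ : Measurable φ) (hc : ∀ θ, |φ θ| ≤ c) :
    CondEq P (X.preInfo ⊥ t) (fun ω => φ (X.param ω))
      fun ω => ∫ θ, φ θ ∂X.posteriorAt L (t + 1) ω := by
  have := hL.prob
  obtain ⟨ω₀⟩ := P.nonempty_of_neZero
  have : Nonempty A := ⟨X.act 0 ω₀⟩
  have : Nonempty O := ⟨X.obs 0 ω₀⟩
  have hinfo := hX.info_le (bot_le : ⊥ ≤ X.paramInfo) t
  have hφi : Integrable (fun ω => φ (X.param ω)) P :=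
    integrable_of_abs_le (hφ.comp hX.param_meas) fun ω => hc _
  have hpm : Measurable fun ω => ∫ θ, φ θ ∂X.posteriorAt L (t + 1) ω :=
    (measurable_of_history (fun act obs => ∫ θ, φ θ ∂L.posterior act obs (t + 1)) (t + 1)
      fun act act' obs obs' ha ho => by simp only [L.posterior_congr ha ho]).mono
        (hX.hist_le (t + 1)) le_rfl
  have hpi : Integrable (fun ω => ∫ θ, φ θ ∂X.posteriorAt L (t + 1) ω) P :=
    integrable_of_abs_le hpm fun ω => L.abs_integral_posterior_le _ _ _ hc
  refine CondEq.sup_comap_of_finite hinfo (hX.obs_meas (t + 1)) hφi hpi fun o => ?_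
  rw [indicator_eq_mul _ fun ω => φ (X.param ω),
    indicator_eq_mul _ fun ω => ∫ θ, φ θ ∂X.posteriorAt L (t + 1) ω]
  -- the posterior after observing `o`
  let post : (ℕ → A) → (ℕ → O) → Measure (TransKernel S A) := fun act obs =>
    L.posterior act (Function.update obs (t + 1) o) (t + 1)
  have hpost : ∀ act act' obs obs', (∀ i, 1 ≤ i → i ≤ t → act i = act' i) →
      (∀ i, 1 ≤ i → i ≤ t → obs i = obs' i) → post act obs = post act' obs' :=
    fun act act' obs obs' ha ho => L.posterior_congr (fun i h1 h2 => ha i h1 (by omega))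
      fun i h1 h2 => by
        rcases Nat.lt_or_ge t i with hi | hi
        · obtain rfl : i = t + 1 := by omega
          simp
        · rw [Function.update_of_ne (by omega), Function.update_of_ne (by omega)]
          exact ho i h1 hi
  have hupd : ∀ (obs : ℕ → O) i, 1 ≤ i → i ≤ t → Function.update obs (t + 1) o i = obs i :=
    fun obs i _ h2 => Function.update_of_ne (by omega) _ _
  have hpb : ∀ act obs θ, L.predBelief act (Function.update obs (t + 1) o) t θ =
      L.predBelief act obs t θ := fun act obs θ =>
    L.predBelief_congr (fun _ _ _ => rfl) (hupd obs) θ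
  have hpp : ∀ act obs, L.posterior act (Function.update obs (t + 1) o) t =
      L.posterior act obs t := fun act obs => L.posterior_congr (fun _ _ _ => rfl) (hupd obs)
  have hbm : ∀ act obs, Measurable fun θ => L.predBelief act obs t θ := fun act obs =>
    L.measurable_predBelief (Ω := TransKernel S A) (act := fun i _ => act i)
      (obs := fun i _ => obs i) hL.init_meas measurable_id t (fun _ _ _ => measurable_const)
      fun _ _ _ => measurable_const
  have hw0 : ∀ act obs θ, |L.toPOMDP.obsWeight (L.predBelief act obs t θ) o| ≤ 1 :=
    fun act obs θ => by
      rw [abs_of_nonneg (L.toPOMDP.obsWeight_nonneg _ _)]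
      exact L.toPOMDP.obsWeight_le_one _ _
  -- Given θ_* the next observation is o with the predicted weight; then θ_* is averaged with the
  -- current posterior.
  have key : ∀ (ψ : TransKernel S A → ℝ) (c : ℝ), Measurable ψ → (∀ θ, |ψ θ| ≤ c) →
      CondEq P (X.info ⊥ t)
        (fun ω => (X.obs (t + 1) ⁻¹' {o}).indicator (fun _ => 1) ω * ψ (X.param ω))
        fun ω => ∫ θ, ψ θ * L.toPOMDP.obsWeight (X.predBeliefAt L t θ ω) o
          ∂X.posteriorAt L t ω := by
    intro ψ c hψ hc
    have h1 := ((hX.condEq_obs (hX.condEq_state_pred hL t) o).mul_right (hX.info_le le_rfl t)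
      (hψ.comp (measurable_param_info t)) fun ω => hc (X.param ω)).mono (info_mono bot_le t)
      (hX.info_le le_rfl t)
    have h2 := hX.condEq_param_history h
      (fun act obs θ => ψ θ * L.toPOMDP.obsWeight (L.predBelief act obs t θ) o) (c := c * 1)
      (fun act act' obs obs' ha ho => by ext θ; simp only [L.predBelief_congr ha ho])
      (fun act obs => hψ.mul (L.toPOMDP.measurable_obsWeight (hbm act obs) o))
      fun act obs θ => by
        rw [abs_mul]
        exact mul_le_mul (hc θ) (hw0 _ _ _) (abs_nonneg _) ((abs_nonneg _).trans (hc θ))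
    exact h1.trans ((CondEq.of_ae_eq h1.int_right (ae_of_all _ fun ω => mul_comm _ _)).trans h2)
  have hpm' : Measurable[X.info ⊥ t]
      fun ω => ∫ θ, φ θ ∂post (fun i => X.act i ω) fun i => X.obs i ω := by
    simp_rw [eq_unword (X := X) post hpost]
    exact (measurable_of_countable fun w : Fin t → A × O =>
      ∫ θ, φ θ ∂post (fun i => (unword w i).1) fun i => (unword w i).2).comp (measurable_word t)
  -- ψ = 1, times the posterior mean of φ after seeing o, gives that mean times the normaliser. By
  -- `integral_posterior_succ_mul` this is the right-hand side for ψ = φ.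
  have h3 := (key (fun _ => 1) 1 measurable_const fun _ => by simp).mul_left hinfo hpm'
    fun ω => L.abs_integral_posterior_le _ _ _ hc
  refine (key φ c hφ hc).trans (CondEq.trans (CondEq.of_ae_eq (key φ c hφ hc).int_right
    (ae_of_all _ fun ω => ?_)) (h3.symm.trans (CondEq.of_ae_eq h3.int_left
    (ae_of_all _ fun ω => ?_))))
  · have h4 := L.integral_posterior_succ_mul (fun i => X.act i ω)
      (Function.update (fun i => X.obs i ω) (t + 1) o) t (hbm _ _) φ
    simp only [hpb, hpp, Function.update_self] at h4
    simp only [one_mul]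
    exact h4.symm
  · by_cases ho : X.obs (t + 1) ω = o
    · simp only [Set.indicator_of_mem (show ω ∈ X.obs (t + 1) ⁻¹' {o} from ho), mul_one, one_mul]
      congr 1
      exact L.posterior_congr (fun _ _ _ => rfl) fun i h1 h2 => by
        rcases Nat.lt_or_ge t i with hi | hi
        · obtain rfl : i = t + 1 := by omega
          simp [ho]
        · rw [Function.update_of_ne (by omega)]
    · simp [ho]

/-- Given the observations, the sampled parameters and the actions, the law of the true parameter is
the posterior. -/
theorem condEq_param (hX : X.IsPSRLRun P L) (hL : L.IsAdmissible H) (t : ℕ)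
    (φ : TransKernel S A → ℝ) {c : ℝ} (hφ : Measurable φ) (hc : ∀ θ, |φ θ| ≤ c) :
    CondEq P (X.info ⊥ t) (fun ω => φ (X.param ω)) fun ω => ∫ θ, φ θ ∂X.posteriorAt L t ω := by
  have := hL.prob
  induction t generalizing φ c with
  | zero =>
    refine CondEq.bot (integrable_of_abs_le (hφ.comp hX.param_meas) fun ω => hc _)
      (integrable_const (∫ θ, φ θ ∂L.prior)) ?_
    simp only [posteriorAt, Setup.posterior, integral_const, probReal_univ, one_smul]
    rw [← hX.param_law, integral_map hX.param_meas.aemeasurable hφ.aestronglyMeasurable]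
  | succ t ih =>
    obtain ⟨ω₀⟩ := P.nonempty_of_neZero
    have : Nonempty A := ⟨X.act 0 ω₀⟩
    have : Nonempty O := ⟨X.obs 0 ω₀⟩
    refine hX.condEq_info_succ hL.init_meas hL.policy_meas bot_le (c := |c|)
      (hX.condEq_param_preInfo hL (fun φ c hφ hc => ih φ hφ hc) φ hφ hc) ?_ ?_
      (fun ω => (hc _).trans (le_abs_self c)) fun ω => L.abs_integral_posterior_le _ _ _ hc
    · exact hφ.comp ((comap_measurable X.param).mono paramInfo_le_full le_rfl)
    · exact (measurable_of_history (fun act obs => ∫ θ, φ θ ∂L.posterior act obs (t + 1)) (t + 1)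
        fun act act' obs obs' ha ho => by simp only [L.posterior_congr ha ho]).mono
          ((hist_le_preInfo (m₀ := X.paramInfo) t).trans (preInfo_le_full le_rfl _ _)) le_rfl

/-- Posterior sampling: where an episode starts, the sampled parameter and the true one have the same
law jointly with any function of the history. -/
theorem map_sample_eq_map_param (hX : X.IsPSRLRun P L) (hL : L.IsAdmissible H) {t : ℕ} (ht : 1 ≤ t)
    {β : Type*} [MeasurableSpace β] {Z : Ω → β} (hZ : Measurable[X.hist t] Z) :
    (P.restrict (X.startSet P t)).map (fun ω => (Z ω, X.sample t ω)) =
      (P.restrict (X.startSet P t)).map fun ω => (Z ω, X.param ω) := by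
  obtain ⟨t, rfl⟩ := Nat.exists_eq_add_of_le' ht
  have hZ' : Measurable Z := hZ.mono (hX.hist_le _) le_rfl
  refine Measure.ext_prod fun {C B} hC hB => ?_
  have hE : MeasurableSet[X.hist (t + 1)] (X.startSet P (t + 1) ∩ Z ⁻¹' C) :=
    MeasurableSet.inter (m := X.hist (t + 1)) (measurableSet_startSet P _) (hZ hC)
  have hE' := hX.hist_le _ _ hE
  rw [Measure.map_apply (hZ'.prodMk (hX.sample_meas _)) (hC.prod hB),
    Measure.map_apply (hZ'.prodMk hX.param_meas) (hC.prod hB),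
    Measure.restrict_apply ((hZ'.prodMk (hX.sample_meas _)) (hC.prod hB)),
    Measure.restrict_apply ((hZ'.prodMk hX.param_meas) (hC.prod hB))]
  rw [← ENNReal.toReal_eq_toReal_iff' (measure_ne_top _ _) (measure_ne_top _ _)]
  have hset : ∀ {U : Ω → TransKernel S A}, Measurable U →
      (P ((fun ω => (Z ω, U ω)) ⁻¹' C ×ˢ B ∩ X.startSet P (t + 1))).toReal =
        ∫ ω in X.startSet P (t + 1) ∩ Z ⁻¹' C, (U ⁻¹' B).indicator (fun _ => (1 : ℝ)) ω ∂P := by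
    intro U hU
    rw [setIntegral_indicator (hU hB), setIntegral_const, smul_eq_mul, mul_one]
    congr 2
    ext ω
    simp only [Set.mem_inter_iff, Set.mem_preimage, Set.mem_prod]
    tauto
  rw [hset (hX.sample_meas _), hset hX.param_meas]
  have hfull := (hist_le_preInfo (X := X) (m₀ := X.paramInfo) t).trans
    (preInfo_le_full le_rfl (t + 1) t)
  -- Over a history event inside the start set, both probabilities become the integral of the
  -- posterior mass of B.
  rw [(hX.condEq_sample t hB).setIntegral_eq (hX.full_le _ _ _) (hfull _ hE)]
  have h1 := (hX.condEq_param_preInfo hL (fun φ c hφ hc => hX.condEq_param hL t φ hφ hc)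
    (B.indicator fun _ => 1) (c := 1) (measurable_indicator_one hB)
    (abs_indicator_one_le B)).setIntegral_eq (hX.preInfo_le bot_le t)
    (hist_le_preInfo (m₀ := ⊥) t _ hE)
  have h2 : (X.param ⁻¹' B).indicator (fun _ => (1 : ℝ)) =
      fun ω => B.indicator (fun _ => 1) (X.param ω) := rfl
  rw [h2, h1]
  refine setIntegral_congr_fun hE' fun ω hω => ?_
  have := hL.prob
  have := L.isFiniteMeasure_posterior (fun i => X.act i ω) (fun i => X.obs i ω) (t + 1)
  simp only [sampleLaw, Set.indicator_of_mem hω.1]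
  rw [Set.indicator_of_notMem (fun h => h.1 hω.1), add_zero, integral_indicator_const _ hB,
    smul_eq_mul, mul_one]

end IsPSRLRun

end Trajectory

/-! ### Counting episodes and summing over them -/

section EpisodeCount

variable {S A : Type*} [Fintype S] [Fintype A] (m : ℕ → S → A → ℕ)

/-- The number of episodes that start up to time `T`. -/
def numStarts (T : ℕ) : ℕ := ((Finset.Icc 1 T).filter fun t => (episode m t).1 = t).card

theorem numStarts_succ_of_stays {T : ℕ} (h : episodeStays m T) :
    numStarts m (T + 1) = numStarts m T := by
  rw [numStarts, ← Finset.insert_Icc_right_eq_Icc_add_one (by omega), Finset.filter_insert,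
    if_neg ((episode_fst_succ_ne_iff m T).2 h)]
  rfl

theorem numStarts_succ_of_not_stays {T : ℕ} (h : ¬ episodeStays m T) :
    numStarts m (T + 1) = numStarts m T + 1 := by
  rw [numStarts, ← Finset.insert_Icc_right_eq_Icc_add_one (by omega), Finset.filter_insert,
    if_pos (by rw [episode_succ_of_not_stays m h]), Finset.card_insert_of_notMem (by simp)]
  rfl

theorem numStarts_one : numStarts m 1 = 1 := by
  rw [numStarts_succ_of_not_stays m (not_episodeStays_zero m)]
  simp [numStarts]

theorem numStarts_le (T : ℕ) : numStarts m T ≤ T := by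
  refine (Finset.card_filter_le _ _).trans ?_
  simp

variable {m}

/-- Bookkeeping for the number of episodes: `M` counts the episodes that were ended by the counts,
`j` is the number of episodes since the last one of these, and `W` is a sum of lower bounds for the
lengths. -/
theorem exists_macro_count (hm : Monotone m) {T : ℕ} (hT : 1 ≤ T) :
    ∃ j M W : ℕ, 1 ≤ j ∧ j ≤ (episode m T).2 ∧ W ≤ (episode m T).1 ∧
      (∀ x : ℝ, 2 * x * numStarts m T ≤ x ^ 2 * M + 2 * W - j * (j + 1) + 2 * x * j) ∧
      (M : ℝ) ≤ ∑ s, ∑ a, Real.logb 2 (m (episode m T).1 s a + 1) := by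
  induction T, hT using Nat.le_induction with
  | base =>
    refine ⟨1, 0, 1, le_rfl, by rw [episode_one], by rw [episode_one], fun x => ?_, ?_⟩
    · rw [numStarts_one]; norm_num
    · simp only [Nat.cast_zero]
      exact Finset.sum_nonneg fun s _ => Finset.sum_nonneg fun a _ =>
        Real.logb_nonneg (by norm_num) (by simp)
  | succ T hT ih =>
    obtain ⟨j, M, W, hj1, hj, hW, hx, hM⟩ := ih
    by_cases h : episodeStays m T
    · rw [numStarts_succ_of_stays m h, episode_succ_of_stays m h]
      exact ⟨j, M, W, hj1, hj, hW, hx, hM⟩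
    rw [numStarts_succ_of_not_stays m h, episode_succ_of_not_stays m h]
    have hle := episode_fst_le m T
    have hlog : ∀ s a, Real.logb 2 (m (episode m T).1 s a + 1) ≤
        Real.logb 2 (m (T + 1) s a + 1) := fun s a =>
      Real.logb_le_logb_of_le (by norm_num) (by positivity) (by
        have := hm (show (episode m T).1 ≤ T + 1 by omega) s a
        exact_mod_cast Nat.add_le_add_right this 1)
    by_cases hc : ∀ s a, m (T + 1) s a ≤ 2 * m (episode m T).1 s a
    · have hlen : (episode m T).1 + (episode m T).2 < T + 1 := by
        by_contra h'
        exact h ⟨by omega, hc⟩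
      -- The schedule ran out, so the finished episode was longer than its predecessor and its
      -- length is at least j + 1. The changes of 2W and of -j(j+1) cancel, so the inequality is
      -- carried over exactly.
      refine ⟨j + 1, M, W + (j + 1), by omega, by simp only; omega, by simp only; omega,
        fun x => ?_, hM.trans (Finset.sum_le_sum fun s _ => Finset.sum_le_sum fun a _ => hlog s a)⟩
      have := hx x
      push_cast
      nlinarith
    · push Not at hc
      obtain ⟨s₀, a₀, h0⟩ := hc
      -- A count more than doubled and j restarts at 1. The inequality survives because 2xj - j² ≤
      -- x², which pays for the new unit of M.
      refine ⟨1, M + 1, W + 1, le_rfl, by simp only; omega, by simp only; omega, fun x => ?_, ?_⟩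
      · have := hx x
        have hj0 : (0 : ℝ) ≤ j := by positivity
        push_cast
        nlinarith [sq_nonneg (x - j)]
      -- For integers, exceeding 2m means at least 2m + 1, so m + 1 doubles and its binary logarithm
      -- grows by one.
      · have h1 : Real.logb 2 (m (episode m T).1 s₀ a₀ + 1) + 1 ≤
            Real.logb 2 (m (T + 1) s₀ a₀ + 1) := by
          have h2 : (1 : ℝ) = Real.logb 2 2 := (Real.logb_self_eq_one (by norm_num)).symm
          nth_rewrite 2 [h2]
          rw [← Real.logb_mul (by positivity) (by norm_num)]
          refine Real.logb_le_logb_of_le (by norm_num) (by positivity) ?_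
          have : 2 * m (episode m T).1 s₀ a₀ + 1 ≤ m (T + 1) s₀ a₀ := h0
          have h3 : (2 * m (episode m T).1 s₀ a₀ + 1 : ℝ) ≤ m (T + 1) s₀ a₀ := by exact_mod_cast this
          linarith
        push_cast
        have h4 : ∑ s, ∑ a, (Real.logb 2 (m (episode m T).1 s a + 1)) + 1 ≤
            ∑ s, ∑ a, Real.logb 2 (m (T + 1) s a + 1) := by
          rw [← Fintype.sum_prod_type', ← Fintype.sum_prod_type' (f := fun s a =>
            Real.logb 2 (m (T + 1) s a + 1))]
          classical
          rw [← Finset.add_sum_erase _ _ (Finset.mem_univ (s₀, a₀)),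
            ← Finset.add_sum_erase (f := fun x : S × A => Real.logb 2 (m (T + 1) x.1 x.2 + 1))
              _ (Finset.mem_univ (s₀, a₀))]
          have h5 := Finset.sum_le_sum (s := Finset.univ.erase (s₀, a₀))
            fun (x : S × A) _ => hlog x.1 x.2
          simp only
          linarith
        linarith

/-- A block of j episodes between two count-triggered ends has recorded lengths at least 1, …, j, so
it takes time of order j²/2, and there are at most 1 + |S||A| log₂(T+1) blocks. The inequality with
a free x plays the role of Cauchy–Schwarz over the blocks. -/
theorem numStarts_le_sqrt (hm : Monotone m) {T : ℕ} (hT : 1 ≤ T) (hmT : ∀ t ≤ T, ∀ s a, m t s a ≤ T) :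
    (numStarts m T : ℝ) ≤ Real.sqrt
      (2 * T * (1 + Fintype.card S * Fintype.card A * Real.logb 2 (T + 1))) := by
  obtain ⟨j, M, W, -, -, hW, hx, hM⟩ := exists_macro_count hm hT
  set B : ℝ := Fintype.card S * Fintype.card A * Real.logb 2 (T + 1) with hB
  have hMB : (M : ℝ) ≤ B := by
    refine hM.trans ?_
    calc _ ≤ ∑ s : S, ∑ a : A, Real.logb 2 (T + 1) :=
          Finset.sum_le_sum fun s _ => Finset.sum_le_sum fun a _ =>
            Real.logb_le_logb_of_le (by norm_num) (by positivity) (by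
              have := hmT _ (episode_fst_le m T) s a
              exact_mod_cast Nat.add_le_add_right this 1)
      _ = B := by simp [hB, mul_assoc]
  have hWT : (W : ℝ) ≤ T := by exact_mod_cast hW.trans (episode_fst_le m T)
  have hB0 : 0 < 1 + B := by
    have : (0 : ℝ) ≤ M := by positivity
    linarith
  apply Real.le_sqrt_of_sq_le
  -- The best x is the number of episodes divided by the bound on the number of blocks.
  have h1 := hx (numStarts m T / (1 + B))
  set K : ℝ := (numStarts m T : ℝ)
  set x := K / (1 + B) with hxd
  have hK : K = x * (1 + B) := by rw [hxd]; field_simp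
  have hj0 : (0 : ℝ) ≤ j := by positivity
  have h2 : x ^ 2 * M ≤ x ^ 2 * B := mul_le_mul_of_nonneg_left hMB (sq_nonneg x)
  have h3 : x ^ 2 * (1 + B) ≤ 2 * T := by
    rw [hK] at h1
    nlinarith [sq_nonneg (x - j)]
  calc K ^ 2 = x ^ 2 * (1 + B) * (1 + B) := by rw [hK]; ring
    _ ≤ 2 * T * (1 + B) := mul_le_mul_of_nonneg_right h3 hB0.le

theorem sum_Icc_succ {M : Type*} [AddCommMonoid M] (f : ℕ → M) (T : ℕ) :
    ∑ t ∈ Finset.Icc 1 (T + 1), f t = ∑ t ∈ Finset.Icc 1 T, f t + f (T + 1) :=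
  Finset.sum_Icc_succ_top (by omega) f

theorem sum_start_mul (g : ℕ → ℝ) (T : ℕ) :
    (∑ t ∈ Finset.Icc 1 (T + 1), if (episode m t).1 = t then g t else 0) =
      (∑ t ∈ Finset.Icc 1 T, if (episode m t).1 = t then g t else 0) +
        open Classical in if episodeStays m T then 0 else g (T + 1) := by
  rw [sum_Icc_succ]
  congr 1
  by_cases h : episodeStays m T
  · rw [if_neg ((episode_fst_succ_ne_iff m T).2 h), if_pos h]
  · rw [if_pos (by rw [episode_succ_of_not_stays m h]), if_neg h]

/-- The scheduled lengths of the previous episodes add up to the current start time. -/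
theorem sum_start_len (T : ℕ) :
    (∑ t ∈ Finset.Icc 1 T, if (episode m t).1 = t then ((episode m t).2 : ℝ) else 0) =
      (episode m T).1 := by
  induction T with
  | zero => simp [episode]
  | succ T ih =>
    rw [sum_start_mul (fun t => ((episode m t).2 : ℝ)), ih]
    by_cases h : episodeStays m T
    · rw [if_pos h, episode_succ_of_stays m h, add_zero]
    · rw [if_neg h, episode_succ_of_not_stays m h]
      have := episode_fst_le m T
      rw [Nat.cast_sub (by omega)]
      ring

theorem numStarts_eq_sum (T : ℕ) :
    (numStarts m T : ℝ) = ∑ t ∈ Finset.Icc 1 T, if (episode m t).1 = t then (1 : ℝ) else 0 := by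
  simp [numStarts]

/-- A quantity that is constant on episodes, summed over time. -/
theorem sum_le_sum_start {J : ℕ → ℝ} (hJ0 : ∀ t, 0 ≤ J t)
    (hJ : ∀ t, 1 ≤ t → episodeStays m t → J (t + 1) = J t) (T : ℕ) :
    ∑ t ∈ Finset.Icc 1 T, J t ≤
      ∑ t ∈ Finset.Icc 1 T, if (episode m t).1 = t then ((episode m t).2 + 1) * J t else 0 := by
  -- At its start an episode is charged for its longest possible duration T_{k-1} + 1. The extra
  -- term is the part not yet consumed, which is nonnegative when the episode ends.
  suffices h : ∑ t ∈ Finset.Icc 1 T, J t + ((episode m T).1 + (episode m T).2 - T) * J T ≤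
      ∑ t ∈ Finset.Icc 1 T, if (episode m t).1 = t then ((episode m t).2 + 1) * J t else 0 by
    have h1 : (T : ℝ) ≤ (episode m T).1 + (episode m T).2 := by exact_mod_cast le_episode_add m T
    have h2 := mul_nonneg (sub_nonneg.2 h1) (hJ0 T)
    linarith
  induction T with
  | zero => simp [episode]
  | succ T ih =>
    rw [sum_start_mul (fun t => ((episode m t).2 + 1) * J t), sum_Icc_succ]
    by_cases h : episodeStays m T
    · have hT : 1 ≤ T := by
        rcases Nat.eq_zero_or_pos T with rfl | h'
        · exact absurd h (not_episodeStays_zero m)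
        · exact h'
      rw [if_pos h, episode_succ_of_stays m h, hJ T hT h]
      push_cast
      linarith
    · rw [if_neg h, episode_succ_of_not_stays m h]
      have h1 : (T : ℝ) ≤ (episode m T).1 + (episode m T).2 := by exact_mod_cast le_episode_add m T
      have h2 := mul_nonneg (sub_nonneg.2 h1) (hJ0 T)
      simp only
      push_cast
      linarith

/-- Telescoping inside each episode. -/
theorem sum_sub_le_numStarts {V V' : ℕ → ℝ} {H : ℝ} (hV : ∀ t, V t ≤ H) (hV' : ∀ t, 0 ≤ V' t)
    (hVV' : ∀ t, 1 ≤ t → episodeStays m t → V (t + 1) = V' t) (T : ℕ) :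
    ∑ t ∈ Finset.Icc 1 T, (V t - V' t) ≤ H * numStarts m T := by
  -- Keeping the last `V'` in the bound lets it cancel the next `V` while the episode continues; at
  -- a new start the fresh `V` is paid for by H.
  suffices h : ∀ T, 1 ≤ T → ∑ t ∈ Finset.Icc 1 T, (V t - V' t) ≤ H * numStarts m T - V' T by
    rcases Nat.eq_zero_or_pos T with rfl | hT
    · simp [numStarts]
    · linarith [h T hT, hV' T]
  intro T hT
  induction T, hT using Nat.le_induction with
  | base => simp [numStarts_one, hV 1]
  | succ T hT ih =>
    rw [sum_Icc_succ]
    by_cases h : episodeStays m T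
    · rw [numStarts_succ_of_stays m h, hVV' T hT h]
      linarith
    · rw [numStarts_succ_of_not_stays m h]
      push_cast
      linarith [hV (T + 1), hV' T]

theorem sum_inv_sqrt_le (T : ℕ) : ∑ t ∈ Finset.Icc 1 T, 1 / Real.sqrt t ≤ 2 * Real.sqrt T := by
  induction T with
  | zero => simp
  | succ T ih =>
    rw [sum_Icc_succ]
    have h1 : (0 : ℝ) < Real.sqrt ((T + 1 : ℕ) : ℝ) := Real.sqrt_pos.2 (by positivity)
    have h2 : Real.sqrt ((T + 1 : ℕ) : ℝ) ^ 2 = T + 1 := by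
      rw [Real.sq_sqrt (by positivity)]; push_cast; rfl
    have h3 : Real.sqrt T ^ 2 = (T : ℝ) := Real.sq_sqrt (by positivity)
    have h4 : 1 / Real.sqrt ((T + 1 : ℕ) : ℝ) ≤
        2 * Real.sqrt ((T + 1 : ℕ) : ℝ) - 2 * Real.sqrt T := by
      rw [div_le_iff₀ h1]
      nlinarith [sq_nonneg (Real.sqrt ((T + 1 : ℕ) : ℝ) - Real.sqrt T)]
    linarith

theorem sum_inv_sqrt_episode_le (T : ℕ) :
    ∑ t ∈ Finset.Icc 1 T, 1 / Real.sqrt (episode m t).1 ≤ 2 * Real.sqrt (2 * T) := by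
  calc _ ≤ ∑ t ∈ Finset.Icc 1 T, Real.sqrt 2 * (1 / Real.sqrt t) := by
        refine Finset.sum_le_sum fun t ht => ?_
        rw [Finset.mem_Icc] at ht
        have h1 := one_le_episode_fst m ht.1
        have h2 : t ≤ 2 * (episode m t).1 := by
          have := le_episode_add m t
          have := episode_snd_le m t
          omega
        have h3 : Real.sqrt t ≤ Real.sqrt 2 * Real.sqrt (episode m t).1 := by
          rw [← Real.sqrt_mul (by norm_num)]
          exact Real.sqrt_le_sqrt (by exact_mod_cast h2)
        have h4 : 0 < Real.sqrt t := Real.sqrt_pos.2 (by exact_mod_cast ht.1)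
        have h5 : 0 < Real.sqrt (episode m t).1 := Real.sqrt_pos.2 (by exact_mod_cast h1)
        rw [mul_one_div, div_le_div_iff₀ h5 h4]
        linarith
    _ = Real.sqrt 2 * ∑ t ∈ Finset.Icc 1 T, 1 / Real.sqrt t := by rw [Finset.mul_sum]
    _ ≤ Real.sqrt 2 * (2 * Real.sqrt T) :=
        mul_le_mul_of_nonneg_left (sum_inv_sqrt_le T) (Real.sqrt_nonneg _)
    _ = 2 * Real.sqrt (2 * T) := by rw [Real.sqrt_mul (by norm_num)]; ring

theorem count_le_two_mul_start {t : ℕ} (ht : 1 ≤ t) (s : S) (a : A) :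
    m t s a ≤ 2 * m (episode m t).1 s a := by
  obtain ⟨t, rfl⟩ := Nat.exists_eq_add_of_le' ht
  by_cases h : episodeStays m t
  · rw [episode_succ_of_stays m h]; exact h.2 s a
  · rw [episode_succ_of_not_stays m h]; simp only; omega

/-- The doubling criterion allows the count at the start of the episode to be exchanged for the
current one at the price of √2. -/
theorem inv_sqrt_count_start_le {t : ℕ} (ht : 1 ≤ t) (s : S) (a : A) :
    1 / Real.sqrt (max 1 (m (episode m t).1 s a : ℝ)) ≤
      Real.sqrt 2 * (1 / Real.sqrt (max 1 (m t s a : ℝ))) := by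
  have h1 : (m t s a : ℝ) ≤ 2 * m (episode m t).1 s a := by
    exact_mod_cast count_le_two_mul_start ht s a
  have h2 : max 1 (m t s a : ℝ) ≤ 2 * max 1 (m (episode m t).1 s a : ℝ) :=
    max_le (by linarith [le_max_left 1 (m (episode m t).1 s a : ℝ)])
      (by linarith [le_max_right 1 (m (episode m t).1 s a : ℝ)])
  have h3 : Real.sqrt (max 1 (m t s a : ℝ)) ≤
      Real.sqrt 2 * Real.sqrt (max 1 (m (episode m t).1 s a : ℝ)) := by
    rw [← Real.sqrt_mul (by norm_num)]
    exact Real.sqrt_le_sqrt h2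
  have h4 : 0 < Real.sqrt (max 1 (m t s a : ℝ)) := Real.sqrt_pos.2 (by positivity)
  have h5 : 0 < Real.sqrt (max 1 (m (episode m t).1 s a : ℝ)) := Real.sqrt_pos.2 (by positivity)
  rw [mul_one_div, div_le_div_iff₀ h5 h4]
  linarith

end EpisodeCount

/-! ### Sums of inverse square roots of visit counts -/

section VisitSum

variable {ι : Type*} [Fintype ι]

/-- A telescoping bound with the count before the visit. The usual factor 2 fails at n = 1, since
2(√2 - 1) < 1; the factor 3 works for all n. -/
theorem inv_sqrt_max_le (n : ℕ) :
    1 / Real.sqrt (max 1 (n : ℝ)) ≤ 3 * Real.sqrt (n + 1 : ℕ) - 3 * Real.sqrt n := by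
  rcases Nat.eq_zero_or_pos n with rfl | hn
  · simp
  have hn1 : (1 : ℝ) ≤ n := by exact_mod_cast hn
  rw [max_eq_right hn1]
  have h1 : 0 < Real.sqrt n := Real.sqrt_pos.2 (by linarith)
  have h2 : Real.sqrt n ^ 2 = n := Real.sq_sqrt (by linarith)
  have h3 : Real.sqrt (n + 1 : ℕ) ^ 2 = n + 1 := by rw [Real.sq_sqrt (by positivity)]; simp
  rw [div_le_iff₀ h1]
  have h4 : Real.sqrt n + 1 / (3 * Real.sqrt n) ≤ Real.sqrt (n + 1 : ℕ) := by
    apply Real.le_sqrt_of_sq_le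
    have h5 : (Real.sqrt n + 1 / (3 * Real.sqrt n)) ^ 2 = n + 2 / 3 + 1 / (9 * n) := by
      field_simp
      rw [h2]
      ring
    rw [h5]
    have h6 : 1 / (9 * (n : ℝ)) ≤ 1 / 3 := by
      apply one_div_le_one_div_of_le <;> linarith
    push_cast
    linarith
  have h7 : 1 / (3 * Real.sqrt n) * (3 * Real.sqrt n) = 1 := by field_simp
  nlinarith

/-- The number of visits to `i` of a sequence at the times `1, …, t - 1`. -/
noncomputable def visitCount (x : ℕ → ι) (t : ℕ) (i : ι) : ℕ :=
  open Classical in ((Finset.Ico 1 t).filter fun u => x u = i).card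

theorem visitCount_succ (x : ℕ → ι) {t : ℕ} (ht : 1 ≤ t) (i : ι) :
    visitCount x (t + 1) i = visitCount x t i + open Classical in if x t = i then 1 else 0 := by
  classical
  rw [visitCount, visitCount, ← Finset.insert_Ico_right_eq_Ico_add_one ht, Finset.filter_insert]
  split_ifs with h
  · rw [Finset.card_insert_of_notMem (by simp)]
  · simp

theorem sum_visitCount (x : ℕ → ι) (t : ℕ) : ∑ i, visitCount x t i = t - 1 := by
  classical
  have := Finset.card_eq_sum_card_fiberwise (f := x) (s := Finset.Ico 1 t) (t := Finset.univ)
    (fun _ _ => Finset.mem_coe.2 (Finset.mem_univ _))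
  rw [Nat.card_Ico] at this
  rw [this]
  exact Finset.sum_congr rfl fun i _ => by rw [visitCount]

/-- Each point telescopes to three times the root of its final count; Cauchy–Schwarz combines the
points, whose counts add up to T. -/
theorem sum_inv_sqrt_visitCount_le (x : ℕ → ι) (T : ℕ) :
    ∑ t ∈ Finset.Icc 1 T, 1 / Real.sqrt (max 1 (visitCount x t (x t) : ℝ)) ≤
      3 * Real.sqrt (Fintype.card ι * T) := by
  classical
  have h1 : ∀ T, ∑ t ∈ Finset.Icc 1 T, 1 / Real.sqrt (max 1 (visitCount x t (x t) : ℝ)) ≤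
      ∑ i, 3 * Real.sqrt (visitCount x (T + 1) i) := by
    intro T
    induction T with
    | zero => simp only [visitCount]; simp
    | succ T ih =>
      rw [sum_Icc_succ]
      have h2 : ∑ i, (3 * Real.sqrt (visitCount x (T + 1 + 1) i) -
          3 * Real.sqrt (visitCount x (T + 1) i)) =
          3 * Real.sqrt (visitCount x (T + 1) (x (T + 1)) + 1 : ℕ) -
            3 * Real.sqrt (visitCount x (T + 1) (x (T + 1))) := by
        rw [Finset.sum_eq_single (x (T + 1))]
        · rw [visitCount_succ x (by omega), if_pos rfl]
        · intro i _ hi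
          rw [visitCount_succ x (by omega), if_neg (Ne.symm hi)]
          simp
        · simp
      rw [Finset.sum_sub_distrib] at h2
      have h3 := inv_sqrt_max_le (visitCount x (T + 1) (x (T + 1)))
      linarith
  refine (h1 T).trans ?_
  rw [← Finset.mul_sum]
  refine mul_le_mul_of_nonneg_left ?_ (by norm_num)
  apply Real.le_sqrt_of_sq_le
  refine (sq_sum_le_card_mul_sum_sq).trans ?_
  rw [Finset.card_univ]
  refine mul_le_mul_of_nonneg_left ?_ (by positivity)
  simp_rw [Real.sq_sqrt (Nat.cast_nonneg _)]
  rw [← Nat.cast_sum, sum_visitCount]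
  simp

end VisitSum

/-! ### Perturbation of one-step predictions -/

namespace POMDP

variable {S A O : Type*} [Fintype S] [Fintype A] [Fintype O] (M : POMDP S A O)

theorem expCost_sub_le (b b' : Belief S) (a : A) :
    M.expCost b a - M.expCost b' a ≤ ∑ s, |b s - b' s| := by
  rw [expCost, expCost, ← Finset.sum_sub_distrib]
  refine Finset.sum_le_sum fun s _ => ?_
  rw [← mul_sub]
  refine (le_abs_self _).trans ?_
  rw [abs_mul, abs_of_nonneg (M.cost_nonneg s a)]
  exact mul_le_of_le_one_left (abs_nonneg _) (M.cost_le_one s a)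

/-- The difference is split as θ'(b - b') + (θ - θ')b. Keeping b with the kernel difference matters:
for the belief of θ_* that average is the conditional expectation of the distance at the actual
state. -/
theorem sum_abs_predict_sub_le (θ θ' : TransKernel S A) (b b' : Belief S) (a : A) :
    ∑ s', |predict θ b a s' - predict θ' b' a s'| ≤
      ∑ s, |b s - b' s| + ∑ s, b s * ∑ s', |θ s a s' - θ' s a s'| := by
  have h1 : ∀ s', |predict θ b a s' - predict θ' b' a s'| ≤
      ∑ s, (θ' s a s' * |b s - b' s| + b s * |θ s a s' - θ' s a s'|) := fun s' => by
    rw [predict_apply, predict_apply, ← Finset.sum_sub_distrib]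
    refine (Finset.abs_sum_le_sum_abs _ _).trans (Finset.sum_le_sum fun s _ => ?_)
    calc |θ s a s' * b s - θ' s a s' * b' s|
        = |θ' s a s' * (b s - b' s) + b s * (θ s a s' - θ' s a s')| := by congr 1; ring
      _ ≤ |θ' s a s' * (b s - b' s)| + |b s * (θ s a s' - θ' s a s')| := abs_add_le _ _
      _ = _ := by
        rw [abs_mul, abs_mul, abs_of_nonneg ((θ' s a).nonneg s'), abs_of_nonneg (b.nonneg s)]
  refine (Finset.sum_le_sum fun s' _ => h1 s').trans ?_
  rw [Finset.sum_comm, ← Finset.sum_add_distrib]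
  refine Finset.sum_le_sum fun s _ => ?_
  rw [Finset.sum_add_distrib, ← Finset.sum_mul, Belief.sum_eq_one, one_mul, Finset.mul_sum]

theorem sum_abs_obsWeight_sub_le (b b' : Belief S) :
    ∑ o, |M.obsWeight b o - M.obsWeight b' o| ≤ ∑ s, |b s - b' s| := by
  have h1 : ∀ o, |M.obsWeight b o - M.obsWeight b' o| ≤
      ∑ s, M.obsKernel s o * |b s - b' s| := fun o => by
    rw [obsWeight, obsWeight, ← Finset.sum_sub_distrib]
    refine (Finset.abs_sum_le_sum_abs _ _).trans (Finset.sum_le_sum fun s _ => ?_)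
    rw [← mul_sub, abs_mul, abs_of_nonneg (Belief.nonneg (M.obsKernel s) o)]
  refine (Finset.sum_le_sum fun o _ => h1 o).trans ?_
  rw [Finset.sum_comm]
  refine Finset.sum_le_sum fun s _ => ?_
  rw [← Finset.sum_mul, Belief.sum_eq_one, one_mul]

theorem sum_obsProb_mul_sub_le (θ θ' : TransKernel S A) (b b' : Belief S) (a : A) {f : O → ℝ} {H : ℝ}
    (hf0 : ∀ o, 0 ≤ f o) (hf : ∀ o, f o ≤ H) :
    ∑ o, M.obsProb θ b a o * f o - ∑ o, M.obsProb θ' b' a o * f o ≤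
      H * (∑ s, |b s - b' s| + ∑ s, b s * ∑ s', |θ s a s' - θ' s a s'|) := by
  rw [← Finset.sum_sub_distrib]
  calc ∑ o, (M.obsProb θ b a o * f o - M.obsProb θ' b' a o * f o)
      ≤ ∑ o, |M.obsProb θ b a o - M.obsProb θ' b' a o| * H := by
        refine Finset.sum_le_sum fun o _ => ?_
        rw [← sub_mul]
        calc _ ≤ |M.obsProb θ b a o - M.obsProb θ' b' a o| * f o :=
              mul_le_mul_of_nonneg_right (le_abs_self _) (hf0 o)
          _ ≤ _ := mul_le_mul_of_nonneg_left (hf o) (abs_nonneg _)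
    _ = H * ∑ o, |M.obsProb θ b a o - M.obsProb θ' b' a o| := by
        rw [← Finset.sum_mul, mul_comm]
    _ ≤ _ := by
        -- The sign of H is read off from the bounds on f at some observation; with none,
        -- probabilities could not sum to one.
        rcases isEmpty_or_nonempty O with hO | ⟨⟨o⟩⟩
        · have := M.sum_obsProb θ b a
          simp at this
        refine mul_le_mul_of_nonneg_left ?_ ((hf0 o).trans (hf o))
        simp_rw [obsProb_eq]
        exact (M.sum_abs_obsWeight_sub_le _ _).trans (sum_abs_predict_sub_le _ _ _ _ _)

end POMDP

/-! ### Bounded and measurable versions of values and optimal costs -/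

namespace Setup

variable {S A O : Type*} [Fintype S] [Fintype A] [Fintype O] (L : Setup S A O) (H : ℝ)

/-- The parameters at which the Bellman equation holds and the policy is optimal. -/
def Good (θ : TransKernel S A) : Prop :=
  L.toPOMDP.IsRelValue H θ (L.value θ) ∧ ∀ b a,
    L.toPOMDP.bellmanRHS θ (L.value θ) b (L.policy θ b) ≤ L.toPOMDP.bellmanRHS θ (L.value θ) b a

/-- The value function, clamped to `[0, H]`. -/
noncomputable def boundedValue (θ : TransKernel S A) (b : Belief S) : ℝ :=
  max 0 (min H (L.value θ b))

/-- The constant of the Bellman equation, computed at the belief `b₀` and clamped to `[0, 1]`. -/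
noncomputable def bellmanConst (b₀ : Belief S) (θ : TransKernel S A) : ℝ :=
  max 0 (min 1 (L.toPOMDP.bellmanRHS θ (L.value θ) b₀ (L.policy θ b₀) - L.value θ b₀))

variable {H} {L}

theorem boundedValue_nonneg (θ : TransKernel S A) (b : Belief S) : 0 ≤ L.boundedValue H θ b :=
  le_max_left _ _

theorem boundedValue_le (hH : 0 ≤ H) (θ : TransKernel S A) (b : Belief S) :
    L.boundedValue H θ b ≤ H := max_le hH (min_le_left _ _)

theorem bellmanConst_nonneg (b₀ : Belief S) (θ : TransKernel S A) : 0 ≤ L.bellmanConst b₀ θ :=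
  le_max_left _ _

theorem bellmanConst_le_one (b₀ : Belief S) (θ : TransKernel S A) : L.bellmanConst b₀ θ ≤ 1 :=
  max_le zero_le_one (min_le_left _ _)

theorem Good.boundedValue_eq {θ : TransKernel S A} (h : L.Good H θ) (b : Belief S) :
    L.boundedValue H θ b = L.value θ b := by
  rw [boundedValue, min_eq_right (h.1.le b), max_eq_right (h.1.nonneg b)]

/-- The optimal cost is an infimum over uncountably many policies, so its measurability in θ is not
evident. Where the Bellman equation holds it agrees with this measurable expression, whatever the
reference belief `b₀`. -/
theorem Good.bellmanConst_eq [Nonempty A] {θ : TransKernel S A} (h : L.Good H θ) (b₀ b : Belief S) :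
    L.bellmanConst b₀ θ = L.toPOMDP.optCost θ b := by
  rw [bellmanConst, h.1.bellmanRHS_eq (h.2 b₀) b, add_sub_cancel_right,
    min_eq_right (L.toPOMDP.optCost_le_one θ b), max_eq_right (L.toPOMDP.optCost_nonneg θ b)]

theorem Good.bellman [Nonempty A] {θ : TransKernel S A} (h : L.Good H θ) (b₀ b : Belief S) :
    L.toPOMDP.expCost b (L.policy θ b) + ∑ o, L.toPOMDP.obsProb θ b (L.policy θ b) o *
      L.boundedValue H θ (L.toPOMDP.tau θ b (L.policy θ b) o) =
        L.bellmanConst b₀ θ + L.boundedValue H θ b := by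
  simp_rw [h.boundedValue_eq, h.bellmanConst_eq b₀ b]
  exact h.1.bellmanRHS_eq (h.2 b) b

variable [MeasurableSpace A] [DiscreteMeasurableSpace A] (hL : L.IsAdmissible H)
include hL

theorem IsAdmissible.ae_good : ∀ᵐ θ ∂L.prior, L.Good H θ := by
  filter_upwards [hL.bellman, hL.argmin] with θ h1 h2 using ⟨h1, h2⟩

theorem IsAdmissible.nonneg [Nonempty S] : 0 ≤ H := by
  classical
  have := hL.prob
  obtain ⟨θ, hθ⟩ := hL.ae_good.exists
  let b : Belief S := ⟨Pi.single (Classical.arbitrary S) 1, single_mem_stdSimplex ℝ _⟩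
  exact (hθ.1.nonneg b).trans (hθ.1.le b)

theorem IsAdmissible.measurable_boundedValue {Ω : Type*} {m : MeasurableSpace Ω}
    {θ : Ω → TransKernel S A} {b : Ω → Belief S} (hθ : Measurable θ) (hb : Measurable b) :
    Measurable fun ω => L.boundedValue H (θ ω) (b ω) :=
  measurable_const.max (measurable_const.min (hL.value_meas.comp (hθ.prodMk hb)))

theorem IsAdmissible.measurable_bellmanConst (b₀ : Belief S) : Measurable (L.bellmanConst b₀) := by
  have hv : ∀ {b : TransKernel S A → Belief S}, Measurable b → Measurable fun θ => L.value θ (b θ) :=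
    fun hb => hL.value_meas.comp (measurable_id.prodMk hb)
  have hp : Measurable fun θ => L.policy θ b₀ :=
    hL.policy_meas.comp (measurable_id.prodMk measurable_const)
  refine measurable_const.max (measurable_const.min (Measurable.sub ?_ (hv measurable_const)))
  refine measurable_comp_of_countable
    (f := fun a θ => L.toPOMDP.bellmanRHS θ (L.value θ) b₀ a) (fun a => ?_) hp
  exact (L.toPOMDP.measurable_expCost measurable_const a).add <|
    Finset.measurable_fun_sum _ fun o _ =>
      (L.toPOMDP.measurable_obsProb measurable_id measurable_const a o).mul
        (hv (L.toPOMDP.measurable_tau measurable_id measurable_const a o))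

end Setup

/-! ### Transfer between sampled and true parameter; averaging over state and observation -/

namespace Trajectory

variable {S A O : Type*} [Fintype S] [Fintype A] [Fintype O]
  [MeasurableSpace S] [DiscreteMeasurableSpace S] [mA : MeasurableSpace A]
  [DiscreteMeasurableSpace A] [mO : MeasurableSpace O] [DiscreteMeasurableSpace O]
  {Ω : Type*} {m₀ mΩ : MeasurableSpace Ω} {P : Measure Ω} {L : Setup S A O}
  {X : Trajectory S A O Ω} {H : ℝ} [IsProbabilityMeasure P]

namespace IsPSRLRun

variable (hX : X.IsPSRLRun P L) (hL : L.IsAdmissible H)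
include hX hL

theorem setIntegral_sample_eq {t : ℕ} (ht : 1 ≤ t) {β : Type*} [MeasurableSpace β] {Z : Ω → β}
    (hZ : Measurable[X.hist t] Z) {g : β × TransKernel S A → ℝ} (hg : Measurable g) :
    ∫ ω in X.startSet P t, g (Z ω, X.sample t ω) ∂P =
      ∫ ω in X.startSet P t, g (Z ω, X.param ω) ∂P := by
  have hZ' : Measurable Z := hZ.mono (hX.hist_le _) le_rfl
  rw [← integral_map (φ := fun ω => (Z ω, X.sample t ω)) (f := g)
      (hZ'.prodMk (hX.sample_meas t)).aemeasurable hg.aestronglyMeasurable,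
    hX.map_sample_eq_map_param hL ht hZ,
    integral_map (hZ'.prodMk hX.param_meas).aemeasurable hg.aestronglyMeasurable]

theorem measure_sample_eq {t : ℕ} (ht : 1 ≤ t) {β : Type*} [MeasurableSpace β] {Z : Ω → β}
    (hZ : Measurable[X.hist t] Z) {C : Set (β × TransKernel S A)} (hC : MeasurableSet C) :
    P (X.startSet P t ∩ {ω | (Z ω, X.sample t ω) ∈ C}) =
      P (X.startSet P t ∩ {ω | (Z ω, X.param ω) ∈ C}) := by
  have hZ' : Measurable Z := hZ.mono (hX.hist_le _) le_rfl
  have h1 := DFunLike.congr_fun (hX.map_sample_eq_map_param hL ht hZ) C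
  rw [Measure.map_apply (hZ'.prodMk (hX.sample_meas t)) hC,
    Measure.map_apply (hZ'.prodMk hX.param_meas) hC,
    Measure.restrict_apply ((hZ'.prodMk (hX.sample_meas t)) hC),
    Measure.restrict_apply ((hZ'.prodMk hX.param_meas) hC)] at h1
  rw [Set.inter_comm, Set.inter_comm (X.startSet P t)]
  exact h1

theorem ae_param_good : ∀ᵐ ω ∂P, L.Good H (X.param ω) := by
  have h := hL.ae_good
  rw [← hX.param_law] at h
  exact ae_of_ae_map hX.param_meas.aemeasurable h

/-- The prior is carried by good parameters; at episode starts the equality of laws transfers this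
to the sample, which is then kept. -/
theorem ae_sample_good (t : ℕ) (ht : 1 ≤ t) : ∀ᵐ ω ∂P, L.Good H (X.sample t ω) := by
  -- The set of good parameters is not known to be measurable, so a measurable null set containing
  -- the bad ones is transferred.
  obtain ⟨N, hN, hNm, hN0⟩ := exists_measurable_superset_of_null (ae_iff.1 hL.ae_good)
  have hstart : ∀ t, 1 ≤ t → ∀ᵐ ω ∂P, ω ∈ X.startSet P t → X.sample t ω ∉ N := fun t ht => by
    have h1 := hX.measure_sample_eq hL ht (Z := fun _ => ()) measurable_const
      (C := Prod.snd ⁻¹' N) (measurable_snd hNm)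
    have h2 : P (X.startSet P t ∩ {ω | ((), X.param ω) ∈ Prod.snd ⁻¹' N}) = 0 := by
      refine measure_mono_null Set.inter_subset_right ?_
      rw [← hX.param_law, Measure.map_apply hX.param_meas hNm] at hN0
      exact hN0
    rw [h2] at h1
    rw [ae_iff]
    refine measure_mono_null (fun ω hω => ?_) h1
    simp only [not_forall, not_not] at hω
    obtain ⟨hs, hn⟩ := hω
    exact ⟨hs, hn⟩
  suffices h : ∀ᵐ ω ∂P, X.sample t ω ∉ N by
    filter_upwards [h] with ω hω
    by_contra h'
    exact hω (hN h')
  induction t, ht using Nat.le_induction with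
  | base =>
    filter_upwards [hstart 1 le_rfl] with ω hω
    exact hω (by rw [startSet_one]; trivial)
  | succ t ht ih =>
    filter_upwards [ih, hstart (t + 1) (by omega), hX.sample_keep t ht] with ω h1 h2 h3
    by_cases hs : ω ∈ X.startSet P (t + 1)
    · exact h2 hs
    · rw [h3 hs]; exact h1

/-- Averaging over the state at time `t + 1`. -/
theorem integral_state {t : ℕ} {f : S → Ω → ℝ} {c : ℝ}
    (hf : ∀ s, Measurable[X.info X.paramInfo (t + 1)] (f s)) (hc : ∀ s ω, |f s ω| ≤ c) :
    ∫ ω, f (X.state (t + 1) ω) ω ∂P =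
      ∫ ω, ∑ s, X.beliefAt L (t + 1) (X.param ω) ω s * f s ω ∂P := by
  have h1 := CondEq.sum (s := Finset.univ) fun s _ =>
    (hX.condEq_state hL t s).mul_right (hX.info_le le_rfl (t + 1)) (hf s) (hc s)
  rw [← h1.integral_eq (hX.info_le le_rfl (t + 1))]
  exact integral_congr_ae (ae_of_all _ fun ω => apply_eq_sum_indicator _ _ _)

/-- Averaging over the observation at time `t + 2`. -/
theorem integral_obs {t : ℕ} {f : O → Ω → ℝ} {c : ℝ}
    (hf : ∀ o, Measurable[X.info X.paramInfo (t + 1)] (f o)) (hc : ∀ o ω, |f o ω| ≤ c) :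
    ∫ ω, f (X.obs (t + 2) ω) ω ∂P = ∫ ω, ∑ o, L.toPOMDP.obsProb (X.param ω)
      (X.beliefAt L (t + 1) (X.param ω) ω) (X.act (t + 1) ω) o * f o ω ∂P := by
  have h1 := CondEq.sum (s := Finset.univ) fun o _ =>
    (hX.condEq_obs (hX.condEq_state_pred hL (t + 1)) o).mul_right (hX.info_le le_rfl (t + 1))
      (hf o) (hc o)
  simp_rw [POMDP.obsProb_eq]
  refine Eq.trans ?_ (h1.integral_eq (hX.info_le le_rfl (t + 1)))
  exact integral_congr_ae (ae_of_all _ fun ω => apply_eq_sum_indicator _ _ _)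

end IsPSRLRun

end Trajectory

/-! ### The one-step regret decomposition -/

namespace Trajectory

variable {S A O : Type*} [Fintype S] [Fintype A] [Fintype O]
  [MeasurableSpace S] [DiscreteMeasurableSpace S] [mA : MeasurableSpace A]
  [DiscreteMeasurableSpace A] [mO : MeasurableSpace O] [DiscreteMeasurableSpace O]
  {Ω : Type*} {m₀ mΩ : MeasurableSpace Ω} {P : Measure Ω} {L : Setup S A O}
  {X : Trajectory S A O Ω} {H : ℝ}

/-- The distance between the beliefs of the true and of the sampled parameter. -/
noncomputable def beliefErr (X : Trajectory S A O Ω) (L : Setup S A O) (t : ℕ) (ω : Ω) : ℝ :=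
  ∑ s, |X.beliefAt L t (X.param ω) ω s - X.beliefAt L t (X.sample t ω) ω s|

/-- The distance between the true and the sampled transition law at the current state and action. -/
noncomputable def kernelErr (X : Trajectory S A O Ω) (t : ℕ) (ω : Ω) : ℝ :=
  ∑ s', |X.param ω (X.state t ω) (X.act t ω) s' - X.sample t ω (X.state t ω) (X.act t ω) s'|

/-- The value of the current belief, for the sampled parameter. -/
noncomputable def valNow (X : Trajectory S A O Ω) (L : Setup S A O) (H : ℝ) (t : ℕ) (ω : Ω) : ℝ :=
  L.boundedValue H (X.sample t ω) (X.beliefAt L t (X.sample t ω) ω)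

/-- The value of the next belief, for the parameter sampled for the current time. -/
noncomputable def valNext (X : Trajectory S A O Ω) (L : Setup S A O) (H : ℝ) (t : ℕ) (ω : Ω) : ℝ :=
  L.boundedValue H (X.sample t ω) (X.beliefAt L (t + 1) (X.sample t ω) ω)

theorem beliefErr_nonneg (t : ℕ) (ω : Ω) : 0 ≤ X.beliefErr L t ω :=
  Finset.sum_nonneg fun _ _ => abs_nonneg _

theorem beliefErr_le (t : ℕ) (ω : Ω) : X.beliefErr L t ω ≤ 2 := Belief.sum_abs_sub_le _ _

theorem kernelErr_nonneg (t : ℕ) (ω : Ω) : 0 ≤ X.kernelErr t ω :=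
  Finset.sum_nonneg fun _ _ => abs_nonneg _

theorem kernelErr_le (t : ℕ) (ω : Ω) : X.kernelErr t ω ≤ 2 := Belief.sum_abs_sub_le _ _

theorem measurable_sum_abs_sub {m : MeasurableSpace Ω} {b b' : Ω → Belief S} (hb : Measurable b)
    (hb' : Measurable b') : Measurable fun ω => ∑ s, |b ω s - b' ω s| :=
  Finset.measurable_fun_sum _ fun s _ =>
    measurable_abs.comp ((hb.belief_apply s).sub (hb'.belief_apply s))

theorem integral_le_integral_combination {f f₁ f₂ f₃ f₄ f₅ : Ω → ℝ} {c c' : ℝ} (hf : Integrable f P)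
    (h₁ : Integrable f₁ P) (h₂ : Integrable f₂ P) (h₃ : Integrable f₃ P) (h₄ : Integrable f₄ P)
    (h₅ : Integrable f₅ P)
    (h : ∀ᵐ ω ∂P, f ω ≤ f₁ ω + (f₂ ω - f₃ ω) + c * f₄ ω + c' * f₅ ω) :
    ∫ ω, f ω ∂P ≤ ∫ ω, f₁ ω ∂P + (∫ ω, f₂ ω ∂P - ∫ ω, f₃ ω ∂P) + c * ∫ ω, f₄ ω ∂P +
      c' * ∫ ω, f₅ ω ∂P := by
  have i₁ : Integrable (fun ω => f₂ ω - f₃ ω) P := h₂.sub h₃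
  have i₂ : Integrable (fun ω => f₁ ω + (f₂ ω - f₃ ω)) P := h₁.add i₁
  have i₃ : Integrable (fun ω => c * f₄ ω) P := h₄.const_mul c
  have i₄ : Integrable (fun ω => f₁ ω + (f₂ ω - f₃ ω) + c * f₄ ω) P := i₂.add i₃
  have i₅ : Integrable (fun ω => c' * f₅ ω) P := h₅.const_mul c'
  refine (integral_mono_ae hf (i₄.add i₅) h).trans_eq ?_
  rw [integral_add' i₄ i₅, integral_add i₂ i₃, integral_add h₁ i₁, integral_sub h₂ h₃,
    integral_const_mul, integral_const_mul]

variable [IsProbabilityMeasure P]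

theorem measurable_beliefErr_info (hinit : Measurable L.init) (t : ℕ) :
    Measurable[X.info X.paramInfo (t + 1)] (X.beliefErr L (t + 1)) :=
  measurable_sum_abs_sub (measurable_beliefAt_info hinit (measurable_param_info (t + 1)))
    (measurable_beliefAt_info hinit (measurable_sample_info (by omega) le_rfl))

theorem measurable_kernelErr_at (t : ℕ) (s : S) : Measurable[X.info X.paramInfo (t + 1)] fun ω =>
    ∑ s', |X.param ω s (X.act (t + 1) ω) s' - X.sample (t + 1) ω s (X.act (t + 1) ω) s'| :=
  measurable_comp_of_countable (m := X.info X.paramInfo (t + 1))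
    (f := fun a ω => ∑ s', |X.param ω s a s' - X.sample (t + 1) ω s a s'|)
    (fun a => measurable_sum_abs_sub ((measurable_param_info (t + 1)).kernel_apply s a)
      ((measurable_sample_info (m₀ := X.paramInfo) (by omega) le_rfl).kernel_apply s a))
    (measurable_act_info (by omega) le_rfl)

namespace IsPSRLRun

variable (hX : X.IsPSRLRun P L) (hL : L.IsAdmissible H)
include hX

theorem measurable_kernelErr (t : ℕ) : Measurable (X.kernelErr (t + 1)) :=
  measurable_comp_of_countable
    (f := fun s ω => ∑ s', |X.param ω s (X.act (t + 1) ω) s' -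
      X.sample (t + 1) ω s (X.act (t + 1) ω) s'|)
    (fun s => (measurable_kernelErr_at t s).mono (hX.info_le le_rfl (t + 1)) le_rfl)
    (hX.state_meas (t + 1))

theorem integrable_kernelErr (t : ℕ) : Integrable (X.kernelErr (t + 1)) P :=
  integrable_of_abs_le (hX.measurable_kernelErr t) fun ω => by
    rw [abs_of_nonneg (kernelErr_nonneg _ _)]; exact kernelErr_le _ _

theorem integrable_cost (t : ℕ) :
    Integrable (fun ω => L.cost (X.state t ω) (X.act t ω)) P :=
  integrable_of_abs_le (c := 1) ((measurable_of_countable fun x : S × A => L.cost x.1 x.2).comp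
    ((hX.state_meas t).prodMk (hX.act_meas t))) fun ω => by
      rw [abs_of_nonneg (L.cost_nonneg _ _)]; exact L.cost_le_one _ _

include hL

theorem integrable_beliefErr (t : ℕ) : Integrable (X.beliefErr L (t + 1)) P :=
  integrable_of_abs_le ((measurable_beliefErr_info hL.init_meas t).mono
    (hX.info_le le_rfl (t + 1)) le_rfl) fun ω => by
      rw [abs_of_nonneg (beliefErr_nonneg _ _)]; exact beliefErr_le _ _

theorem integrable_bellmanConst (b₀ : Belief S) {θ : Ω → TransKernel S A} (hθ : Measurable θ) :
    Integrable (fun ω => L.bellmanConst b₀ (θ ω)) P :=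
  integrable_of_abs_le (c := 1) ((hL.measurable_bellmanConst b₀).comp hθ) fun ω => by
    rw [abs_of_nonneg (Setup.bellmanConst_nonneg _ _)]; exact Setup.bellmanConst_le_one _ _

theorem integrable_boundedValue (hH : 0 ≤ H) (t u : ℕ) :
    Integrable (fun ω => L.boundedValue H (X.sample t ω) (X.beliefAt L u (X.sample t ω) ω)) P :=
  integrable_of_abs_le (c := H) (hL.measurable_boundedValue (hX.sample_meas t)
    (L.measurable_belief hL.init_meas (hX.sample_meas t) u (fun i _ _ => hX.act_meas i)
      fun i _ _ => hX.obs_meas i)) fun ω => by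
    rw [abs_of_nonneg (Setup.boundedValue_nonneg _ _)]; exact Setup.boundedValue_le hH _ _

theorem integral_cost (t : ℕ) :
    ∫ ω, L.cost (X.state (t + 1) ω) (X.act (t + 1) ω) ∂P =
      ∫ ω, L.toPOMDP.expCost (X.beliefAt L (t + 1) (X.param ω) ω) (X.act (t + 1) ω) ∂P := by
  rw [hX.integral_state hL (f := fun s ω => L.cost s (X.act (t + 1) ω)) (c := 1)]
  · simp_rw [POMDP.expCost, mul_comm]
  · exact fun s => (measurable_of_countable fun a => L.cost s a).comp
      (measurable_act_info (by omega) le_rfl)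
  · intro s ω
    rw [abs_of_nonneg (L.cost_nonneg _ _)]; exact L.cost_le_one _ _

theorem integral_kernelErr (t : ℕ) :
    ∫ ω, X.kernelErr (t + 1) ω ∂P = ∫ ω, ∑ s, X.beliefAt L (t + 1) (X.param ω) ω s *
      ∑ s', |X.param ω s (X.act (t + 1) ω) s' - X.sample (t + 1) ω s (X.act (t + 1) ω) s'| ∂P :=
  hX.integral_state hL (f := fun s ω => ∑ s', |X.param ω s (X.act (t + 1) ω) s' -
      X.sample (t + 1) ω s (X.act (t + 1) ω) s'|) (c := 2) (measurable_kernelErr_at t)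
    fun s ω => by
      rw [abs_of_nonneg (Finset.sum_nonneg fun _ _ => abs_nonneg _)]
      exact Belief.sum_abs_sub_le _ _

theorem measurable_valNext_at (t : ℕ) (o : O) : Measurable[X.info X.paramInfo (t + 1)] fun ω =>
    L.boundedValue H (X.sample (t + 1) ω) (L.toPOMDP.tau (X.sample (t + 1) ω)
      (X.beliefAt L (t + 1) (X.sample (t + 1) ω) ω) (X.act (t + 1) ω) o) := by
  have hs : Measurable[X.info X.paramInfo (t + 1)] (X.sample (t + 1)) :=
    measurable_sample_info (by omega) le_rfl
  exact hL.measurable_boundedValue hs <| measurable_comp_of_countable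
    (m := X.info X.paramInfo (t + 1)) (f := fun a ω => L.toPOMDP.tau (X.sample (t + 1) ω)
      (X.beliefAt L (t + 1) (X.sample (t + 1) ω) ω) a o)
    (fun a => L.toPOMDP.measurable_tau hs (measurable_beliefAt_info hL.init_meas hs) a o)
    (measurable_act_info (by omega) le_rfl)

theorem integral_valNext (hH : 0 ≤ H) (t : ℕ) :
    ∫ ω, X.valNext L H (t + 1) ω ∂P = ∫ ω, ∑ o, L.toPOMDP.obsProb (X.param ω)
      (X.beliefAt L (t + 1) (X.param ω) ω) (X.act (t + 1) ω) o *
        L.boundedValue H (X.sample (t + 1) ω) (L.toPOMDP.tau (X.sample (t + 1) ω)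
          (X.beliefAt L (t + 1) (X.sample (t + 1) ω) ω) (X.act (t + 1) ω) o) ∂P :=
  hX.integral_obs hL (f := fun o ω => L.boundedValue H (X.sample (t + 1) ω)
    (L.toPOMDP.tau (X.sample (t + 1) ω)
      (X.beliefAt L (t + 1) (X.sample (t + 1) ω) ω) (X.act (t + 1) ω) o)) (c := H)
    (hX.measurable_valNext_at hL t) fun o ω => by
      rw [abs_of_nonneg (Setup.boundedValue_nonneg _ _)]; exact Setup.boundedValue_le hH _ _

/-- The expected cost at one time, in terms of the Bellman equation of the sampled parameter. -/
theorem integral_cost_le (hH : 0 ≤ H) (b₀ : Belief S) (t : ℕ) :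
    ∫ ω, L.cost (X.state (t + 1) ω) (X.act (t + 1) ω) ∂P ≤
      ∫ ω, L.bellmanConst b₀ (X.sample (t + 1) ω) ∂P +
      (∫ ω, X.valNow L H (t + 1) ω ∂P - ∫ ω, X.valNext L H (t + 1) ω ∂P) +
      (1 + H) * ∫ ω, X.beliefErr L (t + 1) ω ∂P + H * ∫ ω, X.kernelErr (t + 1) ω ∂P := by
  rw [hX.integral_cost hL, hX.integral_valNext hL hH, hX.integral_kernelErr hL]
  obtain ⟨ω₀⟩ := P.nonempty_of_neZero
  have : Nonempty A := ⟨X.act 0 ω₀⟩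
  have hinfo := hX.info_le le_rfl (t + 1)
  have hbm := measurable_beliefAt_info (L := L) hL.init_meas (measurable_param_info (X := X) (t + 1))
  have ha : Measurable[X.info X.paramInfo (t + 1)] (X.act (t + 1)) :=
    measurable_act_info (by omega) le_rfl
  have i1 : Integrable (fun ω => L.toPOMDP.expCost (X.beliefAt L (t + 1) (X.param ω) ω)
      (X.act (t + 1) ω)) P :=
    integrable_of_abs_le (c := 1) ((measurable_comp_of_countable (m := X.info X.paramInfo (t + 1))
      (f := fun a ω => L.toPOMDP.expCost (X.beliefAt L (t + 1) (X.param ω) ω) a)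
      (fun a => L.toPOMDP.measurable_expCost hbm a) ha).mono hinfo le_rfl) fun ω => by
        rw [abs_of_nonneg (L.toPOMDP.expCost_nonneg _ _)]; exact L.toPOMDP.expCost_le_one _ _
  have i2 := hX.integrable_bellmanConst hL b₀ (hX.sample_meas (t + 1))
  have i3 : Integrable (X.valNow L H (t + 1)) P := hX.integrable_boundedValue hL hH (t + 1) (t + 1)
  have i4 : Integrable (fun ω => ∑ o, L.toPOMDP.obsProb (X.param ω)
      (X.beliefAt L (t + 1) (X.param ω) ω) (X.act (t + 1) ω) o *
        L.boundedValue H (X.sample (t + 1) ω) (L.toPOMDP.tau (X.sample (t + 1) ω)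
          (X.beliefAt L (t + 1) (X.sample (t + 1) ω) ω) (X.act (t + 1) ω) o)) P := by
    refine integrable_finsetSum _ fun o _ => integrable_of_abs_le (c := 1 * H) ?_ fun ω => ?_
    · refine Measurable.mono (Measurable.mul ?_ (hX.measurable_valNext_at hL t o)) hinfo le_rfl
      exact measurable_comp_of_countable (m := X.info X.paramInfo (t + 1))
        (f := fun a ω => L.toPOMDP.obsProb (X.param ω) (X.beliefAt L (t + 1) (X.param ω) ω) a o)
        (fun a => L.toPOMDP.measurable_obsProb (measurable_param_info (t + 1)) hbm a o) ha
    · rw [abs_mul, abs_of_nonneg (L.toPOMDP.obsProb_nonneg _ _ _ _),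
        abs_of_nonneg (Setup.boundedValue_nonneg _ _)]
      exact mul_le_mul (L.toPOMDP.obsProb_le_one _ _ _ _) (Setup.boundedValue_le hH _ _)
        (Setup.boundedValue_nonneg _ _) zero_le_one
  have i5 := hX.integrable_beliefErr hL t
  have i6 : Integrable (fun ω => ∑ s, X.beliefAt L (t + 1) (X.param ω) ω s *
      ∑ s', |X.param ω s (X.act (t + 1) ω) s' - X.sample (t + 1) ω s (X.act (t + 1) ω) s'|) P := by
    refine integrable_finsetSum _ fun s _ => integrable_of_abs_le (c := 1 * 2) ?_ fun ω => ?_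
    · exact Measurable.mono (Measurable.mul (hbm.belief_apply s) (measurable_kernelErr_at t s))
        hinfo le_rfl
    · rw [abs_mul, abs_of_nonneg (Belief.nonneg _ _),
        abs_of_nonneg (Finset.sum_nonneg fun _ _ => abs_nonneg _)]
      exact mul_le_mul (Belief.le_one _ _) (Belief.sum_abs_sub_le _ _)
        (Finset.sum_nonneg fun _ _ => abs_nonneg _) zero_le_one
  refine integral_le_integral_combination i1 i2 i3 i4 i5 i6 ?_
  filter_upwards [hX.ae_sample_good hL (t + 1) (by omega), hX.act_eq (t + 1) (by omega)]
    with ω hg hact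
  -- The agent's action minimises the right-hand side for the sampled parameter at its own belief,
  -- so the Bellman equation holds there with equality.
  have h1 := hg.bellman b₀ (X.beliefAt L (t + 1) (X.sample (t + 1) ω) ω)
  rw [← hact] at h1
  have h2 := L.toPOMDP.expCost_sub_le (X.beliefAt L (t + 1) (X.param ω) ω)
    (X.beliefAt L (t + 1) (X.sample (t + 1) ω) ω) (X.act (t + 1) ω)
  -- Both predictions average the same function of the observation, the value of the sampled
  -- parameter at its own updated belief; only the laws of the observation differ.
  have h3 := L.toPOMDP.sum_obsProb_mul_sub_le (X.param ω) (X.sample (t + 1) ω)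
    (X.beliefAt L (t + 1) (X.param ω) ω) (X.beliefAt L (t + 1) (X.sample (t + 1) ω) ω)
    (X.act (t + 1) ω) (f := fun o => L.boundedValue H (X.sample (t + 1) ω)
      (L.toPOMDP.tau (X.sample (t + 1) ω)
        (X.beliefAt L (t + 1) (X.sample (t + 1) ω) ω) (X.act (t + 1) ω) o)) (H := H)
    (fun o => Setup.boundedValue_nonneg _ _) fun o => Setup.boundedValue_le hH _ _
  simp only [valNow, beliefErr]
  linarith

end IsPSRLRun

end Trajectory

/-! ### Two probability estimates -/

section ProbabilityBounds

variable {Ω : Type*} {m mΩ : MeasurableSpace Ω} {P : Measure Ω} [IsProbabilityMeasure P]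

theorem probReal_compl_le {E : Set Ω} (hE : MeasurableSet E) {δ : ℝ} (h : 1 - δ ≤ P.real E) :
    P.real Eᶜ ≤ δ := by
  rw [probReal_compl_eq_one_sub hE]
  linarith

theorem integral_le_of_prob_le {Z U : Ω → ℝ} {c δ : ℝ} (hZm : Measurable Z) (hUm : Measurable U)
    (hZ : Integrable Z P) (hU : Integrable U P) (hc : 0 ≤ c)
    (hZc : ∀ᵐ ω ∂P, Z ω ≤ c) (hU0 : ∀ᵐ ω ∂P, 0 ≤ U ω) (h : 1 - δ ≤ P.real {ω | Z ω ≤ U ω}) :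
    ∫ ω, Z ω ∂P ≤ ∫ ω, U ω ∂P + c * δ := by
  have hE : MeasurableSet {ω | Z ω ≤ U ω} := measurableSet_le hZm hUm
  have hI := integrable_indicator_one (P := P) hE.compl
  have hI' : Integrable (fun ω => c * {ω | Z ω ≤ U ω}ᶜ.indicator (fun _ => (1 : ℝ)) ω) P :=
    hI.const_mul c
  calc ∫ ω, Z ω ∂P
      ≤ ∫ ω, (U ω + c * {ω | Z ω ≤ U ω}ᶜ.indicator (fun _ => (1 : ℝ)) ω) ∂P := by
        refine integral_mono_ae hZ (hU.add hI') ?_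
        filter_upwards [hZc, hU0] with ω h1 h2
        by_cases hω : Z ω ≤ U ω
        · simp [hω]
        · simp only [Set.indicator_of_mem (show ω ∈ {ω | Z ω ≤ U ω}ᶜ from hω)]
          linarith
    _ = ∫ ω, U ω ∂P + c * P.real {ω | Z ω ≤ U ω}ᶜ := by
        rw [integral_add hU hI', integral_const_mul, integral_indicator_const _ hE.compl]
        simp
    _ ≤ _ := by
        have := mul_le_mul_of_nonneg_left (probReal_compl_le hE h) hc
        linarith

/-- Markov's inequality for a conditional expectation: a nonnegative random variable rarely exceeds
its conditional expectation by a large factor. -/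
theorem probReal_condExp_lt_le (hm : m ≤ mΩ) {Y : Ω → ℝ} (hY : Integrable Y P) (hYm : Measurable Y)
    (hY0 : ∀ ω, 0 ≤ Y ω) {α ε : ℝ} (hα : 0 ≤ α) (hε : 0 < ε) :
    P.real {ω | (P[Y | m]) ω + ε < α * Y ω} ≤ α := by
  have hcm : Measurable[m] (P[Y | m]) := stronglyMeasurable_condExp.measurable
  have hc0 : ∀ᵐ ω ∂P, 0 ≤ (P[Y | m]) ω := condExp_nonneg (ae_of_all _ hY0)
  -- This weight is `m`-measurable, bounded by 1/ε, and satisfies E[WY] = E[W E[Y|m]] ≤ 1; the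
  -- maximum with 0 makes it positive everywhere and not only almost surely. Markov's inequality is
  -- applied to WY.
  let W : Ω → ℝ := fun ω => (max 0 ((P[Y | m]) ω) + ε)⁻¹
  have hpos : ∀ ω, 0 < max 0 ((P[Y | m]) ω) + ε := fun ω => by positivity
  have hWm : Measurable[m] W := ((measurable_const.max hcm).add_const ε).inv
  have hWc : ∀ ω, |W ω| ≤ ε⁻¹ := fun ω => by
    rw [abs_of_nonneg (inv_nonneg.2 (hpos ω).le)]
    exact inv_anti₀ hε (by linarith [le_max_left 0 ((P[Y | m]) ω)])
  have h1 := (CondEq.condExp_self hm hY).mul_left hm hWm hWc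
  have h2 := h1.integral_eq hm
  have hE : MeasurableSet {ω | (P[Y | m]) ω + ε < α * Y ω} :=
    measurableSet_lt ((hcm.mono hm le_rfl).add_const ε) (hYm.const_mul α)
  calc P.real {ω | (P[Y | m]) ω + ε < α * Y ω}
      = ∫ ω, {ω | (P[Y | m]) ω + ε < α * Y ω}.indicator (fun _ => (1 : ℝ)) ω ∂P := by
        rw [integral_indicator_const _ hE]; simp
    _ ≤ ∫ ω, α * (W ω * Y ω) ∂P := by
        refine integral_mono_ae (integrable_indicator_one hE) (h1.int_left.const_mul α) ?_
        filter_upwards [hc0] with ω hω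
        by_cases h : (P[Y | m]) ω + ε < α * Y ω
        · simp only [Set.indicator_of_mem (show ω ∈ {ω | (P[Y | m]) ω + ε < α * Y ω} from h), W,
            max_eq_right hω]
          have h3 : 0 < (P[Y | m]) ω + ε := by linarith
          rw [← mul_assoc, mul_comm α, mul_assoc, inv_mul_eq_div, le_div_iff₀ h3]
          linarith
        · rw [Set.indicator_of_notMem (show ω ∉ {ω | (P[Y | m]) ω + ε < α * Y ω} from h)]
          exact mul_nonneg hα (mul_nonneg (inv_nonneg.2 (hpos ω).le) (hY0 ω))
    _ = α * ∫ ω, W ω * (P[Y | m]) ω ∂P := by rw [integral_const_mul, h2]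
    _ ≤ α * ∫ ω, 1 ∂P := by
        refine mul_le_mul_of_nonneg_left ?_ hα
        refine integral_mono_ae h1.int_right (integrable_const 1) (ae_of_all _ fun ω => ?_)
        simp only [W]
        rw [inv_mul_eq_div, div_le_one (hpos ω)]
        linarith [le_max_right 0 ((P[Y | m]) ω)]
    _ = α := by simp

end ProbabilityBounds

/-! ### Summing optimal costs, values and belief errors -/

namespace Trajectory

variable {S A O : Type*} [Fintype S] [Fintype A] [Fintype O]
  [MeasurableSpace S] [DiscreteMeasurableSpace S] [mA : MeasurableSpace A]
  [DiscreteMeasurableSpace A] [mO : MeasurableSpace O] [DiscreteMeasurableSpace O]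
  {Ω : Type*} {𝒢 mΩ : MeasurableSpace Ω} {P : Measure Ω} {L : Setup S A O}
  {X : Trajectory S A O Ω} {H : ℝ}

theorem visits_eq (t : ℕ) (s : S) (a : A) (ω : Ω) :
    X.visits t s a ω = visitCount (fun i => (X.state i ω, X.act i ω)) t (s, a) := by
  rw [visits, visitCount]
  congr 1
  ext i
  simp

theorem visits_le (t : ℕ) (s : S) (a : A) (ω : Ω) : X.visits t s a ω ≤ t := by
  classical
  refine (Finset.card_filter_le _ _).trans ?_
  simp

theorem monotone_pseudoCount (P : Measure Ω) (ω : Ω) : Monotone (X.pseudoCount P ω) :=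
  monotone_nat_of_le_succ fun _ _ _ => le_max_left _ _

theorem expVisits_le_pseudoCount (P : Measure Ω) {t : ℕ} (ht : 1 ≤ t) (s : S) (a : A) (ω : Ω) :
    X.expVisits P t s a ω ≤ X.pseudoCount P ω t s a := by
  obtain ⟨t, rfl⟩ := Nat.exists_eq_add_of_le' ht
  refine (Nat.le_ceil _).trans ?_
  exact_mod_cast le_max_right _ _

theorem indicator_startSet (P : Measure Ω) (t : ℕ) (f : Ω → ℝ) (ω : Ω) :
    (X.startSet P t).indicator f ω =
      if (episode (X.pseudoCount P ω) t).1 = t then f ω else 0 := by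
  by_cases h : (episode (X.pseudoCount P ω) t).1 = t <;> simp [startSet, epStart, h]

theorem one_le_epStart (P : Measure Ω) {t : ℕ} (ht : 1 ≤ t) (ω : Ω) : 1 ≤ X.epStart P t ω :=
  one_le_episode_fst _ ht

variable [IsProbabilityMeasure P]

namespace IsPSRLRun

variable (hX : X.IsPSRLRun P L) (hL : L.IsAdmissible H)
include hX

theorem measurable_visits (t : ℕ) (s : S) (a : A) : Measurable (X.visits t s a) := by
  classical
  have h : X.visits t s a = fun ω => ∑ i ∈ Finset.Ico 1 t,
      (X.state i ⁻¹' {s} ∩ X.act i ⁻¹' {a}).indicator (fun _ => 1) ω := by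
    ext ω
    simp [visits, Set.indicator_apply]
  rw [h]
  exact Finset.measurable_fun_sum _ fun i _ => measurable_const.indicator
    ((hX.state_meas i (MeasurableSet.of_discrete)).inter
      (hX.act_meas i (MeasurableSet.of_discrete)))

theorem integrable_visits (t : ℕ) (s : S) (a : A) :
    Integrable (fun ω => (X.visits t s a ω : ℝ)) P :=
  integrable_of_abs_le (c := t) (measurable_from_top.comp (hX.measurable_visits t s a)) fun ω => by
    rw [Nat.abs_cast]
    exact_mod_cast visits_le t s a ω

theorem ae_pseudoCount_le : ∀ᵐ ω ∂P, ∀ t s a, X.pseudoCount P ω t s a ≤ t := by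
  have h : ∀ᵐ ω ∂P, ∀ (t : ℕ) (s : S) (a : A), X.expVisits P t s a ω ≤ t := by
    refine ae_all_iff.2 fun t => ae_all_iff.2 fun s => ae_all_iff.2 fun a => ?_
    have h1 := condExp_mono (m := X.histPlus (t - 1)) (hX.integrable_visits t s a)
      (integrable_const (μ := P) (t : ℝ))
      (ae_of_all _ fun ω => Nat.cast_le.2 (visits_le t s a ω))
    rw [condExp_const (hX.histPlus_le _)] at h1
    exact h1
  filter_upwards [h] with ω hω t s a
  induction t with
  | zero => rfl
  | succ t ih =>
    exact max_le (ih.trans (Nat.le_succ t)) (Nat.ceil_le.2 (hω (t + 1) s a))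

theorem ae_numStarts_le {T : ℕ} (hT : 1 ≤ T) :
    ∀ᵐ ω ∂P, (numStarts (X.pseudoCount P ω) T : ℝ) ≤ Real.sqrt
      (2 * T * (1 + Fintype.card S * Fintype.card A * Real.logb 2 (T + 1))) := by
  filter_upwards [hX.ae_pseudoCount_le] with ω hω
  exact numStarts_le_sqrt (monotone_pseudoCount P ω) hT fun t ht s a => (hω t s a).trans ht

theorem measurable_episode (t : ℕ) : Measurable fun ω => episode (X.pseudoCount P ω) t :=
  (measurable_episode_hist P le_rfl).mono (hX.hist_le t) le_rfl

theorem measurable_epStart (t : ℕ) : Measurable (X.epStart P t) := (hX.measurable_episode t).fst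

theorem measurableSet_start (t : ℕ) : MeasurableSet (X.startSet P t) :=
  hX.hist_le t _ (measurableSet_startSet P t)

theorem integrable_numStarts (T : ℕ) :
    Integrable (fun ω => (numStarts (X.pseudoCount P ω) T : ℝ)) P := by
  refine integrable_of_abs_le (c := T) ?_ fun ω => by
    rw [Nat.abs_cast]; exact_mod_cast numStarts_le _ T
  have h : (fun ω => (numStarts (X.pseudoCount P ω) T : ℝ)) = fun ω => ∑ t ∈ Finset.Icc 1 T,
      (X.startSet P t).indicator (fun _ => (1 : ℝ)) ω := by
    ext ω
    simp only [numStarts_eq_sum, indicator_startSet]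
  rw [h]
  exact Finset.measurable_fun_sum _ fun t _ => measurable_indicator_one (hX.measurableSet_start t)

theorem ae_sample_keep : ∀ᵐ ω ∂P, ∀ t, 1 ≤ t → episodeStays (X.pseudoCount P ω) t →
    X.sample (t + 1) ω = X.sample t ω := by
  refine ae_all_iff.2 fun t => ?_
  by_cases ht : 1 ≤ t
  · filter_upwards [hX.sample_keep t ht] with ω hω _ hs
    exact hω ((episode_fst_succ_ne_iff _ t).2 hs)
  · exact ae_of_all _ fun ω h => absurd h ht

include hL

/-- The optimal costs of the sampled parameters exceed that of the true one by at most the number of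
episodes. -/
theorem sum_integral_bellmanConst_le (b₀ : Belief S) (T : ℕ) :
    ∑ t ∈ Finset.Icc 1 T, ∫ ω, L.bellmanConst b₀ (X.sample t ω) ∂P ≤
      T * ∫ ω, L.bellmanConst b₀ (X.param ω) ∂P +
        ∫ ω, (numStarts (X.pseudoCount P ω) T : ℝ) ∂P := by
  have hint : ∀ (t : ℕ) {U : Ω → TransKernel S A}, Measurable U → Integrable
      ((X.startSet P t).indicator fun ω =>
        ((episode (X.pseudoCount P ω) t).2 + 1) * L.bellmanConst b₀ (U ω)) P := by
    intro t U hU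
    refine Integrable.indicator (integrable_of_abs_le (c := (t + 1) * 1) ?_ fun ω => ?_)
      (hX.measurableSet_start t)
    · exact ((measurable_from_top.comp (hX.measurable_episode t).snd).add_const 1).mul
        ((hL.measurable_bellmanConst b₀).comp hU)
    · rw [abs_mul, abs_of_nonneg (Setup.bellmanConst_nonneg _ _), abs_of_nonneg (by positivity)]
      refine mul_le_mul ?_ (Setup.bellmanConst_le_one _ _) (Setup.bellmanConst_nonneg _ _)
        (by positivity)
      have := (episode_snd_le (X.pseudoCount P ω) t).trans (episode_fst_le _ t)
      have h' : ((episode (X.pseudoCount P ω) t).2 : ℝ) ≤ t := by exact_mod_cast this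
      linarith
  have hJi := fun {U : Ω → TransKernel S A} (hU : Measurable U) =>
    hX.integrable_bellmanConst hL b₀ hU
  -- The factor T_{k-1} + 1 is determined by the history at the start, so θ_k may be exchanged for
  -- θ_*. The actual length of the episode depends on what happens later and could not be used here.
  have hswap : ∀ t ∈ Finset.Icc 1 T, ∫ ω, (X.startSet P t).indicator (fun ω =>
        ((episode (X.pseudoCount P ω) t).2 + 1) * L.bellmanConst b₀ (X.sample t ω)) ω ∂P =
      ∫ ω, (X.startSet P t).indicator (fun ω =>
        ((episode (X.pseudoCount P ω) t).2 + 1) * L.bellmanConst b₀ (X.param ω)) ω ∂P := by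
    intro t ht
    rw [integral_indicator (hX.measurableSet_start t), integral_indicator (hX.measurableSet_start t)]
    have hZ : Measurable[X.hist t] fun ω => ((episode (X.pseudoCount P ω) t).2 : ℝ) :=
      measurable_from_top.comp (@Measurable.snd _ _ _ (X.hist t) _ _ _
        (measurable_episode_hist (X := X) P le_rfl))
    exact hX.setIntegral_sample_eq hL (Finset.mem_Icc.1 ht).1 hZ
      (g := fun x => (x.1 + 1) * L.bellmanConst b₀ x.2)
      ((measurable_fst.add_const 1).mul ((hL.measurable_bellmanConst b₀).comp measurable_snd))
  calc ∑ t ∈ Finset.Icc 1 T, ∫ ω, L.bellmanConst b₀ (X.sample t ω) ∂P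
      = ∫ ω, ∑ t ∈ Finset.Icc 1 T, L.bellmanConst b₀ (X.sample t ω) ∂P :=
        (integral_finsetSum _ fun t _ => hJi (hX.sample_meas t)).symm
    _ ≤ ∫ ω, ∑ t ∈ Finset.Icc 1 T, (X.startSet P t).indicator (fun ω =>
          ((episode (X.pseudoCount P ω) t).2 + 1) * L.bellmanConst b₀ (X.sample t ω)) ω ∂P := by
        refine integral_mono_ae (integrable_finsetSum _ fun t _ => hJi (hX.sample_meas t))
          (integrable_finsetSum _ fun t _ => hint t (hX.sample_meas t)) ?_
        filter_upwards [hX.ae_sample_keep] with ω hω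
        simp only [indicator_startSet]
        exact sum_le_sum_start (J := fun t => L.bellmanConst b₀ (X.sample t ω))
          (fun t => Setup.bellmanConst_nonneg _ _) (fun t ht hs => by rw [hω t ht hs]) T
    _ = ∫ ω, ∑ t ∈ Finset.Icc 1 T, (X.startSet P t).indicator (fun ω =>
          ((episode (X.pseudoCount P ω) t).2 + 1) * L.bellmanConst b₀ (X.param ω)) ω ∂P := by
        rw [integral_finsetSum _ fun t _ => hint t (hX.sample_meas t),
          integral_finsetSum _ fun t _ => hint t hX.param_meas]
        exact Finset.sum_congr rfl hswap
    _ ≤ ∫ ω, (T * L.bellmanConst b₀ (X.param ω) + (numStarts (X.pseudoCount P ω) T : ℝ)) ∂P := by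
        refine integral_mono (integrable_finsetSum _ fun t _ => hint t hX.param_meas)
          (((hJi hX.param_meas).const_mul _).add (hX.integrable_numStarts T)) fun ω => ?_
        simp only [indicator_startSet]
        -- The previous lengths telescope to the current start time, at most T; the extra 1 per
        -- episode counts episodes.
        have h1 : (∑ t ∈ Finset.Icc 1 T, if (episode (X.pseudoCount P ω) t).1 = t then
            ((episode (X.pseudoCount P ω) t).2 + 1) * L.bellmanConst b₀ (X.param ω) else 0) =
            ((episode (X.pseudoCount P ω) T).1 + numStarts (X.pseudoCount P ω) T) *
              L.bellmanConst b₀ (X.param ω) := by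
          rw [← sum_start_len, numStarts_eq_sum, ← Finset.sum_add_distrib, Finset.sum_mul]
          refine Finset.sum_congr rfl fun t _ => ?_
          split_ifs <;> ring
        rw [h1, add_mul]
        have h2 : ((episode (X.pseudoCount P ω) T).1 : ℝ) ≤ T := by
          exact_mod_cast episode_fst_le _ T
        exact add_le_add (mul_le_mul_of_nonneg_right h2 (Setup.bellmanConst_nonneg _ _))
          (mul_le_of_le_one_right (by positivity) (Setup.bellmanConst_le_one _ _))
    _ = _ := by
        rw [integral_add ((hJi hX.param_meas).const_mul _) (hX.integrable_numStarts T),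
          integral_const_mul]

theorem sum_integral_val_le (hH : 0 ≤ H) (T : ℕ) :
    ∑ t ∈ Finset.Icc 1 T, (∫ ω, X.valNow L H t ω ∂P - ∫ ω, X.valNext L H t ω ∂P) ≤
      H * ∫ ω, (numStarts (X.pseudoCount P ω) T : ℝ) ∂P := by
  have i1 : ∀ t, Integrable (X.valNow L H t) P := fun t => hX.integrable_boundedValue hL hH t t
  have i2 : ∀ t, Integrable (X.valNext L H t) P := fun t =>
    hX.integrable_boundedValue hL hH t (t + 1)
  simp_rw [← integral_sub (i1 _) (i2 _)]
  rw [← integral_finsetSum (Finset.Icc 1 T) (f := fun t ω => X.valNow L H t ω - X.valNext L H t ω)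
    fun t _ => (i1 t).sub (i2 t), ← integral_const_mul]
  refine integral_mono_ae (integrable_finsetSum _ fun t _ => (i1 t).sub (i2 t))
    ((hX.integrable_numStarts T).const_mul H) ?_
  filter_upwards [hX.ae_sample_keep] with ω hω
  exact sum_sub_le_numStarts (V := fun t => X.valNow L H t ω) (V' := fun t => X.valNext L H t ω)
    (fun t => Setup.boundedValue_le hH _ _) (fun t => Setup.boundedValue_nonneg _ _)
    (fun t ht hs => by simp only [valNow, valNext, hω t ht hs]) T

/-- The conditional expectation has the same mean as the belief error itself, so the choice of the
conditioning σ-algebra is irrelevant. Off the good event the error is at most 2, which adds 2δ per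
time step. -/
theorem sum_integral_beliefErr_le {T : ℕ} {K : ℝ → ℝ} (h𝒢 : 𝒢 ≤ mΩ)
    (hcb : X.ConcentratingBelief 𝒢 P L T K) (hT : 1 ≤ T) {δ : ℝ} (hδ0 : 0 < δ) (hδ1 : δ < 1) :
    0 ≤ K δ ∧ ∑ t ∈ Finset.Icc 1 T, ∫ ω, X.beliefErr L t ω ∂P ≤
      K δ * (2 * Real.sqrt (2 * T)) + T * (2 * δ) := by
  have hi : ∀ t, 1 ≤ t → Integrable (X.beliefErr L t) P := fun t ht => by
    obtain ⟨t, rfl⟩ := Nat.exists_eq_add_of_le' ht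
    exact hX.integrable_beliefErr hL t
  have hZm : ∀ t, Measurable (P[X.beliefErr L t | 𝒢]) := fun t =>
    stronglyMeasurable_condExp.measurable.mono h𝒢 le_rfl
  have hZ0 : ∀ t, ∀ᵐ ω ∂P, 0 ≤ (P[X.beliefErr L t | 𝒢]) ω := fun t =>
    condExp_nonneg (ae_of_all _ (beliefErr_nonneg t))
  have hUm : ∀ t, Measurable fun ω => 1 / Real.sqrt (X.epStart P t ω : ℝ) := fun t =>
    (Real.continuous_sqrt.measurable.comp
      (measurable_from_top.comp (hX.measurable_epStart t))).const_div 1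
  have hUi : ∀ t, 1 ≤ t → Integrable (fun ω => 1 / Real.sqrt (X.epStart P t ω : ℝ)) P :=
    fun t ht => integrable_of_abs_le (c := 1) (hUm t) fun ω => by
      rw [abs_of_nonneg (by positivity)]
      refine div_le_one_of_le₀ ?_ (Real.sqrt_nonneg _)
      rw [Real.one_le_sqrt]
      exact_mod_cast one_le_epStart P ht ω
  -- With a negative constant the event in the assumption would be null, contradicting its
  -- probability of at least 1 - δ > 0.
  have hK : 0 ≤ K δ := by
    by_contra hneg
    push Not at hneg
    have h1 := hcb δ hδ0 hδ1 1 le_rfl hT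
    have h2 : P.real {ω | (P[X.beliefErr L 1 | 𝒢]) ω ≤ K δ / Real.sqrt (X.epStart P 1 ω)} = 0 := by
      rw [measureReal_def, ENNReal.toReal_eq_zero_iff]
      left
      rw [← compl_mem_ae_iff]
      filter_upwards [hZ0 1] with ω hω h3
      have h4 : K δ / Real.sqrt (X.epStart P 1 ω) < 0 :=
        div_neg_of_neg_of_pos hneg (Real.sqrt_pos.2 (by
          exact_mod_cast one_le_epStart P le_rfl ω))
      exact absurd (hω.trans h3) (not_le.2 h4)
    have h3 : 1 - δ ≤ 0 := h2 ▸ h1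
    linarith
  refine ⟨hK, ?_⟩
  have hstep : ∀ t ∈ Finset.Icc 1 T, ∫ ω, X.beliefErr L t ω ∂P ≤
      K δ * ∫ ω, 1 / Real.sqrt (X.epStart P t ω : ℝ) ∂P + 2 * δ := by
    intro t ht
    rw [Finset.mem_Icc] at ht
    have hle2 : ∀ᵐ ω ∂P, (P[X.beliefErr L t | 𝒢]) ω ≤ 2 := by
      have h1 := condExp_mono (m := 𝒢) (hi t ht.1) (integrable_const (μ := P) (2 : ℝ))
        (ae_of_all _ (beliefErr_le t))
      rw [condExp_const h𝒢] at h1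
      exact h1
    rw [← integral_condExp h𝒢, ← integral_const_mul]
    refine integral_le_of_prob_le (hZm t) ((hUm t).const_mul _) integrable_condExp
      ((hUi t ht.1).const_mul _) (by norm_num) hle2
      (ae_of_all _ fun ω => mul_nonneg hK (by positivity)) ?_
    simp only [mul_one_div]
    exact hcb δ hδ0 hδ1 t ht.1 ht.2
  refine (Finset.sum_le_sum hstep).trans ?_
  rw [Finset.sum_add_distrib, ← Finset.mul_sum, Finset.sum_const, Nat.card_Icc,
    add_tsub_cancel_right, nsmul_eq_mul]
  refine add_le_add (mul_le_mul_of_nonneg_left ?_ hK) le_rfl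
  rw [← integral_finsetSum _ fun t ht => hUi t (Finset.mem_Icc.1 ht).1]
  calc _ ≤ ∫ ω, 2 * Real.sqrt (2 * T) ∂P :=
        integral_mono (integrable_finsetSum _ fun t ht => hUi t (Finset.mem_Icc.1 ht).1)
          (integrable_const _) fun ω => sum_inv_sqrt_episode_le T
    _ = _ := by simp

end IsPSRLRun

end Trajectory

/-! ### Summing kernel errors through the pseudo-counts -/

theorem episode_fst_fst {S A : Type*} [Fintype S] [Fintype A] (m : ℕ → S → A → ℕ) (t : ℕ) :
    (episode m (episode m t).1).1 = (episode m t).1 := by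
  induction t with
  | zero => simp [episode]
  | succ t ih =>
    by_cases h : episodeStays m t
    · rwa [episode_succ_of_stays m h]
    · rw [episode_succ_of_not_stays m h]
      simp only
      rw [episode_succ_of_not_stays m h]

theorem eq_of_episode {S A : Type*} [Fintype S] [Fintype A] {m : ℕ → S → A → ℕ} {β : Type*}
    {x : ℕ → β} (hx : ∀ t, 1 ≤ t → episodeStays m t → x (t + 1) = x t) {t : ℕ} (ht : 1 ≤ t) :
    x t = x (episode m t).1 := by
  induction t, ht using Nat.le_induction with
  | base => rw [episode_one]
  | succ t ht ih =>
    by_cases h : episodeStays m t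
    · rw [episode_succ_of_stays m h, hx t ht h, ih]
    · rw [episode_succ_of_not_stays m h]

namespace Trajectory

variable {S A O : Type*} [Fintype S] [Fintype A] [Fintype O]
  [MeasurableSpace S] [DiscreteMeasurableSpace S] [mA : MeasurableSpace A]
  [DiscreteMeasurableSpace A] [mO : MeasurableSpace O] [DiscreteMeasurableSpace O]
  {Ω : Type*} {𝒢 mΩ : MeasurableSpace Ω} {P : Measure Ω} {L : Setup S A O}
  {X : Trajectory S A O Ω} {H : ℝ}

/-- The inverse square root of the pseudo-count of the current state and action. -/
noncomputable def invSqrtCount (X : Trajectory S A O Ω) (P : Measure Ω) (t : ℕ) (ω : Ω) : ℝ :=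
  1 / Real.sqrt (max 1 (X.pseudoCount P ω t (X.state t ω) (X.act t ω) : ℝ))

theorem invSqrtCount_nonneg (t : ℕ) (ω : Ω) : 0 ≤ X.invSqrtCount P t ω := by
  rw [invSqrtCount]; positivity

theorem inv_sqrt_max_le_one (x : ℝ) : 1 / Real.sqrt (max 1 x) ≤ 1 := by
  refine div_le_one_of_le₀ ?_ (Real.sqrt_nonneg _)
  rw [Real.one_le_sqrt]
  exact le_max_left _ _

/-- Where the conditional expectation of the number of visits is not too small, the pseudo-count is
comparable to the number of visits. -/
theorem invSqrtCount_le {t : ℕ} (ht : 1 ≤ t) (ω : Ω) {α : ℝ} (hα0 : 0 < α) (hα1 : α ≤ 1)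
    (h : α * X.visits t (X.state t ω) (X.act t ω) ω ≤
      X.expVisits P t (X.state t ω) (X.act t ω) ω + α / 10) :
    X.invSqrtCount P t ω ≤ (1 / Real.sqrt (9 / 10 * α)) *
      (1 / Real.sqrt (max 1 (X.visits t (X.state t ω) (X.act t ω) ω : ℝ))) := by
  set n := X.visits t (X.state t ω) (X.act t ω) ω
  have h1 := expVisits_le_pseudoCount (X := X) P ht (X.state t ω) (X.act t ω) ω
  rw [invSqrtCount]
  set k := X.pseudoCount P ω t (X.state t ω) (X.act t ω)
  have hpos : 0 < 9 / 10 * α := by positivity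
  -- For n ≥ 1 the slack α/10 is at most a tenth of αn, whence the factor 9/10; for n = 0 only α ≤ 1
  -- is needed.
  have h2 : 9 / 10 * α * max 1 (n : ℝ) ≤ max 1 (k : ℝ) := by
    rcases Nat.eq_zero_or_pos n with h0 | h0
    · rw [h0]
      refine le_trans ?_ (le_max_left _ _)
      simp only [Nat.cast_zero, zero_le_one, sup_of_le_left]
      linarith
    · have h0' : (1 : ℝ) ≤ n := by exact_mod_cast h0
      rw [max_eq_right h0']
      refine le_trans ?_ (le_max_right _ _)
      nlinarith
  rw [div_mul_div_comm, one_mul, ← Real.sqrt_mul hpos.le]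
  exact one_div_le_one_div_of_le (Real.sqrt_pos.2 (by positivity)) (Real.sqrt_le_sqrt h2)

variable [IsProbabilityMeasure P]

namespace IsPSRLRun

variable (hX : X.IsPSRLRun P L) (hL : L.IsAdmissible H)
include hX

theorem integrable_invSqrtCount (t : ℕ) : Integrable (X.invSqrtCount P t) P := by
  refine integrable_of_abs_le (c := 1) ?_ fun ω => by
    rw [abs_of_nonneg (invSqrtCount_nonneg _ _)]; exact inv_sqrt_max_le_one _
  refine measurable_comp_of_countable (f := fun (x : S × A) ω =>
    1 / Real.sqrt (max 1 (X.pseudoCount P ω t x.1 x.2 : ℝ)))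
    (g := fun ω => (X.state t ω, X.act t ω)) (fun x => ?_)
    ((hX.state_meas t).prodMk (hX.act_meas t))
  have h := (measurable_pseudoCount (X := X) P (le_refl t) x.1 x.2).mono (hX.hist_le t) le_rfl
  exact (Real.continuous_sqrt.measurable.comp
    (measurable_const.max (measurable_from_top.comp h))).const_div 1

/-- The current pair is random and correlated with the counts, so at each time the bad events of all
|S||A| pairs are discarded, at cost |S||A|α. On the rest, true visit counts replace the
pseudo-counts and the deterministic bound applies. -/
theorem sum_integral_invSqrtCount_le {T : ℕ} {α : ℝ} (hα0 : 0 < α) (hα1 : α ≤ 1) :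
    ∑ t ∈ Finset.Icc 1 T, ∫ ω, X.invSqrtCount P t ω ∂P ≤
      (Fintype.card S * Fintype.card A * T) * α +
        1 / Real.sqrt (9 / 10 * α) * (3 * Real.sqrt (Fintype.card S * Fintype.card A * T)) := by
  let bad : ℕ → S × A → Set Ω := fun t x =>
    {ω | X.expVisits P t x.1 x.2 ω + α / 10 < α * X.visits t x.1 x.2 ω}
  have hvm : ∀ t s a, Measurable fun ω => (X.visits t s a ω : ℝ) := fun t s a =>
    measurable_from_top.comp (hX.measurable_visits t s a)
  have hbm : ∀ t x, MeasurableSet (bad t x) := fun t x =>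
    measurableSet_lt ((stronglyMeasurable_condExp.measurable.mono (hX.histPlus_le _)
      le_rfl).add_const _) ((hvm t x.1 x.2).const_mul α)
  have hbP : ∀ t x, P.real (bad t x) ≤ α := fun t x =>
    probReal_condExp_lt_le (hX.histPlus_le (t - 1)) (hX.integrable_visits t x.1 x.2)
      (hvm t x.1 x.2) (fun ω => by positivity) hα0.le (by positivity)
  have hvi : ∀ t, Integrable (fun ω =>
      1 / Real.sqrt (max 1 (X.visits t (X.state t ω) (X.act t ω) ω : ℝ))) P := fun t => by
    refine integrable_of_abs_le (c := 1) ?_ fun ω => by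
      rw [abs_of_nonneg (by positivity)]; exact inv_sqrt_max_le_one _
    exact measurable_comp_of_countable (f := fun (x : S × A) ω =>
      1 / Real.sqrt (max 1 (X.visits t x.1 x.2 ω : ℝ)))
      (g := fun ω => (X.state t ω, X.act t ω)) (fun x =>
        (Real.continuous_sqrt.measurable.comp (measurable_const.max (hvm t x.1 x.2))).const_div 1)
      ((hX.state_meas t).prodMk (hX.act_meas t))
  have hbi : ∀ t, Integrable (fun ω => ∑ x, (bad t x).indicator (fun _ => (1 : ℝ)) ω) P :=
    fun t => integrable_finsetSum _ fun x _ => integrable_indicator_one (hbm t x)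
  have hstep : ∀ t ∈ Finset.Icc 1 T, ∫ ω, X.invSqrtCount P t ω ∂P ≤
      Fintype.card S * Fintype.card A * α + 1 / Real.sqrt (9 / 10 * α) * ∫ ω,
        1 / Real.sqrt (max 1 (X.visits t (X.state t ω) (X.act t ω) ω : ℝ)) ∂P := by
    intro t ht
    calc ∫ ω, X.invSqrtCount P t ω ∂P
        ≤ ∫ ω, (∑ x, (bad t x).indicator (fun _ => (1 : ℝ)) ω + 1 / Real.sqrt (9 / 10 * α) *
          (1 / Real.sqrt (max 1 (X.visits t (X.state t ω) (X.act t ω) ω : ℝ)))) ∂P := by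
          refine integral_mono (hX.integrable_invSqrtCount t)
            ((hbi t).add ((hvi t).const_mul _)) fun ω => ?_
          have hnn : ∀ x ∈ Finset.univ, 0 ≤ (bad t x).indicator (fun _ => (1 : ℝ)) ω :=
            fun x _ => Set.indicator_nonneg (fun _ _ => zero_le_one) _
          by_cases hω : ω ∈ bad t (X.state t ω, X.act t ω)
          · have h1 := Finset.single_le_sum hnn (Finset.mem_univ (X.state t ω, X.act t ω))
            rw [Set.indicator_of_mem hω] at h1
            have h2 : X.invSqrtCount P t ω ≤ 1 := inv_sqrt_max_le_one _
            have h3 : 0 ≤ 1 / Real.sqrt (9 / 10 * α) *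
              (1 / Real.sqrt (max 1 (X.visits t (X.state t ω) (X.act t ω) ω : ℝ))) := by positivity
            simp only
            linarith
          · have h1 := invSqrtCount_le (P := P) (Finset.mem_Icc.1 ht).1 ω hα0 hα1 (not_lt.1 hω)
            have h2 := Finset.sum_nonneg hnn
            simp only
            linarith
      _ = ∑ x, P.real (bad t x) + 1 / Real.sqrt (9 / 10 * α) * ∫ ω,
          1 / Real.sqrt (max 1 (X.visits t (X.state t ω) (X.act t ω) ω : ℝ)) ∂P := by
          rw [integral_add (hbi t) ((hvi t).const_mul _), integral_const_mul,
            integral_finsetSum _ fun x _ => integrable_indicator_one (hbm t x)]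
          congr 1
          refine Finset.sum_congr rfl fun x _ => ?_
          rw [integral_indicator_const _ (hbm t x), smul_eq_mul, mul_one]
      _ ≤ _ := by
          refine add_le_add ((Finset.sum_le_sum fun x _ => hbP t x).trans_eq ?_) le_rfl
          simp [mul_assoc]
  refine (Finset.sum_le_sum hstep).trans ?_
  rw [Finset.sum_add_distrib, Finset.sum_const, Nat.card_Icc, add_tsub_cancel_right, nsmul_eq_mul,
    ← Finset.mul_sum]
  have hq : 0 ≤ 1 / Real.sqrt (9 / 10 * α) := by positivity
  refine add_le_add (le_of_eq (by ring)) (mul_le_mul_of_nonneg_left ?_ hq)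
  rw [← integral_finsetSum _ fun t _ => hvi t]
  calc _ ≤ ∫ ω, 3 * Real.sqrt (Fintype.card S * Fintype.card A * T) ∂P := by
        refine integral_mono (integrable_finsetSum _ fun t _ => hvi t) (integrable_const _)
          fun ω => ?_
        simp only [visits_eq]
        refine (sum_inv_sqrt_visitCount_le (fun i => (X.state i ω, X.act i ω)) T).trans_eq ?_
        rw [Fintype.card_prod, Nat.cast_mul]
    _ = _ := by simp

/-- The choice `α = (|S| |A| T)^(-1/3)` in the previous bound. -/
theorem sum_integral_invSqrtCount_le_rpow {T : ℕ} (hT : 1 ≤ T) :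
    ∑ t ∈ Finset.Icc 1 T, ∫ ω, X.invSqrtCount P t ω ∂P ≤
      (1 + 3 / Real.sqrt (9 / 10)) *
        ((Fintype.card S * Fintype.card A * T : ℝ) ^ (2 / 3 : ℝ)) := by
  obtain ⟨ω₀⟩ := P.nonempty_of_neZero
  have hS : 1 ≤ Fintype.card S := Fintype.card_pos_iff.2 ⟨X.state 0 ω₀⟩
  have hA : 1 ≤ Fintype.card A := Fintype.card_pos_iff.2 ⟨X.act 0 ω₀⟩
  set N : ℝ := Fintype.card S * Fintype.card A * T with hN
  have hN1 : 1 ≤ N := by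
    have : 1 ≤ Fintype.card S * Fintype.card A * T := Nat.mul_pos (Nat.mul_pos hS hA) hT
    rw [hN]; exact_mod_cast this
  have hN0 : 0 < N := by linarith
  have h1 := hX.sum_integral_invSqrtCount_le (T := T) (α := N ^ (-(1 / 3) : ℝ))
    (Real.rpow_pos_of_pos hN0 _) (Real.rpow_le_one_of_one_le_of_nonpos hN1 (by norm_num))
  rw [← hN] at h1
  refine h1.trans_eq ?_
  have h2 : N * N ^ (-(1 / 3) : ℝ) = N ^ (2 / 3 : ℝ) := by
    nth_rewrite 1 [← Real.rpow_one N]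
    rw [← Real.rpow_add hN0]; norm_num
  have h3 : Real.sqrt (N ^ (-(1 / 3) : ℝ)) = N ^ (-(1 / 6) : ℝ) := by
    rw [Real.sqrt_eq_rpow, ← Real.rpow_mul hN0.le]; norm_num
  have h4 : 1 / N ^ (-(1 / 6) : ℝ) * Real.sqrt N = N ^ (2 / 3 : ℝ) := by
    rw [Real.sqrt_eq_rpow, Real.rpow_neg hN0.le, one_div, inv_inv, ← Real.rpow_add hN0]; norm_num
  rw [h2, Real.sqrt_mul (by norm_num), h3, add_mul, one_mul, ← h4]
  field_simp

include hL

/-- Triangle inequality through the estimator at the start of the episode gives the factor 2, and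
the passage to the current count gives √2. The exceptional events have total probability at most (T
+ 1)δ: one for θ_*, and one for the sample of each possible start time. -/
theorem sum_integral_kernelErr_le {T : ℕ} {K : ℝ → ℝ} (htc : X.TransitionConcentration P T K)
    (hT : 1 ≤ T) {δ : ℝ} (hδ0 : 0 < δ) (hδ1 : δ < 1) :
    0 ≤ K δ ∧ ∑ t ∈ Finset.Icc 1 T, ∫ ω, X.kernelErr t ω ∂P ≤
      2 * Real.sqrt 2 * K δ * ∑ t ∈ Finset.Icc 1 T, ∫ ω, X.invSqrtCount P t ω ∂P +
        T * (2 * (T + 1) * δ) := by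
  obtain ⟨est, hest, hE⟩ := htc
  have hEδ := hE δ hδ0 hδ1
  -- the parameters that are close to the estimate, as a set of triples
  let C : Set ((TransKernel S A × (S → A → ℕ)) × TransKernel S A) :=
    {x | ∀ s a, ∑ s', |x.2 s a s' - x.1.1 s a s'| ≤ K δ / Real.sqrt (max 1 (x.1.2 s a : ℝ))}
  let Z : ℕ → Ω → TransKernel S A × (S → A → ℕ) := fun u ω => (est u ω, X.pseudoCount P ω u)
  have hC : MeasurableSet C := by
    have hC' : C = ⋂ s, ⋂ a, {x | ∑ s', |x.2 s a s' - x.1.1 s a s'| ≤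
        K δ / Real.sqrt (max 1 (x.1.2 s a : ℝ))} := by
      ext x; simp [C]
    rw [hC']
    refine MeasurableSet.iInter fun s => MeasurableSet.iInter fun a => measurableSet_le ?_ ?_
    · exact measurable_sum_abs_sub (measurable_snd.kernel_apply s a)
        (measurable_fst.fst.kernel_apply s a)
    · have h1 : Measurable fun x : (TransKernel S A × (S → A → ℕ)) × TransKernel S A =>
          x.1.2 s a :=
        (measurable_pi_apply a).comp ((measurable_pi_apply s).comp measurable_fst.snd)
      exact (Real.continuous_sqrt.measurable.comp
        (measurable_const.max (measurable_from_top.comp h1))).const_div _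
  have hZ : ∀ u, 1 ≤ u → u ≤ T → Measurable[X.hist u] (Z u) := fun u h1 h2 => by
    let _ := X.hist u
    exact (hest u h1 h2).prodMk (measurable_pi_lambda _ fun s => measurable_pi_lambda _ fun a =>
      measurable_pseudoCount P le_rfl s a)
  let E : Set Ω := {ω | ∀ t, 1 ≤ t → t ≤ T → (Z t ω, X.param ω) ∈ C}
  have hEm : MeasurableSet E := by
    have hE' : E = ⋂ t, ⋂ (_ : 1 ≤ t), ⋂ (_ : t ≤ T), {ω | (Z t ω, X.param ω) ∈ C} := by
      ext ω; simp [E]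
    rw [hE']
    exact MeasurableSet.iInter fun t => MeasurableSet.iInter fun h1 => MeasurableSet.iInter
      fun h2 => (((hZ t h1 h2).mono (hX.hist_le t) le_rfl).prodMk hX.param_meas) hC
  have hEP : 1 - δ ≤ P.real E := hEδ
  have hEc := probReal_compl_le hEm hEP
  have hK : 0 ≤ K δ := by
    have hne : E.Nonempty := by
      by_contra h
      rw [Set.not_nonempty_iff_eq_empty] at h
      rw [h, measureReal_empty] at hEP
      linarith
    obtain ⟨ω, hω⟩ := hne
    by_contra h
    have h1 := hω 1 le_rfl hT (X.state 0 ω) (X.act 0 ω)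
    have h2 : 0 ≤ ∑ s', |X.param ω (X.state 0 ω) (X.act 0 ω) s' -
      est 1 ω (X.state 0 ω) (X.act 0 ω) s'| := Finset.sum_nonneg fun _ _ => abs_nonneg _
    exact absurd (h2.trans h1) (not_le.2 (div_neg_of_neg_of_pos (not_le.1 h)
      (Real.sqrt_pos.2 (by positivity))))
  refine ⟨hK, ?_⟩
  -- The event that an episode starts at u with a sample far from the estimator. Estimator and
  -- counts belong to the history, so θ_* may replace the sample in its probability.
  let B : ℕ → Set Ω := fun u => X.startSet P u ∩ {ω | (Z u ω, X.sample u ω) ∈ Cᶜ}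
  have hBm : ∀ u ∈ Finset.Icc 1 T, MeasurableSet (B u) := fun u hu => by
    rw [Finset.mem_Icc] at hu
    exact (hX.measurableSet_start u).inter
      ((((hZ u hu.1 hu.2).mono (hX.hist_le u) le_rfl).prodMk (hX.sample_meas u)) hC.compl)
  have hBP : ∀ u ∈ Finset.Icc 1 T, P.real (B u) ≤ δ := fun u hu => by
    rw [Finset.mem_Icc] at hu
    refine le_trans ?_ hEc
    rw [measureReal_def, hX.measure_sample_eq hL hu.1 (hZ u hu.1 hu.2) hC.compl]
    exact measureReal_mono fun ω hω hE => hω.2 (hE u hu.1 hu.2)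
  have hBi : Integrable (fun ω => ∑ u ∈ Finset.Icc 1 T, (B u).indicator (fun _ => (1 : ℝ)) ω) P :=
    integrable_finsetSum _ fun u hu => integrable_indicator_one (hBm u hu)
  have hEi := integrable_indicator_one (P := P) hEm.compl
  have hstep : ∀ t ∈ Finset.Icc 1 T, ∫ ω, X.kernelErr t ω ∂P ≤
      2 * Real.sqrt 2 * K δ * ∫ ω, X.invSqrtCount P t ω ∂P + 2 * (T + 1) * δ := by
    intro t ht
    have ht' := Finset.mem_Icc.1 ht
    have hki : Integrable (X.kernelErr t) P := by
      obtain ⟨t, rfl⟩ := Nat.exists_eq_add_of_le' ht'.1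
      exact hX.integrable_kernelErr t
    have i1 : Integrable (fun ω => 2 * Real.sqrt 2 * K δ * X.invSqrtCount P t ω) P :=
      (hX.integrable_invSqrtCount t).const_mul _
    have i2 : Integrable (fun ω => 2 * (Eᶜ.indicator (fun _ => (1 : ℝ)) ω +
        ∑ u ∈ Finset.Icc 1 T, (B u).indicator (fun _ => (1 : ℝ)) ω)) P :=
      (hEi.add hBi).const_mul 2
    calc ∫ ω, X.kernelErr t ω ∂P
        ≤ ∫ ω, (2 * Real.sqrt 2 * K δ * X.invSqrtCount P t ω +
            2 * (Eᶜ.indicator (fun _ => (1 : ℝ)) ω +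
              ∑ u ∈ Finset.Icc 1 T, (B u).indicator (fun _ => (1 : ℝ)) ω)) ∂P := by
          refine integral_mono_ae hki (i1.add i2) ?_
          filter_upwards [hX.ae_sample_keep] with ω hω
          have hnn : ∀ u ∈ Finset.Icc 1 T, 0 ≤ (B u).indicator (fun _ => (1 : ℝ)) ω :=
            fun u _ => Set.indicator_nonneg (fun _ _ => zero_le_one) _
          have hnn' : 0 ≤ Eᶜ.indicator (fun _ => (1 : ℝ)) ω :=
            Set.indicator_nonneg (fun _ _ => zero_le_one) _
          have hmain : 0 ≤ 2 * Real.sqrt 2 * K δ * X.invSqrtCount P t ω :=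
            mul_nonneg (by positivity) (invSqrtCount_nonneg _ _)
          have hk2 : X.kernelErr t ω ≤ 2 := kernelErr_le t ω
          by_cases hωE : ω ∈ E
          -- The comparison is made at the start time u, where posterior sampling applies; the
          -- sample in use at t is still the one drawn at u.
          · set u := (episode (X.pseudoCount P ω) t).1 with hu
            have hu1 : 1 ≤ u := one_le_episode_fst _ ht'.1
            have hut : u ≤ t := episode_fst_le _ t
            have huT : u ∈ Finset.Icc 1 T := Finset.mem_Icc.2 ⟨hu1, hut.trans ht'.2⟩
            have hstart : ω ∈ X.startSet P u := episode_fst_fst _ t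
            have hsamp : X.sample t ω = X.sample u ω :=
              eq_of_episode (x := fun t => X.sample t ω) hω ht'.1
            by_cases hωB : (Z u ω, X.sample u ω) ∈ C
            · have h1 := hωE u hu1 (hut.trans ht'.2) (X.state t ω) (X.act t ω)
              have h2 := hωB (X.state t ω) (X.act t ω)
              have h3 := inv_sqrt_count_start_le (m := X.pseudoCount P ω) ht'.1 (X.state t ω)
                (X.act t ω)
              rw [← hu] at h3
              have h4 : X.kernelErr t ω ≤
                  ∑ s', |X.param ω (X.state t ω) (X.act t ω) s' -
                    est u ω (X.state t ω) (X.act t ω) s'| +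
                  ∑ s', |X.sample u ω (X.state t ω) (X.act t ω) s' -
                    est u ω (X.state t ω) (X.act t ω) s'| := by
                rw [kernelErr, hsamp, ← Finset.sum_add_distrib]
                refine Finset.sum_le_sum fun s' _ => ?_
                rw [abs_sub_comm (X.sample u ω (X.state t ω) (X.act t ω) s')]
                exact abs_sub_le _ _ _
              have h5 : K δ / Real.sqrt (max 1 (X.pseudoCount P ω u (X.state t ω) (X.act t ω) : ℝ))
                  ≤ K δ * (Real.sqrt 2 * X.invSqrtCount P t ω) := by
                rw [div_eq_mul_one_div]
                exact mul_le_mul_of_nonneg_left h3 hK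
              have h6 := Finset.sum_nonneg hnn
              simp only [Z] at h1 h2
              linarith
            · have h1 := Finset.single_le_sum hnn huT
              rw [Set.indicator_of_mem (show ω ∈ B u from ⟨hstart, hωB⟩)] at h1
              linarith
          · have h6 := Finset.sum_nonneg hnn
            have h7 : Eᶜ.indicator (fun _ => (1 : ℝ)) ω = 1 := Set.indicator_of_mem hωE _
            linarith
      _ = 2 * Real.sqrt 2 * K δ * ∫ ω, X.invSqrtCount P t ω ∂P +
            2 * (P.real Eᶜ + ∑ u ∈ Finset.Icc 1 T, P.real (B u)) := by
          rw [integral_add i1 i2, integral_const_mul, integral_const_mul, integral_add hEi hBi,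
            integral_indicator_const _ hEm.compl,
            integral_finsetSum _ fun u hu => integrable_indicator_one (hBm u hu)]
          simp only [smul_eq_mul, mul_one]
          congr 3
          exact Finset.sum_congr rfl fun u hu => by
            rw [integral_indicator_const _ (hBm u hu)]; simp
      _ ≤ _ := by
          have h1 := Finset.sum_le_sum hBP
          rw [Finset.sum_const, Nat.card_Icc, add_tsub_cancel_right, nsmul_eq_mul] at h1
          linarith
  refine (Finset.sum_le_sum hstep).trans_eq ?_
  rw [Finset.sum_add_distrib, ← Finset.mul_sum, Finset.sum_const, Nat.card_Icc,
    add_tsub_cancel_right, nsmul_eq_mul]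

end IsPSRLRun

end Trajectory

/-! ### The explicit regret bound -/

namespace Trajectory

variable {S A O : Type*} [Fintype S] [Fintype A] [Fintype O]
  [MeasurableSpace S] [DiscreteMeasurableSpace S] [mA : MeasurableSpace A]
  [DiscreteMeasurableSpace A] [mO : MeasurableSpace O] [DiscreteMeasurableSpace O]
  {Ω : Type*} {𝒢 mΩ : MeasurableSpace Ω} {P : Measure Ω} [IsProbabilityMeasure P] {L : Setup S A O}
  {X : Trajectory S A O Ω} {H : ℝ}

namespace IsPSRLRun

variable (hX : X.IsPSRLRun P L) (hL : L.IsAdmissible H)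
include hX hL

theorem excessCost_ae_eq (b₀ : Belief S) (T : ℕ) : X.excessCost L T =ᵐ[P] fun ω =>
    ∑ t ∈ Finset.Icc 1 T,
      (L.cost (X.state t ω) (X.act t ω) - L.bellmanConst b₀ (X.param ω)) := by
  filter_upwards [hX.ae_param_good hL] with ω hω
  have : Nonempty A := ⟨X.act 0 ω⟩
  exact Finset.sum_congr rfl fun t _ => by rw [hω.bellmanConst_eq b₀ (L.init (X.param ω))]

theorem integrable_excessCost (T : ℕ) : Integrable (X.excessCost L T) P := by
  have hb := fun ω => L.init (X.param ω)
  obtain ⟨ω₀⟩ := P.nonempty_of_neZero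
  refine Integrable.congr ?_ (hX.excessCost_ae_eq hL (hb ω₀) T).symm
  exact integrable_finsetSum _ fun t _ => (hX.integrable_cost t).sub
    (hX.integrable_bellmanConst hL _ hX.param_meas)

theorem integral_regret (b₀ : Belief S) (T : ℕ) : ∫ ω, X.regret P L T ω ∂P =
    ∑ t ∈ Finset.Icc 1 T, ∫ ω, L.cost (X.state t ω) (X.act t ω) ∂P -
      T * ∫ ω, L.bellmanConst b₀ (X.param ω) ∂P := by
  have hJ := hX.integrable_bellmanConst hL b₀ hX.param_meas
  have hs (t : ℕ) : Integrable
      (fun ω => L.cost (X.state t ω) (X.act t ω) - L.bellmanConst b₀ (X.param ω)) P :=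
    (hX.integrable_cost t).sub hJ
  rw [regret, integral_condExp hX.param_meas.comap_le,
    integral_congr_ae (hX.excessCost_ae_eq hL b₀ T), integral_finsetSum _ fun t _ => hs t]
  simp_rw [integral_sub (hX.integrable_cost _) hJ]
  rw [Finset.sum_sub_distrib, Finset.sum_const, Nat.card_Icc, add_tsub_cancel_right, nsmul_eq_mul]

/-- Each summand is at most 1. This settles the rate when the span bound H exceeds T. -/
theorem integral_regret_le_horizon (T : ℕ) : ∫ ω, X.regret P L T ω ∂P ≤ T := by
  rw [regret, integral_condExp hX.param_meas.comap_le]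
  calc ∫ ω, X.excessCost L T ω ∂P ≤ ∫ ω, (T : ℝ) ∂P := by
        refine integral_mono (hX.integrable_excessCost hL T) (integrable_const _) fun ω => ?_
        calc X.excessCost L T ω ≤ ∑ t ∈ Finset.Icc 1 T, (1 : ℝ) := Finset.sum_le_sum fun t _ => by
              have h1 := L.cost_le_one (X.state t ω) (X.act t ω)
              have h2 := L.toPOMDP.optCost_nonneg (X.param ω) (L.init (X.param ω))
              linarith
          _ = T := by simp
    _ = T := by simp

/-- The explicit bound on the Bayesian regret. -/
theorem integral_regret_le {T : ℕ} {K₁ K₂ : ℝ → ℝ} (hT : 1 ≤ T) (h𝒢 : 𝒢 ≤ mΩ)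
    (hcb : X.ConcentratingBelief 𝒢 P L T K₁) (htc : X.TransitionConcentration P T K₂) :
    ∫ ω, X.regret P L T ω ∂P ≤
      (1 + H) * Real.sqrt
        (2 * T * (1 + Fintype.card S * Fintype.card A * Real.logb 2 (T + 1)))
      + 12 * H * K₂ (1 / (4 * (T : ℝ) ^ 2)) *
        ((Fintype.card S * Fintype.card A * T : ℝ) ^ (2 / 3 : ℝ))
      + 7 * (H + 1) * K₁ (1 / (2 * T * max 1 H)) * Real.sqrt (2 * T) *
        (1 + Fintype.card S * Fintype.card A * Real.logb 2 (T + 1)) *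
        Real.log (Real.sqrt (2 * T))
      + 2 + H := by
  obtain ⟨ω₀⟩ := P.nonempty_of_neZero
  have : Nonempty S := ⟨X.state 0 ω₀⟩
  have hH : 0 ≤ H := hL.nonneg
  have hT1 : (1 : ℝ) ≤ T := by exact_mod_cast hT
  let b₀ : Belief S := L.init (X.param ω₀)
  have hδ₁0 : 0 < 1 / (2 * T * max 1 H) := by positivity
  have hδ₁1 : 1 / (2 * T * max 1 H) < 1 := by
    rw [div_lt_one (by positivity)]
    have : 1 ≤ max 1 H := le_max_left _ _
    nlinarith
  have hδ₂0 : 0 < 1 / (4 * (T : ℝ) ^ 2) := by positivity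
  have hδ₂1 : 1 / (4 * (T : ℝ) ^ 2) < 1 := by
    rw [div_lt_one (by positivity)]
    nlinarith
  obtain ⟨hK₁, hb⟩ := hX.sum_integral_beliefErr_le hL h𝒢 hcb hT hδ₁0 hδ₁1
  obtain ⟨hK₂, hk⟩ := hX.sum_integral_kernelErr_le hL htc hT hδ₂0 hδ₂1
  set k₁ := K₁ (1 / (2 * T * max 1 H))
  set k₂ := K₂ (1 / (4 * (T : ℝ) ^ 2))
  set N : ℝ := (Fintype.card S * Fintype.card A * T : ℝ) ^ (2 / 3 : ℝ)
  have hN : 0 ≤ N := by positivity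
  set F : ℝ := 1 + Fintype.card S * Fintype.card A * Real.logb 2 (T + 1)
  have hF : 1 ≤ F := by
    have : 0 ≤ Real.logb 2 (T + 1 : ℝ) := Real.logb_nonneg (by norm_num) (by linarith)
    have : 0 ≤ Fintype.card S * Fintype.card A * Real.logb 2 (T + 1 : ℝ) := by positivity
    linarith
  have hstarts : ∫ ω, (numStarts (X.pseudoCount P ω) T : ℝ) ∂P ≤ Real.sqrt (2 * T * F) := by
    calc _ ≤ ∫ ω, Real.sqrt (2 * T * F) ∂P :=
          integral_mono_ae (hX.integrable_numStarts T) (integrable_const _) (hX.ae_numStarts_le hT)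
      _ = _ := by simp
  have hcost : ∑ t ∈ Finset.Icc 1 T, ∫ ω, L.cost (X.state t ω) (X.act t ω) ∂P ≤
      ∑ t ∈ Finset.Icc 1 T, (∫ ω, L.bellmanConst b₀ (X.sample t ω) ∂P +
        (∫ ω, X.valNow L H t ω ∂P - ∫ ω, X.valNext L H t ω ∂P) +
        (1 + H) * ∫ ω, X.beliefErr L t ω ∂P + H * ∫ ω, X.kernelErr t ω ∂P) := by
    refine Finset.sum_le_sum fun t ht => ?_
    obtain ⟨t, rfl⟩ := Nat.exists_eq_add_of_le' (Finset.mem_Icc.1 ht).1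
    exact hX.integral_cost_le hL hH b₀ t
  rw [Finset.sum_add_distrib, Finset.sum_add_distrib, Finset.sum_add_distrib, ← Finset.mul_sum,
    ← Finset.mul_sum] at hcost
  have h1 := hX.sum_integral_bellmanConst_le hL b₀ T
  have h2 := hX.sum_integral_val_le hL hH T
  have h3 := mul_le_mul_of_nonneg_left hstarts (by linarith : 0 ≤ 1 + H)
  have h4 := mul_le_mul_of_nonneg_left hb (by linarith : 0 ≤ 1 + H)
  have h5 := mul_le_mul_of_nonneg_left hk hH
  -- Numerically 2√2(1 + 3/√0.9) ≈ 11.77, which explains the constant 12.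
  have h6 : 2 * Real.sqrt 2 * k₂ * ∑ t ∈ Finset.Icc 1 T, ∫ ω, X.invSqrtCount P t ω ∂P ≤
      12 * k₂ * N := by
    have hs2 : Real.sqrt 2 ≤ 14143 / 10000 := Real.sqrt_le_iff.2 (by norm_num)
    have hs9 : 9486 / 10000 ≤ Real.sqrt (9 / 10) := Real.le_sqrt_of_sq_le (by norm_num)
    have hs3 : 3 / Real.sqrt (9 / 10) ≤ 3163 / 1000 := by
      rw [div_le_iff₀ (by linarith)]; linarith
    have hc : 2 * Real.sqrt 2 * (1 + 3 / Real.sqrt (9 / 10)) ≤ 12 := by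
      have h0 : 0 ≤ 3 / Real.sqrt (9 / 10) := by positivity
      have h0' : 0 ≤ Real.sqrt 2 := Real.sqrt_nonneg 2
      nlinarith
    calc _ ≤ 2 * Real.sqrt 2 * k₂ * ((1 + 3 / Real.sqrt (9 / 10)) * N) :=
          mul_le_mul_of_nonneg_left (hX.sum_integral_invSqrtCount_le_rpow hT) (by positivity)
      _ = 2 * Real.sqrt 2 * (1 + 3 / Real.sqrt (9 / 10)) * (k₂ * N) := by ring
      _ ≤ 12 * (k₂ * N) := mul_le_mul_of_nonneg_right hc (by positivity)
      _ = 12 * k₂ * N := by ring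
  -- Failure of the belief concentration contributes (1 + H)/max(1, H) ≤ 2 in total; failure of the
  -- kernel concentration, bounded next, contributes at most H. These are the summands 2 + H.
  have h7 : (1 + H) * (T * (2 * (1 / (2 * T * max 1 H)))) ≤ 2 := by
    have e : (T * (2 * (1 / (2 * T * max 1 H))) : ℝ) = 1 / max 1 H := by field_simp
    rw [e, mul_one_div, div_le_iff₀ (by positivity)]
    linarith [le_max_left 1 H, le_max_right 1 H]
  have h8 : (T * (2 * (T + 1) * (1 / (4 * (T : ℝ) ^ 2))) : ℝ) ≤ 1 := by
    have e : (T * (2 * (T + 1) * (1 / (4 * (T : ℝ) ^ 2))) : ℝ) = (T + 1) / (2 * T) := by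
      field_simp; ring
    rw [e, div_le_one (by positivity)]
    linarith
  -- The argument yields the belief term with factor 2 and no logarithms. The stated factor is
  -- larger, since F ≥ 1 and 7 log √2 > 2.
  have h9 : 2 ≤ 7 * F * Real.log (Real.sqrt (2 * T)) := by
    have hlog : 0.34 ≤ Real.log (Real.sqrt (2 * T)) := by
      rw [Real.log_sqrt (by positivity)]
      have h10 : Real.log 2 ≤ Real.log (2 * T) := Real.log_le_log (by norm_num) (by linarith)
      have := Real.log_two_gt_d9
      norm_num at this ⊢
      linarith
    nlinarith
  have h10 : (1 + H) * (k₁ * (2 * Real.sqrt (2 * T))) ≤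
      7 * (H + 1) * k₁ * Real.sqrt (2 * T) * F * Real.log (Real.sqrt (2 * T)) := by
    have h11 : 0 ≤ (1 + H) * k₁ * Real.sqrt (2 * T) := by positivity
    nlinarith [mul_le_mul_of_nonneg_left h9 h11]
  have h12 := mul_le_mul_of_nonneg_left h6 hH
  have h13 := mul_le_mul_of_nonneg_left h8 hH
  rw [hX.integral_regret hL b₀ T]
  linarith

end IsPSRLRun

end Trajectory

/-! ### Polylogarithmic constants and the rate -/

section PolynomialGrowth

theorem MvPolynomial.exists_abs_eval_le {σ : Type*} [Fintype σ] (p : MvPolynomial σ ℝ) :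
    ∃ c : ℝ, 0 ≤ c ∧ ∃ d : ℕ, ∀ x : σ → ℝ, |eval x p| ≤ c * (1 + ∑ i, |x i|) ^ d := by
  have hbase (x : σ → ℝ) : 1 ≤ 1 + ∑ i, |x i| := by
    have : 0 ≤ ∑ i, |x i| := Finset.sum_nonneg fun i _ => abs_nonneg _
    linarith
  induction p using MvPolynomial.induction_on with
  | C a => exact ⟨|a|, abs_nonneg a, 0, fun x => by simp⟩
  | add p q hp hq =>
    obtain ⟨c, hc, d, h⟩ := hp
    obtain ⟨c', hc', d', h'⟩ := hq
    refine ⟨c + c', add_nonneg hc hc', d + d', fun x => ?_⟩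
    rw [map_add, add_mul]
    refine (abs_add_le _ _).trans (add_le_add ((h x).trans ?_) ((h' x).trans ?_))
    · exact mul_le_mul_of_nonneg_left (pow_le_pow_right₀ (hbase x) (Nat.le_add_right _ _)) hc
    · exact mul_le_mul_of_nonneg_left (pow_le_pow_right₀ (hbase x) (Nat.le_add_left _ _)) hc'
  | mul_X p i hp =>
    obtain ⟨c, hc, d, h⟩ := hp
    refine ⟨c, hc, d + 1, fun x => ?_⟩
    have hi : |x i| ≤ 1 + ∑ j, |x j| := by
      have := Finset.single_le_sum (fun j _ => abs_nonneg (x j)) (Finset.mem_univ i)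
      linarith
    rw [map_mul, eval_X, abs_mul, pow_succ, ← mul_assoc]
    exact mul_le_mul (h x) hi (abs_nonneg _)
      (mul_nonneg hc (pow_nonneg (zero_le_one.trans (hbase x)) _))

/-- A polylogarithm is eventually dominated by any positive power. -/
theorem exists_mul_one_add_log_pow_le (D : ℝ) (q : ℕ) {r : ℝ} (hr : 0 < r) :
    ∃ T₀ : ℕ, 1 ≤ T₀ ∧ ∀ T : ℕ, T₀ ≤ T → D * (1 + Real.log T) ^ q ≤ (T : ℝ) ^ r := by
  have h1 : (fun x : ℝ => (1 + Real.log x) ^ q) =o[Filter.atTop] fun x => x ^ r := by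
    have h2 : (fun x : ℝ => (1 + Real.log x) ^ q) =O[Filter.atTop]
        fun x => Real.log x ^ (q : ℝ) := by
      simp_rw [Real.rpow_natCast]
      refine Asymptotics.IsBigO.pow (Asymptotics.IsBigO.add ?_ (Asymptotics.isBigO_refl _ _)) q
      exact Real.isLittleO_const_log_atTop.isBigO
    exact h2.trans_isLittleO (isLittleO_log_rpow_rpow_atTop _ hr)
  have h3 := (h1.const_mul_left D).comp_tendsto tendsto_natCast_atTop_atTop
  have h4 := h3.bound zero_lt_one
  obtain ⟨T₀, hT₀⟩ := Filter.eventually_atTop.1 h4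
  refine ⟨max 1 T₀, le_max_left _ _, fun T hT => ?_⟩
  have := hT₀ T ((le_max_right _ _).trans hT)
  simp only [Function.comp_apply, one_mul, Real.norm_eq_abs] at this
  rw [abs_of_nonneg (Real.rpow_nonneg (Nat.cast_nonneg T) r)] at this
  exact (le_abs_self _).trans this

/-- The constant is bounded by a power of `1 + log T` if `1 / δ` is bounded by `4 T ^ 2`. -/
theorem exists_polyLogConst_le (S A O : Type*) [Fintype S] [Fintype A] [Fintype O]
    [Nonempty S] [Nonempty A] [Nonempty O] (p : MvPolynomial (Fin 4) ℝ) :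
    ∃ c : ℝ, 0 ≤ c ∧ ∃ d : ℕ, ∀ (T : ℕ) (y : ℝ), 1 ≤ T → 1 ≤ y → y ≤ 4 * (T : ℝ) ^ 2 →
      polyLogConst S A O p T (1 / y) ≤ c * (1 + Real.log T) ^ d := by
  obtain ⟨c, hc, d, h⟩ := p.exists_abs_eval_le
  set n : ℝ := Fintype.card S * Fintype.card A * Fintype.card O with hn
  have hn1 : 1 ≤ n := by
    have : 1 ≤ Fintype.card S * Fintype.card A * Fintype.card O :=
      Nat.mul_pos (Nat.mul_pos Fintype.card_pos Fintype.card_pos) Fintype.card_pos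
    rw [hn]; exact_mod_cast this
  -- One plus the sum of the four arguments is at most Q(1 + log T): ι ≤ log(4n) + 3 log T, and the
  -- summand 4 absorbs both the 1 and the coefficient 3.
  set Q : ℝ := 4 + Fintype.card S + Fintype.card A + Fintype.card O + Real.log (4 * n) with hQ
  have hl4 : 0 ≤ Real.log (4 * n) := Real.log_nonneg (by linarith)
  have hQ0 : 0 ≤ Q := by positivity
  refine ⟨c * Q ^ d, by positivity, d, fun T y hT hy1 hy2 => ?_⟩
  have hT1 : (1 : ℝ) ≤ T := by exact_mod_cast hT
  have hlog : 0 ≤ Real.log T := Real.log_nonneg hT1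
  have hdiv : n * T / (1 / y) = n * T * y := by rw [one_div, div_inv_eq_mul]
  have hι0 : 0 ≤ Real.log (n * T / (1 / y)) := by
    rw [hdiv]
    exact Real.log_nonneg (one_le_mul_of_one_le_of_one_le
      (one_le_mul_of_one_le_of_one_le hn1 hT1) hy1)
  have hι1 : Real.log (n * T / (1 / y)) ≤ Real.log (4 * n) + 3 * Real.log T := by
    have e : Real.log (4 * n) + 3 * Real.log T = Real.log (4 * n * (T : ℝ) ^ 3) := by
      rw [Real.log_mul (x := 4 * n) (by positivity) (by positivity), Real.log_pow]; norm_num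
    rw [e, hdiv]
    refine Real.log_le_log (by positivity) ?_
    calc n * T * y ≤ n * T * (4 * (T : ℝ) ^ 2) := mul_le_mul_of_nonneg_left hy2 (by positivity)
      _ = _ := by ring
  refine (le_abs_self _).trans ((h _).trans ?_)
  rw [mul_assoc c, ← mul_pow]
  refine mul_le_mul_of_nonneg_left (pow_le_pow_left₀ ?_ ?_ d) hc
  · have : 0 ≤ ∑ i, |(![(Fintype.card S : ℝ), (Fintype.card A : ℝ), (Fintype.card O : ℝ),
      Real.log (n * T / (1 / y))] : Fin 4 → ℝ) i| := Finset.sum_nonneg fun i _ => abs_nonneg _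
    linarith
  · rw [Fin.sum_univ_four]
    simp only [Matrix.cons_val]
    rw [abs_of_nonneg hι0, abs_of_nonneg (Nat.cast_nonneg _), abs_of_nonneg (Nat.cast_nonneg _),
      abs_of_nonneg (Nat.cast_nonneg _)]
    have hs : (0 : ℝ) ≤ Fintype.card S := Nat.cast_nonneg _
    have ha : (0 : ℝ) ≤ Fintype.card A := Nat.cast_nonneg _
    have ho : (0 : ℝ) ≤ Fintype.card O := Nat.cast_nonneg _
    have h3 : 3 * Real.log T ≤ (Q - 1) * Real.log T :=
      mul_le_mul_of_nonneg_right (by linarith) hlog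
    nlinarith

/-- The terms of order `√T` of the regret bound, up to logarithms. -/
theorem lower_order_terms_le {sa H₀ H c : ℝ} {d T : ℕ} (hsa : 1 ≤ sa) (hH₀ : 0 < H₀) (hH : H₀ ≤ H)
    (hc : 0 ≤ c) (hT : 1 ≤ T) {k : ℝ} (hk : k ≤ c * (1 + Real.log T) ^ d) :
    (1 + H) * Real.sqrt (2 * T * (1 + sa * Real.logb 2 (T + 1))) +
      7 * (H + 1) * k * Real.sqrt (2 * T) * (1 + sa * Real.logb 2 (T + 1)) *
        Real.log (Real.sqrt (2 * T)) + 2 + H ≤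
    H * ((1 / H₀ + 1) * (2 * (1 + 2 * sa) + 14 * c * (1 + 2 * sa)) + (2 / H₀ + 1)) *
      Real.sqrt T * (1 + Real.log T) ^ (d + 2) := by
  have hT1 : (1 : ℝ) ≤ T := by exact_mod_cast hT
  have hlog : 0 ≤ Real.log T := Real.log_nonneg hT1
  set g := 1 + Real.log T with hg
  have hg1 : 1 ≤ g := by linarith
  have hH0 : 0 < H := hH₀.trans_le hH
  have hl2 : 0.6 ≤ Real.log 2 := by have := Real.log_two_gt_d9; norm_num at this ⊢; linarith
  have hl2' : Real.log 2 ≤ 0.7 := by have := Real.log_two_lt_d9; norm_num at this ⊢; linarith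
  have hlogT1 : Real.log (T + 1) ≤ Real.log 2 + Real.log T := by
    rw [← Real.log_mul (by norm_num) (by positivity)]
    exact Real.log_le_log (by positivity) (by linarith)
  have hb : Real.logb 2 (T + 1 : ℝ) ≤ 2 * g := by
    rw [Real.logb, div_le_iff₀ (by linarith)]
    nlinarith
  have hb0 : 0 ≤ Real.logb 2 (T + 1 : ℝ) := Real.logb_nonneg (by norm_num) (by linarith)
  set F := 1 + sa * Real.logb 2 (T + 1) with hF
  have hF1 : 1 ≤ F := by
    have : 0 ≤ sa * Real.logb 2 (T + 1 : ℝ) := by positivity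
    linarith
  have hFg : F ≤ (1 + 2 * sa) * g := by nlinarith
  have hs2 : Real.sqrt 2 ≤ 2 := Real.sqrt_le_iff.2 (by norm_num)
  have hsT : 1 ≤ Real.sqrt T := Real.one_le_sqrt.2 hT1
  have hs2T : Real.sqrt (2 * T) ≤ 2 * Real.sqrt T := by
    rw [Real.sqrt_mul (by norm_num)]
    exact mul_le_mul_of_nonneg_right hs2 (Real.sqrt_nonneg _)
  have hsF : Real.sqrt (2 * T * F) ≤ 2 * (1 + 2 * sa) * Real.sqrt T * g := by
    rw [Real.sqrt_mul (by positivity)]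
    have hsF' : Real.sqrt F ≤ F := Real.sqrt_le_iff.2 ⟨by linarith, by nlinarith⟩
    calc _ ≤ 2 * Real.sqrt T * ((1 + 2 * sa) * g) :=
          mul_le_mul hs2T (hsF'.trans hFg) (Real.sqrt_nonneg _) (by positivity)
      _ = _ := by ring
  have hl : Real.log (Real.sqrt (2 * T)) ≤ g := by
    rw [Real.log_sqrt (by positivity), Real.log_mul (by norm_num) (by positivity)]
    linarith
  have hl0 : 0 ≤ Real.log (Real.sqrt (2 * T)) :=
    Real.log_nonneg (Real.one_le_sqrt.2 (by linarith))
  -- The lower bound H₀ on H is what turns additive constants into multiples of H.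
  have hH1 : 1 + H ≤ (1 / H₀ + 1) * H := by
    have : 1 ≤ 1 / H₀ * H := by rw [one_div_mul_eq_div, one_le_div hH₀]; exact hH
    linarith
  have hH2 : 2 + H ≤ (2 / H₀ + 1) * H := by
    have : 2 ≤ 2 / H₀ * H := by
      rw [div_mul_eq_mul_div, le_div_iff₀ hH₀]; linarith
    linarith
  have hgd : g ≤ g ^ (d + 2) := le_self_pow₀ hg1 (by omega)
  have hgd1 : 1 ≤ g ^ (d + 2) := one_le_pow₀ hg1
  have t1 : (1 + H) * Real.sqrt (2 * T * F) ≤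
      ((1 / H₀ + 1) * H) * (2 * (1 + 2 * sa) * Real.sqrt T * g ^ (d + 2)) :=
    mul_le_mul hH1 (hsF.trans (mul_le_mul_of_nonneg_left hgd (by positivity)))
      (Real.sqrt_nonneg _) (by positivity)
  have t2 : 7 * (H + 1) * k * Real.sqrt (2 * T) * F * Real.log (Real.sqrt (2 * T)) ≤
      ((1 / H₀ + 1) * H) * (14 * c * (1 + 2 * sa) * Real.sqrt T * g ^ (d + 2)) := by
    have m : 0 ≤ 7 * (H + 1) * Real.sqrt (2 * T) * F * Real.log (Real.sqrt (2 * T)) := by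
      positivity
    calc _ = 7 * (H + 1) * Real.sqrt (2 * T) * F * Real.log (Real.sqrt (2 * T)) * k := by ring
      _ ≤ 7 * (H + 1) * Real.sqrt (2 * T) * F * Real.log (Real.sqrt (2 * T)) * (c * g ^ d) :=
          mul_le_mul_of_nonneg_left hk m
      _ ≤ 7 * ((1 / H₀ + 1) * H) * (2 * Real.sqrt T) * ((1 + 2 * sa) * g) * g * (c * g ^ d) := by
          have : H + 1 ≤ (1 / H₀ + 1) * H := by linarith
          gcongr
      _ = _ := by ring
  have t3 : 2 + H ≤ (2 / H₀ + 1) * H * (Real.sqrt T * g ^ (d + 2)) := by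
    refine hH2.trans (le_mul_of_one_le_right (by positivity) ?_)
    exact one_le_mul_of_one_le_of_one_le hsT hgd1
  calc _ ≤ ((1 / H₀ + 1) * H) * (2 * (1 + 2 * sa) * Real.sqrt T * g ^ (d + 2)) +
        ((1 / H₀ + 1) * H) * (14 * c * (1 + 2 * sa) * Real.sqrt T * g ^ (d + 2)) +
        (2 / H₀ + 1) * H * (Real.sqrt T * g ^ (d + 2)) := by linarith
    _ = _ := by ring

end PolynomialGrowth

namespace Trajectory.IsPSRLRun

/-- The rate of the Bayesian regret when the concentration constants are polylogarithmic. -/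
theorem exists_integral_regret_le {S A O : Type*} [Fintype S] [Fintype A] [Fintype O]
    [MeasurableSpace S] [DiscreteMeasurableSpace S] [MeasurableSpace A] [DiscreteMeasurableSpace A]
    [MeasurableSpace O] [DiscreteMeasurableSpace O] [Nonempty S] [Nonempty A] [Nonempty O]
    (p₁ p₂ : MvPolynomial (Fin 4) ℝ) {H₀ : ℝ} (hH₀ : 0 < H₀) :
    ∃ (T₀ : ℕ) (C : ℝ) (q : ℕ),
      ∀ (Ω : Type uΩ) (𝒢 : MeasurableSpace Ω) [mΩ : MeasurableSpace Ω] (P : Measure Ω)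
        [IsProbabilityMeasure P] (L : Setup S A O) (X : Trajectory S A O Ω) (H : ℝ), H₀ ≤ H →
      L.IsAdmissible H → X.IsPSRLRun P L →
      ∀ (T : ℕ), 𝒢 ≤ mΩ →
        X.ConcentratingBelief 𝒢 P L T (polyLogConst S A O p₁ T) →
        X.TransitionConcentration P T (polyLogConst S A O p₂ T) →
        (T₀ ≤ T → ∫ ω, X.regret P L T ω ∂P ≤
          13 * H * max 1 (polyLogConst S A O p₂ T (1 / (4 * (T : ℝ) ^ 2))) *
            ((Fintype.card S * Fintype.card A * T : ℝ) ^ (2 / 3 : ℝ))) ∧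
        (2 ≤ T → ∫ ω, X.regret P L T ω ∂P ≤
          C * H * ((Fintype.card S * Fintype.card A * T : ℝ) ^ (2 / 3 : ℝ)) *
            Real.log T ^ q) := by
  obtain ⟨c₁, hc₁, d₁, hK₁⟩ := exists_polyLogConst_le S A O p₁
  obtain ⟨c₂, hc₂, d₂, hK₂⟩ := exists_polyLogConst_le S A O p₂
  set sa : ℝ := Fintype.card S * Fintype.card A with hsa_def
  have hsa : 1 ≤ sa := by
    have : 1 ≤ Fintype.card S * Fintype.card A := Nat.mul_pos Fintype.card_pos Fintype.card_pos
    rw [hsa_def]; exact_mod_cast this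
  set D : ℝ := (1 / H₀ + 1) * (2 * (1 + 2 * sa) + 14 * c₁ * (1 + 2 * sa)) + (2 / H₀ + 1) with hD
  have hD0 : 0 ≤ D := by positivity
  -- The exponent is 1/6 = 2/3 - 1/2, the gap between the leading rate and the terms of order √T.
  obtain ⟨T₀, hT₀, hT₀'⟩ := exists_mul_one_add_log_pow_le D (d₁ + 2) (r := 1 / 6) (by norm_num)
  -- 12c₂ covers the kernel term, D the lower-order terms and 1 the case H > T. The power of 3 comes
  -- from 1 + log T ≤ 3 log T for T ≥ 2.
  refine ⟨T₀, (12 * c₂ + D + 1) * 3 ^ (d₁ + d₂ + 2), d₁ + d₂ + 2, ?_⟩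
  intro Ω 𝒢 mΩ P _ L X H hH hL hX T h𝒢 hcb htc
  have hH0 : 0 < H := hH₀.trans_le hH
  set N : ℝ := (sa * T : ℝ) ^ (2 / 3 : ℝ) with hN
  have hN1 : 1 ≤ T → 1 ≤ N := fun hT => Real.one_le_rpow
    (one_le_mul_of_one_le_of_one_le hsa (by exact_mod_cast hT)) (by norm_num)
  have hNT : 1 ≤ T → (T : ℝ) ^ (2 / 3 : ℝ) ≤ N := fun hT => by
    have : (0 : ℝ) ≤ T := Nat.cast_nonneg _
    exact Real.rpow_le_rpow this (le_mul_of_one_le_left this hsa) (by norm_num)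
  -- The confidence level δ₁ depends on H, so ι is not controlled by T alone. For H ≤ T one has 1/δ₁
  -- ≤ 2T², and for H > T the trivial bound is enough; this makes the constants uniform in H.
  have hlong : (T : ℝ) < H → ∫ ω, X.regret P L T ω ∂P ≤ H := fun h =>
    (hX.integral_regret_le_horizon hL T).trans h.le
  have hshort : 1 ≤ T → H ≤ T → ∫ ω, X.regret P L T ω ∂P ≤
      12 * H * polyLogConst S A O p₂ T (1 / (4 * (T : ℝ) ^ 2)) * N +
        H * D * Real.sqrt T * (1 + Real.log T) ^ (d₁ + 2) := by
    intro hT hHT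
    have hT1 : (1 : ℝ) ≤ T := by exact_mod_cast hT
    have hmax : max 1 H ≤ T := max_le hT1 hHT
    have hmax1 : 1 ≤ max 1 H := le_max_left _ _
    have hk := hK₁ T (2 * T * max 1 H) hT (by nlinarith) (by nlinarith)
    have hlow := lower_order_terms_le hsa hH₀ hH hc₁ hT hk
    have hmain := hX.integral_regret_le hL hT h𝒢 hcb htc
    linarith
  have hsplit : 1 ≤ T → Real.sqrt T * (T : ℝ) ^ (1 / 6 : ℝ) ≤ N := fun hT => by
    have hT0 : (0 : ℝ) < T := by exact_mod_cast hT
    rw [Real.sqrt_eq_rpow, ← Real.rpow_add hT0]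
    norm_num
    exact hNT hT
  refine ⟨fun hT => ?_, fun hT => ?_⟩
  · have hT1 : 1 ≤ T := hT₀.trans hT
    set k := polyLogConst S A O p₂ T (1 / (4 * (T : ℝ) ^ 2))
    have hN0 : 0 ≤ N := zero_le_one.trans (hN1 hT1)
    have hk1 : 1 ≤ max 1 k := le_max_left _ _
    have hk2 : k ≤ max 1 k := le_max_right _ _
    rcases lt_or_ge (T : ℝ) H with h | h
    · refine (hlong h).trans ?_
      calc H = H * 1 * 1 := by ring
        _ ≤ 13 * H * max 1 k * N := by
          gcongr
          · linarith
          · exact hN1 hT1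
    · refine (hshort hT1 h).trans ?_
      have h1 : H * D * Real.sqrt T * (1 + Real.log T) ^ (d₁ + 2) ≤ H * N := by
        calc _ = H * (Real.sqrt T * (D * (1 + Real.log T) ^ (d₁ + 2))) := by ring
          _ ≤ H * (Real.sqrt T * (T : ℝ) ^ (1 / 6 : ℝ)) := by gcongr; exact hT₀' T hT
          _ ≤ H * N := by gcongr; exact hsplit hT1
      have h2 : 12 * H * k * N ≤ 12 * H * max 1 k * N := by gcongr
      have h3 : H * N ≤ H * max 1 k * N := by
        gcongr; exact le_mul_of_one_le_right hH0.le hk1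
      linarith
  · have hT1 : 1 ≤ T := by omega
    have hT1' : (1 : ℝ) ≤ T := by exact_mod_cast hT1
    have hN0 : 0 ≤ N := zero_le_one.trans (hN1 hT1)
    have hlog : 1 / 2 ≤ Real.log T := by
      have h1 : Real.log 2 ≤ Real.log T :=
        Real.log_le_log (by norm_num) (by exact_mod_cast hT)
      have := Real.log_two_gt_d9
      norm_num at this ⊢
      linarith
    set g := 1 + Real.log T with hg
    have hg1 : 1 ≤ g := by linarith
    have hg3 : g ^ (d₁ + d₂ + 2) ≤ 3 ^ (d₁ + d₂ + 2) * Real.log T ^ (d₁ + d₂ + 2) := by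
      rw [← mul_pow]
      exact pow_le_pow_left₀ (by linarith) (by linarith) _
    have hG1 : 1 ≤ g ^ (d₁ + d₂ + 2) := one_le_pow₀ hg1
    suffices h : ∫ ω, X.regret P L T ω ∂P ≤
        (12 * c₂ + D + 1) * H * N * g ^ (d₁ + d₂ + 2) by
      refine h.trans ?_
      calc _ ≤ (12 * c₂ + D + 1) * H * N *
            (3 ^ (d₁ + d₂ + 2) * Real.log T ^ (d₁ + d₂ + 2)) := by gcongr
        _ = _ := by ring
    rcases lt_or_ge (T : ℝ) H with h | h
    · refine (hlong h).trans ?_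
      calc H = 1 * H * 1 * 1 := by ring
        _ ≤ (12 * c₂ + D + 1) * H * N * g ^ (d₁ + d₂ + 2) := by
          gcongr
          · linarith
          · exact hN1 hT1
    · refine (hshort hT1 h).trans ?_
      have hk := hK₂ T (4 * (T : ℝ) ^ 2) hT1 (by nlinarith) le_rfl
      have hsT : Real.sqrt T ≤ N := by
        refine le_trans (le_mul_of_one_le_right (Real.sqrt_nonneg _) ?_) (hsplit hT1)
        exact Real.one_le_rpow hT1' (by norm_num)
      have h1 : 12 * H * polyLogConst S A O p₂ T (1 / (4 * (T : ℝ) ^ 2)) * N ≤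
          12 * H * (c₂ * g ^ (d₁ + d₂ + 2)) * N := by
        have : c₂ * g ^ d₂ ≤ c₂ * g ^ (d₁ + d₂ + 2) :=
          mul_le_mul_of_nonneg_left (pow_le_pow_right₀ hg1 (by omega)) hc₂
        gcongr
        exact hk.trans this
      have h2 : H * D * Real.sqrt T * g ^ (d₁ + 2) ≤ H * D * N * g ^ (d₁ + d₂ + 2) := by
        gcongr
        omega
      have h3 : 0 ≤ H * N * g ^ (d₁ + d₂ + 2) := by positivity
      linarith

end Trajectory.IsPSRLRun

theorem mainTheorem1 {S A O : Type*} [Fintype S] [Fintype A] [Fintype O]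
    [MeasurableSpace S] [DiscreteMeasurableSpace S]
    [MeasurableSpace A] [DiscreteMeasurableSpace A]
    [MeasurableSpace O] [DiscreteMeasurableSpace O] :
    -- the explicit bound
    (∀ (Ω : Type uΩ) (𝒢 : MeasurableSpace Ω) [mΩ : MeasurableSpace Ω] (P : Measure Ω) [IsProbabilityMeasure P]
        (L : Setup S A O) (X : Trajectory S A O Ω) (H : ℝ),
      L.IsAdmissible H → X.IsPSRLRun P L →
      ∀ (T : ℕ) (K₁ K₂ : ℝ → ℝ), 1 ≤ T → 𝒢 ≤ mΩ →
        X.ConcentratingBelief 𝒢 P L T K₁ → X.TransitionConcentration P T K₂ →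
        Integrable (X.excessCost L T) P ∧
        ∫ ω, X.regret P L T ω ∂P ≤
          (1 + H) * Real.sqrt
            (2 * T * (1 + Fintype.card S * Fintype.card A * Real.logb 2 (T + 1)))
          + 12 * H * K₂ (1 / (4 * (T : ℝ) ^ 2)) *
            ((Fintype.card S * Fintype.card A * T : ℝ) ^ (2 / 3 : ℝ))
          + 7 * (H + 1) * K₁ (1 / (2 * T * max 1 H)) * Real.sqrt (2 * T) *
            (1 + Fintype.card S * Fintype.card A * Real.logb 2 (T + 1)) *
            Real.log (Real.sqrt (2 * T))
          + 2 + H) ∧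
    -- the rate, for constants that are polynomial in the sizes and in `log (|S| |A| |O| T / δ)`
    (∀ (p₁ p₂ : MvPolynomial (Fin 4) ℝ) (H₀ : ℝ), 0 < H₀ →
      ∃ (T₀ : ℕ) (C : ℝ) (q : ℕ),
        ∀ (Ω : Type uΩ) (𝒢 : MeasurableSpace Ω) [mΩ : MeasurableSpace Ω] (P : Measure Ω) [IsProbabilityMeasure P]
          (L : Setup S A O) (X : Trajectory S A O Ω) (H : ℝ), H₀ ≤ H →
        L.IsAdmissible H → X.IsPSRLRun P L →
        ∀ (T : ℕ), 𝒢 ≤ mΩ →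
          X.ConcentratingBelief 𝒢 P L T (polyLogConst S A O p₁ T) →
          X.TransitionConcentration P T (polyLogConst S A O p₂ T) →
          (T₀ ≤ T → ∫ ω, X.regret P L T ω ∂P ≤
            13 * H * max 1 (polyLogConst S A O p₂ T (1 / (4 * (T : ℝ) ^ 2))) *
              ((Fintype.card S * Fintype.card A * T : ℝ) ^ (2 / 3 : ℝ))) ∧
          (2 ≤ T → ∫ ω, X.regret P L T ω ∂P ≤
            C * H * ((Fintype.card S * Fintype.card A * T : ℝ) ^ (2 / 3 : ℝ)) *
              Real.log T ^ q)) := by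
  refine ⟨?_, fun p₁ p₂ H₀ hH₀ => ?_⟩
  · intro Ω 𝒢 mΩ P _ L X H hL hX T K₁ K₂ hT h𝒢 hcb htc
    exact ⟨hX.integrable_excessCost hL T, hX.integral_regret_le hL hT h𝒢 hcb htc⟩
  · by_cases hne : Nonempty S ∧ Nonempty A ∧ Nonempty O
    · obtain ⟨_, _, _⟩ := hne
      exact Trajectory.IsPSRLRun.exists_integral_regret_le p₁ p₂ hH₀
    -- A trajectory on a probability space has values in S, A and O, so if one of these sets is
    -- empty no run exists and any constants do.
    · refine ⟨0, 0, 0, ?_⟩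
      intro Ω _ _ P _ _ X
      obtain ⟨ω⟩ := P.nonempty_of_neZero
      exact absurd ⟨⟨X.state 0 ω⟩, ⟨X.act 0 ω⟩, ⟨X.obs 0 ω⟩⟩ hne
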